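/- Let $p\in(2,3]$ and let $(Y_i)_{i\in\mathbb Z}$ be a strictly stationary sequence of centered real random variables in $\mathbb L^p$. Put $\mathcal G_0=\sigma(Y_i,\ i\le 0)$, $\gamma_k=\mathrm{Cov}(Y_0,Y_k)$, \[ \lambda_k=\max\Big(\|Y_0\,\mathbb E(Y_k|\mathcal G_0)\|_{p/2},\ \sup_{j\ge i\ge k}\|\mathbb E(Y_iY_j|\mathcal G_0)-\mathbb E(Y_iY_j)\|_{p/2}\Big),\quad \Lambda_n=\sum_{i=1}^n i\lambda_i,\quad \eta_n=\sum_{i=0}^n\|\mathbb E(Y_i|\mathcal G_0)\|_p . \] Let $(\alpha_{i,n})$ be a triangular array of real numbers and put $m_n=\max_{1\le\ell\le n}|\alpha_{\ell,n}|$, $S_n=\sum_{i=1}^n\alpha_{i,n}Y_i$, $V_n=\mathrm{Var}(S_n)$, and \[ B(n,p)=\begin{cases} m_n^{p-2}\,\eta_n^{p-2}\,(\Lambda_n+\eta_n^2)\,\big(\sum_{\ell=1}^n\alpha_{\ell,n}^2\big)^{(3-p)/2} & \text{if } p\in(2,3),\\[2pt] m_n\,\eta_n\,(\Lambda_n+\eta_n^2)\,\log\big(m_n^{-2}\sum_{\ell=1}^n\alpha_{\ell,n}^2\big)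 & \text{if } p=3,\end{cases} \] where $B(n,p)=0$ if $m_n=0$. Assume that $\sum_{k\ge0}|\gamma_k|<\infty$ and that the spectral density $f_Y(\theta)=\frac1{2\pi}\sum_{k\in\mathbb Z}\gamma_k e^{ik\theta}$ satisfies $\inf_{t\in[-\pi,\pi]}|f_Y(t)|>0$. Then there is a constant $C>0$, not depending on $n$, such that for every $n\ge1$ \[ W_1(P_{S_n},G_{V_n})\le C\Big(m_n\sum_{k=0}^n\|\mathbb E(Y_k|\mathcal G_0)\|_2+B(n,p)\Big). \] Here $P_{S_n}$ is the law of $S_n$, $G_v$ is the normal law $\mathcal N(0,v)$ (with $\mathcal N(0,0)=\delta_0$), and $W_1(\mu,\nu)=\inf\int|x-y|\,\pi(dx,dy)$, the infimum being over all laws $\pi$ on $\mathbb R^2$ with marginals $\mu$ and $\nu$. -/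

import Mathlib

open MeasureTheory ProbabilityTheory
open scoped ENNReal NNReal

noncomputable section

namespace LinearStatistic

/-- The Wasserstein distance of order one between two laws on the real line: the infimum of
`∫ |x - y| dπ(x, y)` over all laws `π` on the plane with marginals `μ` and `ν`. -/
def wasserstein1 (μ ν : Measure ℝ) : ℝ≥0∞ :=
  ⨅ (π : Measure (ℝ × ℝ)) (_ : π.map Prod.fst = μ ∧ π.map Prod.snd = ν),
    ∫⁻ z, ENNReal.ofReal |z.1 - z.2| ∂π

/-- The centered normal law with variance `v` (for `v = 0` the Dirac mass at `0`). -/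
def centeredGaussian (v : ℝ) : Measure ℝ := gaussianReal 0 v.toNNReal

/-- Strict stationarity: every shift of the process has the same law, on the product
sigma-algebra of `ℝ^ℤ`, as the process itself. -/
def StrictlyStationary {Ω : Type*} [MeasurableSpace Ω] (P : Measure Ω) (Y : ℤ → Ω → ℝ) : Prop :=
  ∀ h : ℤ, P.map (fun ω (i : ℤ) => Y (i + h) ω) = P.map (fun ω (i : ℤ) => Y i ω)

/-- `G_k = σ(Y_i, i ≤ k)`. -/
@[reducible] def past {Ω : Type*} (Y : ℤ → Ω → ℝ) (k : ℤ) : MeasurableSpace Ω :=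
  ⨆ i : ℤ, ⨆ _ : i ≤ k, MeasurableSpace.comap (Y i) inferInstance

/-- `γ_k = Cov(Y_0, Y_k)`. -/
def autocov {Ω : Type*} [MeasurableSpace Ω] (P : Measure Ω) (Y : ℤ → Ω → ℝ) (k : ℤ) : ℝ :=
  cov[Y 0, Y k; P]

/-- `f_Y(θ) = (2π)⁻¹ ∑_{k ∈ ℤ} γ_k e^{ikθ}`. -/
def spectralDensity {Ω : Type*} [MeasurableSpace Ω] (P : Measure Ω) (Y : ℤ → Ω → ℝ)
    (θ : ℝ) : ℂ :=
  (1 / (2 * (Real.pi : ℂ))) *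
    ∑' k : ℤ, (autocov P Y k : ℂ) * Complex.exp (Complex.I * (k : ℂ) * (θ : ℂ))

/-- `‖E(Y_k | G_0)‖_q`. -/
def condNorm {Ω : Type*} [MeasurableSpace Ω] (P : Measure Ω) (Y : ℤ → Ω → ℝ)
    (q : ℝ) (k : ℕ) : ℝ :=
  lpNorm (P[Y (k : ℤ) | past Y 0]) (ENNReal.ofReal q) P

/-- `λ_k = max(‖Y_0 E(Y_k | G_0)‖_{p/2}, sup_{j ≥ i ≥ k} ‖E(Y_i Y_j | G_0) - E(Y_i Y_j)‖_{p/2})`.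
The supremum is formed in `[0, ∞]`; it is finite for a stationary sequence in `L^p`, `p ≥ 2`. -/
def lam {Ω : Type*} [MeasurableSpace Ω] (P : Measure Ω) (Y : ℤ → Ω → ℝ)
    (p : ℝ) (k : ℕ) : ℝ :=
  max (lpNorm (fun ω => Y 0 ω * (P[Y (k : ℤ) | past Y 0]) ω) (ENNReal.ofReal (p / 2)) P)
    (⨆ (i : ℤ) (j : ℤ) (_ : (k : ℤ) ≤ i ∧ i ≤ j),
      eLpNorm (fun ω => (P[fun ω' => Y i ω' * Y j ω' | past Y 0]) ω - ∫ ω', Y i ω' * Y j ω' ∂P)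
        (ENNReal.ofReal (p / 2)) P).toReal

/-- `Λ_n = ∑_{i=1}^n i λ_i`. -/
def bigLam {Ω : Type*} [MeasurableSpace Ω] (P : Measure Ω) (Y : ℤ → Ω → ℝ)
    (p : ℝ) (n : ℕ) : ℝ :=
  ∑ i ∈ Finset.Icc 1 n, (i : ℝ) * lam P Y p i

/-- `η_n = ∑_{i=0}^n ‖E(Y_i | G_0)‖_p`. -/
def eta {Ω : Type*} [MeasurableSpace Ω] (P : Measure Ω) (Y : ℤ → Ω → ℝ)
    (p : ℝ) (n : ℕ) : ℝ :=
  ∑ i ∈ Finset.range (n + 1), condNorm P Y p i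

/-- `m_n = max_{1 ≤ l ≤ n} |α_{l,n}|`, where `α l n` stands for `α_{l,n}`. -/
def maxCoeff (α : ℕ → ℕ → ℝ) (n : ℕ) : ℝ :=
  (((Finset.Icc 1 n).sup fun l => ‖α l n‖₊ : ℝ≥0) : ℝ)

/-- `∑_{l=1}^n α_{l,n}²`. -/
def sumSq (α : ℕ → ℕ → ℝ) (n : ℕ) : ℝ := ∑ l ∈ Finset.Icc 1 n, (α l n) ^ 2

/-- The linear statistic `S_n = ∑_{i=1}^n α_{i,n} Y_i`. -/
def linStat {Ω : Type*} (Y : ℤ → Ω → ℝ) (α : ℕ → ℕ → ℝ) (n : ℕ) (ω : Ω) : ℝ :=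
  ∑ i ∈ Finset.Icc 1 n, α i n * Y (i : ℤ) ω

/-- The quantity `B(n, p)`, for `p ∈ (2, 3]`:
`m_n^{p-2} η_n^{p-2} (Λ_n + η_n²) (∑ α_{l,n}²)^{(3-p)/2}` if `p < 3`, and
`m_n η_n (Λ_n + η_n²) log (m_n⁻² ∑ α_{l,n}²)` if `p = 3`. -/
def boundB {Ω : Type*} [MeasurableSpace Ω] (P : Measure Ω) (Y : ℤ → Ω → ℝ)
    (α : ℕ → ℕ → ℝ) (p : ℝ) (n : ℕ) : ℝ :=
  if p < 3 then
    maxCoeff α n ^ (p - 2) * eta P Y p n ^ (p - 2) * (bigLam P Y p n + eta P Y p n ^ 2)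
      * sumSq α n ^ ((3 - p) / 2)
  else
    maxCoeff α n * eta P Y p n * (bigLam P Y p n + eta P Y p n ^ 2)
      * Real.log (sumSq α n / maxCoeff α n ^ 2)

end LinearStatistic

end

/-! By Kantorovich duality it suffices to bound `E f(S_n) - E f(N)`, with `N` normal of variance
`V_n`, uniformly over 1-Lipschitz `f`. Such an `f` is too rough for a second order expansion, so it
is convolved with a centered normal law of variance `a²`, where `a = K m_n δ` and `δ` is the sum of
the norms `‖E(Y_k | G_0)‖_2`, `k ≤ n`. This costs `a` on either side and produces the first term of
the bound.

Let `X_l = α_l Y_l`, let `F_k` be the past up to time `k`, `M_k = E(S_n | F_k)` with increments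
`d_k`, and `R_k = E(X_{k+1} + ⋯ + X_n | F_k)`. Put `w_k = a² + E (S_n - M_k)²` and let `u_k` be `f`
smoothed with variance `w_k`. Orthogonality gives `w_k - w_{k+1} = E d_{k+1}²`, hence `u_k` is
`u_{k+1}` smoothed with exactly that variance. The sum of `E u_{k+1}(M_{k+1}) - E u_k(M_k)`
telescopes, and each term is `Cov(u_{k+1}''(M_k), d_{k+1}²) / 2` up to a remainder
(`integral_gaussSmooth_step_le`). This is Lindeberg's method with the heat semigroup in place of
independent normal variables.

The covariances rest on three facts. The function `u_k''` is Hölder of order `p - 2` with constant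
`4 w_k^{-(p-1)/2}` (`abs_gaussHess_sub_le_rpow`). Against `F_k`-measurable factors, `d_{k+1}²` may
be replaced by `X_{k+1}² + 2 X_{k+1}(X_{k+2} + ⋯ + X_n) + R_{k+1}² - R_k²` (`covar_step_sq`), whose
last two terms are summed by parts. For the products `Y_i Y_j`, the factor `u_{k+1}''(M_k)` is
telescoped along the martingale at fixed variance: the increment at time `i` is `F_i`-measurable and
at most a multiple of `|d_i|^{p-2}`, so Hölder's inequality brings in the coefficients `λ`
(`abs_covar_gaussHess_mul_le`). The total is of order `(m_n η_n)^{p-2} (Λ_n + η_n²)` times the sum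
of `w_l^{-(p-1)/2} α_l²`.

The spectral density enters through Toeplitz forms: the variance of `X_{l+1} + ⋯ + X_n` is at least
`κ` times the sum of the `α_j²`, `j > l`. As `a²` dominates `‖R_l‖_2²`, `w_l` is at least a multiple
of `a²` plus that sum, and the weighted sum compares with the integral of `x^{-(p-1)/2}`: a power if
`p < 3`, a logarithm if `p = 3`. If the sum of all `α_l²` is at most `2 m_n²`, where the logarithm
may vanish, the trivial bound `2 √V_n` is already of order `m_n δ`. -/

namespace LinearStatistic

/-! ### Kantorovich duality on the line through the quantile coupling. -/

section Duality

/-- The quantile function of a law on the real line. -/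
noncomputable def quantile (μ : Measure ℝ) (u : ℝ) : ℝ := sInf {x | u ≤ cdf μ x}

/-- Right continuity of the distribution function makes the infimum attained; `0 < u < 1` makes the
set nonempty and bounded below. -/
lemma quantile_le_iff (μ : Measure ℝ) {u : ℝ} (hu0 : 0 < u) (hu1 : u < 1) (x : ℝ) :
    quantile μ u ≤ x ↔ u ≤ cdf μ x := by
  have hne : {x | u ≤ cdf μ x}.Nonempty := by
    obtain ⟨y, hy⟩ := ((tendsto_cdf_atTop μ).eventually (lt_mem_nhds hu1)).exists
    exact ⟨y, hy.le⟩
  have hbdd : BddBelow {x | u ≤ cdf μ x} := by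
    obtain ⟨y, hy⟩ := ((tendsto_cdf_atBot μ).eventually (gt_mem_nhds hu0)).exists
    refine ⟨y, fun z hz => ?_⟩
    by_contra hzy
    have := monotone_cdf μ (not_le.1 hzy).le
    simp only [Set.mem_ofPred_eq] at hz
    linarith
  refine ⟨fun h => ?_, fun h => csInf_le hbdd h⟩
  have hq : u ≤ cdf μ (quantile μ u) := by
    have hr := (cdf μ).right_continuous (quantile μ u)
    have hr' : Filter.Tendsto (cdf μ) (nhdsWithin (quantile μ u) (Set.Ioi (quantile μ u)))
        (nhds (cdf μ (quantile μ u))) := hr.mono_left (nhdsWithin_mono _ Set.Ioi_subset_Ici_self)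
    refine ge_of_tendsto hr' ?_
    filter_upwards [self_mem_nhdsWithin] with y hy
    obtain ⟨z, hz, hzy⟩ := exists_lt_of_csInf_lt hne hy
    exact le_trans hz (monotone_cdf μ hzy.le)
  exact hq.trans (monotone_cdf μ h)

lemma monotoneOn_quantile (μ : Measure ℝ) : MonotoneOn (quantile μ) (Set.Ioo 0 1) := by
  intro u hu v hv huv
  rw [quantile_le_iff μ hu.1 hu.2]
  exact huv.trans ((quantile_le_iff μ hv.1 hv.2 _).1 le_rfl)

lemma aemeasurable_quantile (μ : Measure ℝ) :
    AEMeasurable (quantile μ) (volume.restrict (Set.Ioo (0 : ℝ) 1)) :=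
  aemeasurable_restrict_of_monotoneOn measurableSet_Ioo (monotoneOn_quantile μ)

lemma map_quantile (μ : Measure ℝ) [IsProbabilityMeasure μ] :
    (volume.restrict (Set.Ioo (0 : ℝ) 1)).map (quantile μ) = μ := by
  have : IsProbabilityMeasure (volume.restrict (Set.Ioo (0 : ℝ) 1)) := ⟨by simp⟩
  have := Measure.isProbabilityMeasure_map (aemeasurable_quantile μ)
  refine Measure.ext_of_Iic _ _ fun x => ?_
  rw [Measure.map_apply_of_aemeasurable (aemeasurable_quantile μ) measurableSet_Iic,
    Measure.restrict_apply' measurableSet_Ioo, ← ofReal_cdf μ x]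
  have h1 : quantile μ ⁻¹' Set.Iic x ∩ Set.Ioo 0 1 = Set.Iic (cdf μ x) ∩ Set.Ioo 0 1 := by
    ext u
    simp only [Set.mem_inter_iff, Set.mem_preimage, Set.mem_Iic, and_congr_left_iff]
    exact fun hu => quantile_le_iff μ hu.1 hu.2 x
  rw [h1]
  -- Whether the endpoint `cdf μ x` belongs to the set depends on its being less than 1; the length
  -- is the same in both cases, so a sandwich suffices.
  have h2 : (Set.Ioo 0 (cdf μ x) : Set ℝ) ⊆ Set.Iic (cdf μ x) ∩ Set.Ioo 0 1 := fun u hu =>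
    ⟨hu.2.le, hu.1, hu.2.trans_le (cdf_le_one μ x)⟩
  have h3 : Set.Iic (cdf μ x) ∩ Set.Ioo 0 1 ⊆ Set.Ioc 0 (cdf μ x) := fun u hu => ⟨hu.2.1, hu.1⟩
  refine le_antisymm ((measure_mono h3).trans (by simp)) (le_trans (by simp) (measure_mono h2))

/-- The Kantorovich-Rubinstein upper bound for the Wasserstein distance. -/
theorem wasserstein1_le {μ ν : Measure ℝ} [IsProbabilityMeasure μ] [IsProbabilityMeasure ν]
    (hμ : Integrable id μ) (hν : Integrable id ν) {K : ℝ}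
    (h : ∀ f : ℝ → ℝ, LipschitzWith 1 f → ∫ x, f x ∂μ - ∫ x, f x ∂ν ≤ K) :
    wasserstein1 μ ν ≤ ENNReal.ofReal K := by
  set U : Measure ℝ := volume.restrict (Set.Ioo (0 : ℝ) 1) with hU
  have hUp : IsProbabilityMeasure U := ⟨by simp [hU]⟩
  have hqμ := aemeasurable_quantile μ
  have hqν := aemeasurable_quantile ν
  have hpair : AEMeasurable (fun u => (quantile μ u, quantile ν u)) U := hqμ.prodMk hqν
  have hmarg : (U.map fun u => (quantile μ u, quantile ν u)).map Prod.fst = μ ∧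
      (U.map fun u => (quantile μ u, quantile ν u)).map Prod.snd = ν := by
    constructor
    · rw [AEMeasurable.map_map_of_aemeasurable measurable_fst.aemeasurable hpair]
      exact map_quantile μ
    · rw [AEMeasurable.map_map_of_aemeasurable measurable_snd.aemeasurable hpair]
      exact map_quantile ν
  refine (iInf₂_le (U.map fun u => (quantile μ u, quantile ν u)) hmarg).trans ?_
  rw [lintegral_map' (by fun_prop) hpair]
  -- Between the two quantiles of a level `u` the distribution functions are strictly ordered, so
  -- this sign is constant there. Its primitive `H` is therefore one 1-Lipschitz function that
  -- realizes the cost of the coupling at every level.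
  set s : ℝ → ℝ := fun x => if cdf ν x ≤ cdf μ x then -1 else 1 with hs
  have hsm : Measurable s := Measurable.ite
    (measurableSet_le (monotone_cdf ν).measurable (monotone_cdf μ).measurable)
    measurable_const measurable_const
  have hsb : ∀ x, ‖s x‖ ≤ 1 := fun x => by simp only [hs]; split_ifs <;> simp
  have hsi : ∀ a b, IntervalIntegrable s volume a b := fun a b =>
    (intervalIntegrable_const (c := (1 : ℝ))).mono_fun hsm.aestronglyMeasurable
      (Filter.Eventually.of_forall fun x => by simpa using hsb x)
  set H : ℝ → ℝ := fun x => ∫ t in (0 : ℝ)..x, s t with hH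
  have hHsub : ∀ a b, H b - H a = ∫ t in a..b, s t := fun a b =>
    intervalIntegral.integral_interval_sub_left (hsi _ _) (hsi _ _)
  have hHL : LipschitzWith 1 H := LipschitzWith.of_dist_le_mul fun x y => by
    rw [Real.dist_eq, hHsub, Real.dist_eq, ← Real.norm_eq_abs]
    simpa using intervalIntegral.norm_integral_le_of_norm_le_const (a := y) (b := x) (f := s)
      (C := 1) fun t _ => hsb t
  have key : ∀ u ∈ Set.Ioo (0 : ℝ) 1,
      |quantile μ u - quantile ν u| = H (quantile μ u) - H (quantile ν u) := by
    intro u hu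
    rw [hHsub]
    rcases le_total (quantile μ u) (quantile ν u) with hle | hle
    · rw [abs_of_nonpos (sub_nonpos.2 hle), intervalIntegral.integral_symm,
        intervalIntegral.integral_congr_Ioo_of_le (g := fun _ => (-1 : ℝ)) hle]
      · simp
      · intro x hx
        have h1 : u ≤ cdf μ x := (quantile_le_iff μ hu.1 hu.2 x).1 hx.1.le
        have h2 : cdf ν x < u := not_le.1 fun hc =>
          absurd ((quantile_le_iff ν hu.1 hu.2 x).2 hc) (not_le.2 hx.2)
        simp only [hs]
        rw [if_pos (by linarith)]
    · rw [abs_of_nonneg (sub_nonneg.2 hle),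
        intervalIntegral.integral_congr_Ioo_of_le (g := fun _ => (1 : ℝ)) hle]
      · simp
      · intro x hx
        have h1 : u ≤ cdf ν x := (quantile_le_iff ν hu.1 hu.2 x).1 hx.1.le
        have h2 : cdf μ x < u := not_le.1 fun hc =>
          absurd ((quantile_le_iff μ hu.1 hu.2 x).2 hc) (not_le.2 hx.2)
        simp only [hs]
        rw [if_neg (by linarith)]
  have hint : ∀ {ρ : Measure ℝ} [IsProbabilityMeasure ρ], Integrable id ρ → Integrable H ρ := by
    intro ρ _ hρ
    refine (hρ.norm.add (integrable_const |H 0|)).mono' hHL.continuous.aestronglyMeasurable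
      (Filter.Eventually.of_forall fun x => ?_)
    have := hHL.dist_le_mul x 0
    simp only [Real.dist_eq, NNReal.coe_one, one_mul, sub_zero] at this
    simp only [Pi.add_apply, id, Real.norm_eq_abs]
    have h3 := abs_sub_abs_le_abs_sub (H x) (H 0)
    linarith
  have hiμ : Integrable (fun u => H (quantile μ u)) U := by
    have h1 := hint hμ
    rw [← map_quantile μ] at h1
    exact h1.comp_aemeasurable hqμ
  have hiν : Integrable (fun u => H (quantile ν u)) U := by
    have h1 := hint hν
    rw [← map_quantile ν] at h1
    exact h1.comp_aemeasurable hqν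
  have e1 : ∫⁻ u, ENNReal.ofReal |quantile μ u - quantile ν u| ∂U
      = ∫⁻ u, ENNReal.ofReal (H (quantile μ u) - H (quantile ν u)) ∂U := by
    refine setLIntegral_congr_fun measurableSet_Ioo fun u hu => ?_
    simp only [key u hu]
  have e2 : ∀ᵐ u ∂U, 0 ≤ H (quantile μ u) - H (quantile ν u) := by
    filter_upwards [ae_restrict_mem measurableSet_Ioo] with u hu
    rw [← key u hu]
    exact abs_nonneg _
  simp only
  rw [e1, ← ofReal_integral_eq_lintegral_ofReal
    (f := fun u => H (quantile μ u) - H (quantile ν u)) (hiμ.sub hiν) e2, integral_sub hiμ hiν]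
  refine ENNReal.ofReal_le_ofReal ((le_of_eq ?_).trans (h H hHL))
  congr 1
  · conv_rhs => rw [← map_quantile μ]
    exact (integral_map hqμ hHL.continuous.aestronglyMeasurable).symm
  · conv_rhs => rw [← map_quantile ν]
    exact (integral_map hqν hHL.continuous.aestronglyMeasurable).symm

end Duality

/-! ### Gaussian smoothing of Lipschitz functions and its derivative. -/

section Smoothing

lemma integral_abs_le_sqrt {Ω : Type*} [MeasurableSpace Ω] {P : Measure Ω} [IsProbabilityMeasure P]
    {X : Ω → ℝ} (hX : MemLp X 2 P) : ∫ ω, |X ω| ∂P ≤ √(∫ ω, X ω ^ 2 ∂P) := by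
  have h := variance_nonneg (fun ω => |X ω|) P
  rw [variance_eq_sub (by simpa using hX.norm)] at h
  simp only [Pi.pow_apply, sq_abs] at h
  exact Real.le_sqrt_of_sq_le (by linarith)

instance (v : ℝ) : IsProbabilityMeasure (centeredGaussian v) := by
  unfold centeredGaussian; infer_instance

lemma memLp_id_centeredGaussian (v : ℝ) {q : ℝ≥0∞} (hq : q ≠ ∞) :
    MemLp id q (centeredGaussian v) := memLp_id_gaussianReal' q hq

lemma integrable_id_centeredGaussian (v : ℝ) : Integrable id (centeredGaussian v) :=
  memLp_one_iff_integrable.1 (memLp_id_centeredGaussian v (by simp))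

lemma integral_id_centeredGaussian (v : ℝ) : ∫ z, z ∂(centeredGaussian v) = 0 :=
  integral_id_gaussianReal

lemma integral_sq_centeredGaussian {v : ℝ} (hv : 0 ≤ v) : ∫ z, z ^ 2 ∂(centeredGaussian v) = v := by
  have h := variance_eq_sub (memLp_id_centeredGaussian v (q := 2) (by simp))
  have h2 : Var[id; centeredGaussian v] = v := by
    unfold centeredGaussian
    rw [variance_id_gaussianReal, Real.coe_toNNReal _ hv]
  rw [h2] at h
  simp only [Pi.pow_apply, id, integral_id_centeredGaussian] at h
  linarith

lemma integral_abs_centeredGaussian_le {v : ℝ} (hv : 0 ≤ v) :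
    ∫ z, |z| ∂(centeredGaussian v) ≤ √v := by
  have := integral_abs_le_sqrt (memLp_id_centeredGaussian v (q := 2) (by simp))
  simpa [integral_sq_centeredGaussian hv] using this

lemma integrable_comp_of_lipschitz {Ω : Type*} [MeasurableSpace Ω] {P : Measure Ω}
    [IsFiniteMeasure P] {f : ℝ → ℝ} {L : ℝ≥0} (hf : LipschitzWith L f) {X : Ω → ℝ}
    (hX : Integrable X P) : Integrable (fun ω => f (X ω)) P := by
  refine ((hX.norm.const_mul (L : ℝ)).add (integrable_const |f 0|)).mono'
    (hf.continuous.comp_aestronglyMeasurable hX.aestronglyMeasurable)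
    (Filter.Eventually.of_forall fun ω => ?_)
  have := hf.dist_le_mul (X ω) 0
  simp only [Real.dist_eq, sub_zero] at this
  simp only [Pi.add_apply, Real.norm_eq_abs]
  have h3 := abs_sub_abs_le_abs_sub (f (X ω)) (f 0)
  linarith

lemma integrable_add_centeredGaussian {f : ℝ → ℝ} {L : ℝ≥0} (hf : LipschitzWith L f) (v x : ℝ) :
    Integrable (fun z => f (x + z)) (centeredGaussian v) :=
  integrable_comp_of_lipschitz hf ((integrable_const x).add (integrable_id_centeredGaussian v))

/-- The convolution of `f` with the centered normal law of variance `v`. -/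
noncomputable def gaussSmooth (v : ℝ) (f : ℝ → ℝ) (x : ℝ) : ℝ :=
  ∫ z, f (x + z) ∂(centeredGaussian v)

lemma lipschitzWith_gaussSmooth {f : ℝ → ℝ} {L : ℝ≥0} (hf : LipschitzWith L f) (v : ℝ) :
    LipschitzWith L (gaussSmooth v f) := by
  refine LipschitzWith.of_dist_le_mul fun x y => ?_
  rw [Real.dist_eq, gaussSmooth, gaussSmooth, ← integral_sub
    (integrable_add_centeredGaussian hf v x) (integrable_add_centeredGaussian hf v y)]
  have := norm_integral_le_of_norm_le_const (μ := centeredGaussian v)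
    (f := fun z => f (x + z) - f (y + z)) (C := L * dist x y)
    (Filter.Eventually.of_forall fun z => by
      have := hf.dist_le_mul (x + z) (y + z)
      simpa [Real.dist_eq] using this)
  simpa using this

/-- Semigroup property: convolving centered normal laws adds their variances. Every later change of
variance goes through it. -/
lemma gaussSmooth_gaussSmooth {f : ℝ → ℝ} {L : ℝ≥0} (hf : LipschitzWith L f) {v w : ℝ}
    (hv : 0 ≤ v) (hw : 0 ≤ w) : gaussSmooth v (gaussSmooth w f) = gaussSmooth (v + w) f := by
  ext x
  have hconv : centeredGaussian (v + w) = (centeredGaussian v) ∗ (centeredGaussian w) := by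
    unfold centeredGaussian
    rw [gaussianReal_conv_gaussianReal, Real.toNNReal_add hv hw, add_zero]
  have hi := integrable_add_centeredGaussian hf (v + w) x
  unfold gaussSmooth
  rw [hconv] at hi ⊢
  rw [integral_conv hi]
  simp only [add_assoc]

lemma abs_gaussSmooth_sub_le {f : ℝ → ℝ} (hf : LipschitzWith 1 f) {v : ℝ} (hv : 0 ≤ v) (x : ℝ) :
    |gaussSmooth v f x - f x| ≤ √v := by
  have h1 : gaussSmooth v f x - f x = ∫ z, (f (x + z) - f x) ∂(centeredGaussian v) := by
    rw [integral_sub (integrable_add_centeredGaussian hf v x) (integrable_const _)]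
    simp [gaussSmooth]
  rw [h1]
  refine (abs_integral_le_integral_abs).trans (le_trans ?_ (integral_abs_centeredGaussian_le hv))
  refine integral_mono_of_nonneg (Filter.Eventually.of_forall fun z => abs_nonneg _)
    (integrable_id_centeredGaussian v).abs (Filter.Eventually.of_forall fun z => ?_)
  simpa [Real.dist_eq] using hf.dist_le_mul (x + z) x

/-- Differentiation under the smoothing integral. -/
lemma hasDerivAt_gaussSmooth_of_hasDerivAt {u u' : ℝ → ℝ} {L : ℝ≥0} (hu : LipschitzWith L u)
    (hu' : Continuous u') (hd : ∀ x, HasDerivAt u (u' x) x) (v x : ℝ) :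
    HasDerivAt (gaussSmooth v u) (gaussSmooth v u' x) x := by
  have hb : ∀ x, ‖u' x‖ ≤ L := fun x => by
    rw [← (hd x).deriv]; exact norm_deriv_le_of_lipschitz hu
  refine (hasDerivAt_integral_of_dominated_loc_of_deriv_le (bound := fun _ => (L : ℝ))
    (F := fun x z => u (x + z)) (F' := fun x z => u' (x + z)) Filter.univ_mem
    (Filter.Eventually.of_forall fun y => (integrable_add_centeredGaussian hu v y).aestronglyMeasurable)
    (integrable_add_centeredGaussian hu v x) ?_ ?_ (integrable_const _) ?_).2
  · exact (hu'.comp (continuous_const.add continuous_id)).aestronglyMeasurable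
  · exact Filter.Eventually.of_forall fun z y _ => hb _
  · exact Filter.Eventually.of_forall fun z y _ => (hd (y + z)).comp_add_const y z

/-- The derivative of the convolution of `f` with the centered normal law of variance `s`. -/
noncomputable def gaussDeriv (s : ℝ) (f : ℝ → ℝ) (x : ℝ) : ℝ :=
  ∫ z, f (x + z) * (z / s) ∂(centeredGaussian s)

lemma integral_centeredGaussian_eq {s : ℝ} (hs : 0 < s) (g : ℝ → ℝ) :
    ∫ z, g z ∂(centeredGaussian s)
      = ∫ z, (√(2 * Real.pi * s))⁻¹ * Real.exp (-z ^ 2 / (2 * s)) * g z := by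
  unfold centeredGaussian
  rw [integral_gaussianReal_eq_integral_smul (by simpa using hs)]
  simp [gaussianPDFReal, hs.le]

/-- After the translation `y = x + z` the point `x` occurs only in the density, so the derivative
falls on the density and none of `f` is needed; the Lipschitz bound only serves to make `f` grow at
most linearly. -/
lemma hasDerivAt_gaussSmooth {f : ℝ → ℝ} {L : ℝ≥0} (hf : LipschitzWith L f) {s : ℝ} (hs : 0 < s)
    (x₀ : ℝ) : HasDerivAt (gaussSmooth s f) (gaussDeriv s f x₀) x₀ := by
  set c : ℝ := (√(2 * Real.pi * s))⁻¹ with hc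
  have hc0 : 0 ≤ c := by positivity
  have e1 : gaussSmooth s f
      = fun x => ∫ y, c * Real.exp (-(y - x) ^ 2 / (2 * s)) * f y := by
    ext x
    rw [gaussSmooth, integral_centeredGaussian_eq hs, ← integral_sub_right_eq_self _ x]
    simp [hc]
  have e2 : gaussDeriv s f x₀
      = ∫ y, c * (Real.exp (-(y - x₀) ^ 2 / (2 * s)) * ((y - x₀) / s)) * f y := by
    rw [gaussDeriv, integral_centeredGaussian_eq hs, ← integral_sub_right_eq_self _ x₀]
    congr 1
    ext y
    simp only [hc, add_sub_cancel]
    ring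
  rw [e1, e2]
  have hfb : ∀ y, |f y| ≤ |f x₀| + L * |y - x₀| := fun y => by
    have := hf.dist_le_mul y x₀
    simp only [Real.dist_eq] at this
    have h3 := abs_sub_abs_le_abs_sub (f y) (f x₀)
    linarith
  -- From `(y - x₀)² ≤ 2 (y - x)² + 2 (x - x₀)²`: halving the exponent gives a Gaussian bound
  -- uniform over the ball.
  have hexp : ∀ x ∈ Metric.ball x₀ 1, ∀ y, Real.exp (-(y - x) ^ 2 / (2 * s))
      ≤ Real.exp (1 / (2 * s)) * Real.exp (-(1 / (4 * s)) * (y - x₀) ^ 2) := by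
    intro x hx y
    rw [← Real.exp_add, Real.exp_le_exp]
    have hx' : (x - x₀) ^ 2 ≤ 1 := by
      rw [Metric.mem_ball, Real.dist_eq] at hx
      have := abs_lt.1 hx
      nlinarith
    have h4 : -(y - x) ^ 2 ≤ 1 - (y - x₀) ^ 2 / 2 := by
      nlinarith [sq_nonneg ((y - x) + (x₀ - x))]
    have : 1 / (2 * s) + -(1 / (4 * s)) * (y - x₀) ^ 2 = (1 - (y - x₀) ^ 2 / 2) / (2 * s) := by
      field_simp
      ring
    rw [this]
    gcongr
  set A : ℝ := c * Real.exp (1 / (2 * s)) * (1 + 1 / s) * (|f x₀| + L) * 2 with hA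
  have hbint : Integrable fun y : ℝ =>
      A * ((1 + (y - x₀) ^ 2) * Real.exp (-(1 / (4 * s)) * (y - x₀) ^ 2)) := by
    have hb : 0 < 1 / (4 * s) := by positivity
    have h1 := integrable_exp_neg_mul_sq hb
    have h2 := integrable_rpow_mul_exp_neg_mul_sq hb (s := 2) (by norm_num)
    have h3 : Integrable fun y : ℝ => (1 + y ^ 2) * Real.exp (-(1 / (4 * s)) * y ^ 2) := by
      refine (h1.add h2).congr (Filter.Eventually.of_forall fun y => ?_)
      simp only [Pi.add_apply, Real.rpow_two]
      ring
    exact (h3.comp_sub_right x₀).const_mul A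
  have hfm : Measurable f := hf.continuous.measurable
  -- The factor `t` lets one estimate serve the integrand (`t = 1`) and its derivative in `x` (`t =
  -- (y - x) / s`).
  have key : ∀ x ∈ Metric.ball x₀ 1, ∀ y, ∀ t : ℝ, |t| ≤ 1 + (1 + |y - x₀|) / s →
      ‖c * (Real.exp (-(y - x) ^ 2 / (2 * s)) * t) * f y‖
        ≤ A * ((1 + (y - x₀) ^ 2) * Real.exp (-(1 / (4 * s)) * (y - x₀) ^ 2)) := by
    intro x hx y t ht
    rw [norm_mul, norm_mul, norm_mul, Real.norm_eq_abs c, abs_of_nonneg hc0, Real.norm_eq_abs,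
      abs_of_nonneg (Real.exp_nonneg _), Real.norm_eq_abs, Real.norm_eq_abs]
    have h5 : |t| * |f y| ≤ (1 + 1 / s) * (|f x₀| + L) * 2 * (1 + (y - x₀) ^ 2) := by
      set r := |y - x₀| with hr
      have hr0 : 0 ≤ r := abs_nonneg _
      have hs' : 0 ≤ 1 / s := by positivity
      have e : (y - x₀) ^ 2 = r ^ 2 := (sq_abs _).symm
      have h6 : |t| ≤ (1 + 1 / s) * (1 + r) := by
        refine ht.trans ?_
        have : (1 + r) / s = (1 / s) * (1 + r) := by ring
        rw [this]
        nlinarith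
      have h7 : |f y| ≤ (|f x₀| + L) * (1 + r) := by
        refine (hfb y).trans ?_
        have h8 : (0 : ℝ) ≤ L := L.2
        nlinarith [abs_nonneg (f x₀), mul_nonneg (abs_nonneg (f x₀)) hr0]
      calc |t| * |f y| ≤ ((1 + 1 / s) * (1 + r)) * ((|f x₀| + L) * (1 + r)) := by gcongr
        _ = (1 + 1 / s) * (|f x₀| + L) * (1 + r) ^ 2 := by ring
        _ ≤ (1 + 1 / s) * (|f x₀| + L) * (2 * (1 + r ^ 2)) := by
          gcongr
          nlinarith [sq_nonneg (1 - r)]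
        _ = _ := by rw [e]; ring
    calc c * (Real.exp (-(y - x) ^ 2 / (2 * s)) * |t|) * |f y|
        = c * Real.exp (-(y - x) ^ 2 / (2 * s)) * (|t| * |f y|) := by ring
      _ ≤ c * (Real.exp (1 / (2 * s)) * Real.exp (-(1 / (4 * s)) * (y - x₀) ^ 2))
          * ((1 + 1 / s) * (|f x₀| + L) * 2 * (1 + (y - x₀) ^ 2)) := by
        gcongr
        exact hexp x hx y
      _ = _ := by rw [hA]; ring
  refine (hasDerivAt_integral_of_dominated_loc_of_deriv_le
    (F := fun x y => c * Real.exp (-(y - x) ^ 2 / (2 * s)) * f y)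
    (F' := fun x y => c * (Real.exp (-(y - x) ^ 2 / (2 * s)) * ((y - x) / s)) * f y)
    (Metric.ball_mem_nhds x₀ one_pos)
    (Filter.Eventually.of_forall fun x => by fun_prop) ?_ (by fun_prop) ?_ hbint ?_).2
  · refine hbint.mono' (by fun_prop) (Filter.Eventually.of_forall fun y => ?_)
    have := key x₀ (Metric.mem_ball_self one_pos) y 1 (by
      rw [abs_one]; have : 0 ≤ (1 + |y - x₀|) / s := by positivity
      linarith)
    simpa using this
  · refine Filter.Eventually.of_forall fun y x hx => key x hx y _ ?_
    rw [Metric.mem_ball, Real.dist_eq, abs_sub_comm] at hx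
    rw [abs_div, abs_of_pos hs]
    have : |y - x| ≤ 1 + |y - x₀| := by
      have := abs_sub_le y x₀ x
      linarith
    have h9 : |y - x| / s ≤ (1 + |y - x₀|) / s := by gcongr
    linarith
  · refine Filter.Eventually.of_forall fun y x _ => ?_
    have h1 : HasDerivAt (fun x : ℝ => -(y - x) ^ 2 / (2 * s)) ((y - x) / s) x := by
      have := ((((hasDerivAt_id x).const_sub y).pow 2).neg).div_const (2 * s)
      convert! this using 1
      simp
      field_simp
    exact ((h1.exp).const_mul c).mul_const (f y)

/-- A derivative costs `E|Z| / s ≤ 1 / √s`, with `Z` centered normal of variance `s`. -/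
lemma lipschitzWith_gaussDeriv {f : ℝ → ℝ} {L : ℝ≥0} (hf : LipschitzWith L f) {s : ℝ}
    (hs : 0 < s) : LipschitzWith (L * Real.toNNReal (1 / √s)) (gaussDeriv s f) := by
  have hint : ∀ x, Integrable (fun z => f (x + z) * (z / s)) (centeredGaussian s) := fun x => by
    have h1 : MemLp (fun z => f (x + z)) 2 (centeredGaussian s) := by
      have h2 : MemLp (fun z : ℝ => (L : ℝ) * |z| + |f x|) 2 (centeredGaussian s) :=
        ((memLp_id_centeredGaussian s (q := 2) (by simp)).norm.const_mul (L : ℝ)).add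
          (memLp_const _)
      refine h2.mono' (hf.continuous.comp (continuous_const.add continuous_id)).aestronglyMeasurable
        (Filter.Eventually.of_forall fun z => ?_)
      have := hf.dist_le_mul (x + z) x
      simp only [Real.dist_eq, add_sub_cancel_left] at this
      have h3 := abs_sub_abs_le_abs_sub (f (x + z)) (f x)
      rw [Real.norm_eq_abs]
      linarith
    have h2 : MemLp (fun z : ℝ => z / s) 2 (centeredGaussian s) := by
      simpa [div_eq_inv_mul] using
        (memLp_id_centeredGaussian s (q := 2) (by simp)).const_mul s⁻¹
    exact h1.integrable_mul h2
  refine LipschitzWith.of_dist_le_mul fun x y => ?_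
  rw [Real.dist_eq, gaussDeriv, gaussDeriv, ← integral_sub (hint x) (hint y)]
  refine (abs_integral_le_integral_abs).trans ?_
  have h1 : ∫ z, |f (x + z) * (z / s) - f (y + z) * (z / s)| ∂(centeredGaussian s)
      ≤ ∫ z, (L * dist x y / s) * |z| ∂(centeredGaussian s) := by
    refine integral_mono_of_nonneg (Filter.Eventually.of_forall fun z => abs_nonneg _)
      ((integrable_id_centeredGaussian s).abs.const_mul _)
      (Filter.Eventually.of_forall fun z => ?_)
    have := hf.dist_le_mul (x + z) (y + z)
    simp only [Real.dist_eq, add_sub_add_right_eq_sub] at this ⊢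
    rw [← sub_mul, abs_mul, abs_div, abs_of_pos hs]
    calc |f (x + z) - f (y + z)| * (|z| / s) ≤ (L * |x - y|) * (|z| / s) := by gcongr
      _ = _ := by ring
  refine h1.trans ?_
  rw [integral_const_mul]
  have h2 := integral_abs_centeredGaussian_le hs.le
  calc L * dist x y / s * ∫ z, |z| ∂(centeredGaussian s) ≤ L * dist x y / s * √s := by gcongr
    _ = _ := by
      rw [NNReal.coe_mul, Real.coe_toNNReal _ (by positivity)]
      have : √s / s = 1 / √s := by
        rw [div_eq_div_iff hs.ne' (by positivity), one_mul, Real.mul_self_sqrt hs.le]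
      rw [← this]
      ring

end Smoothing

/-! ### Hölder regularity of the second derivative and Taylor expansions. -/

section Regularity

/-- The second derivative of the convolution of `f` with the centered normal law. -/
noncomputable def gaussHess (v : ℝ) (f : ℝ → ℝ) : ℝ → ℝ := deriv (deriv (gaussSmooth v f))

/-- The Hölder constant of order `p - 2` of `gaussHess v f` for a `1`-Lipschitz `f`. -/
noncomputable def holderConst (p v : ℝ) : ℝ := 4 * v ^ (-((p - 1) / 2))

lemma holderConst_nonneg {p v : ℝ} (hv : 0 ≤ v) : 0 ≤ holderConst p v := by
  unfold holderConst; positivity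

lemma holderConst_anti {p v w : ℝ} (hp : 2 < p) (hv : 0 < v) (hvw : v ≤ w) :
    holderConst p w ≤ holderConst p v := by
  unfold holderConst
  have := Real.rpow_le_rpow_of_nonpos hv hvw (z := -((p - 1) / 2)) (by linarith)
  linarith

variable {f : ℝ → ℝ} (hf : LipschitzWith 1 f) {v : ℝ} (hv : 0 < v)

include hf hv

/-- Each half of the variance pays for one derivative: the inner half turns the Lipschitz `f` into
the Lipschitz function `gaussDeriv (v / 2) f`, which the outer half differentiates once more and
leaves Lipschitz. -/
lemma gaussSmooth_half : gaussSmooth v f = gaussSmooth (v / 2) (gaussSmooth (v / 2) f) := by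
  rw [gaussSmooth_gaussSmooth hf (by positivity) (by positivity), add_halves]

lemma hasDerivAt_gaussSmooth_half (x : ℝ) :
    HasDerivAt (gaussSmooth v f) (gaussSmooth (v / 2) (gaussDeriv (v / 2) f) x) x := by
  rw [gaussSmooth_half hf hv]
  exact hasDerivAt_gaussSmooth_of_hasDerivAt (lipschitzWith_gaussSmooth hf _)
    (lipschitzWith_gaussDeriv hf (half_pos hv)).continuous
    (hasDerivAt_gaussSmooth hf (half_pos hv)) _ x

lemma deriv_gaussSmooth_half :
    deriv (gaussSmooth v f) = gaussSmooth (v / 2) (gaussDeriv (v / 2) f) :=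
  funext fun x => (hasDerivAt_gaussSmooth_half hf hv x).deriv

lemma hasDerivAt_gaussSmooth_deriv (x : ℝ) :
    HasDerivAt (gaussSmooth v f) (deriv (gaussSmooth v f) x) x :=
  (hasDerivAt_gaussSmooth_half hf hv x).differentiableAt.hasDerivAt

lemma gaussHess_eq : gaussHess v f = gaussDeriv (v / 2) (gaussDeriv (v / 2) f) := by
  rw [gaussHess, deriv_gaussSmooth_half hf hv]
  exact funext fun x => (hasDerivAt_gaussSmooth (lipschitzWith_gaussDeriv hf (half_pos hv))
    (half_pos hv) x).deriv

lemma hasDerivAt_deriv_gaussSmooth (x : ℝ) :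
    HasDerivAt (deriv (gaussSmooth v f)) (gaussHess v f x) x := by
  have h := hasDerivAt_gaussSmooth (lipschitzWith_gaussDeriv hf (half_pos hv)) (half_pos hv) x
  rw [gaussHess, deriv_gaussSmooth_half hf hv]
  exact h.differentiableAt.hasDerivAt

lemma lipschitzWith_deriv_gaussSmooth :
    LipschitzWith (1 * Real.toNNReal (1 / √(v / 2))) (deriv (gaussSmooth v f)) := by
  rw [deriv_gaussSmooth_half hf hv]
  exact lipschitzWith_gaussSmooth (lipschitzWith_gaussDeriv hf (half_pos hv)) _

lemma lipschitzWith_gaussHess : LipschitzWith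
    (1 * Real.toNNReal (1 / √(v / 2)) * Real.toNNReal (1 / √(v / 2))) (gaussHess v f) := by
  rw [gaussHess_eq hf hv]
  exact lipschitzWith_gaussDeriv (lipschitzWith_gaussDeriv hf (half_pos hv)) (half_pos hv)

omit hv in
lemma abs_deriv_gaussSmooth_le (x : ℝ) : |deriv (gaussSmooth v f) x| ≤ 1 := by
  simpa using norm_deriv_le_of_lipschitz (lipschitzWith_gaussSmooth hf v) (x₀ := x)

lemma abs_gaussHess_le (x : ℝ) : |gaussHess v f x| ≤ 2 / √v := by
  have h := norm_deriv_le_of_lipschitz (lipschitzWith_deriv_gaussSmooth hf hv) (x₀ := x)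
  rw [one_mul, Real.coe_toNNReal _ (by positivity)] at h
  refine h.trans ?_
  have h0 : 0 < √v := Real.sqrt_pos.2 hv
  rw [div_le_div_iff₀ (by positivity) h0, one_mul]
  have h4 : √v = √4 * √(v / 4) := by
    rw [← Real.sqrt_mul (by norm_num)]
    congr 1
    ring
  have : √4 = 2 := by
    rw [show (4 : ℝ) = 2 ^ 2 by norm_num, Real.sqrt_sq (by norm_num)]
  rw [h4, this]
  gcongr
  norm_num

lemma abs_gaussHess_sub_le (x y : ℝ) :
    |gaussHess v f x - gaussHess v f y| ≤ 2 / v * |x - y| := by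
  have h := (lipschitzWith_gaussHess hf hv).dist_le_mul x y
  rw [Real.dist_eq, Real.dist_eq, one_mul, NNReal.coe_mul, Real.coe_toNNReal _ (by positivity)] at h
  refine h.trans (le_of_eq ?_)
  congr 1
  rw [div_mul_div_comm, Real.mul_self_sqrt (by positivity)]
  field_simp

lemma continuous_gaussHess : Continuous (gaussHess v f) :=
  (lipschitzWith_gaussHess hf hv).continuous

/-- Interpolation at the scale `√v`: below it the Lipschitz bound `2 / v` is used with `r ≤
r^{p-2}`, which holds since `p - 2 ≤ 1`; above it the uniform bound `2 / √v` is used twice. -/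
lemma abs_gaussHess_sub_le_rpow {p : ℝ} (hp2 : 2 < p) (hp3 : p ≤ 3) (x y : ℝ) :
    |gaussHess v f x - gaussHess v f y| ≤ holderConst p v * |x - y| ^ (p - 2) := by
  have h0 : 0 < √v := Real.sqrt_pos.2 hv
  set r := |x - y| / √v with hr
  have hr0 : 0 ≤ r := by positivity
  have hxy : |x - y| = r * √v := by rw [hr]; field_simp
  have e1 : holderConst p v * |x - y| ^ (p - 2) = 4 * (r ^ (p - 2) * (√v)⁻¹) := by
    rw [hxy, Real.mul_rpow hr0 h0.le, holderConst, Real.sqrt_eq_rpow, ← Real.rpow_mul hv.le,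
      ← Real.rpow_neg hv.le]
    have : v ^ (-(1 / 2) : ℝ) = v ^ (-((p - 1) / 2)) * v ^ (1 / 2 * (p - 2)) := by
      rw [← Real.rpow_add hv]
      congr 1
      ring
    rw [this]
    ring
  rw [e1]
  rcases le_total r 1 with h1 | h1
  · have h2 : r ≤ r ^ (p - 2) := by
      rcases hr0.eq_or_lt with h | h
      · rw [← h, Real.zero_rpow (by linarith)]
      · conv_lhs => rw [← Real.rpow_one r]
        exact Real.rpow_le_rpow_of_exponent_ge h h1 (by linarith)
    calc |gaussHess v f x - gaussHess v f y| ≤ 2 / v * |x - y| := abs_gaussHess_sub_le hf hv x y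
      _ = 2 * (r * (√v)⁻¹) := by
        rw [hxy]
        nth_rw 1 [← Real.sq_sqrt hv.le]
        field_simp
      _ ≤ 4 * (r ^ (p - 2) * (√v)⁻¹) := by gcongr; norm_num
  · have h2 : 1 ≤ r ^ (p - 2) := Real.one_le_rpow h1 (by linarith)
    calc |gaussHess v f x - gaussHess v f y| ≤ |gaussHess v f x| + |gaussHess v f y| := abs_sub _ _
      _ ≤ 2 / √v + 2 / √v := add_le_add (abs_gaussHess_le hf hv x) (abs_gaussHess_le hf hv y)
      _ = 4 * (1 * (√v)⁻¹) := by ring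
      _ ≤ _ := by gcongr

/-- The Hölder bound of the second derivative is carried up by two applications of the mean value
inequality, without keeping the smaller constant that integration would give. -/
lemma abs_gaussSmooth_taylor_le {p : ℝ} (hp2 : 2 < p) (hp3 : p ≤ 3) (x h : ℝ) :
    |gaussSmooth v f (x + h) - gaussSmooth v f x - h * deriv (gaussSmooth v f) x
      - h ^ 2 / 2 * gaussHess v f x| ≤ holderConst p v * |h| ^ p := by
  set φ := gaussSmooth v f with hφ
  set B := holderConst p v with hB
  have hB0 : 0 ≤ B := holderConst_nonneg hv.le
  have hmem : ∀ t ∈ Set.uIcc 0 h, |t| ≤ |h| := fun t ht => by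
    simpa using Set.abs_sub_left_of_mem_uIcc ht
  have h1 : ∀ t ∈ Set.uIcc 0 h,
      |deriv φ (x + t) - deriv φ x - t * gaussHess v f x| ≤ B * |h| ^ (p - 1) := by
    intro t ht
    have hd : ∀ s ∈ Set.uIcc 0 h, HasDerivWithinAt
        (fun s => deriv φ (x + s) - deriv φ x - s * gaussHess v f x)
        (gaussHess v f (x + s) - gaussHess v f x) (Set.uIcc 0 h) s := fun s _ => by
      have := (((hasDerivAt_deriv_gaussSmooth hf hv (x + s)).comp_const_add x s).sub_const
        (deriv φ x)).sub ((hasDerivAt_id s).mul_const (gaussHess v f x))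
      refine HasDerivAt.hasDerivWithinAt ?_
      convert! this using 1
      simp
    have := (convex_uIcc 0 h).norm_image_sub_le_of_norm_hasDerivWithin_le (C := B * |h| ^ (p - 2))
      hd (fun s hs => by
        have h2 := abs_gaussHess_sub_le_rpow hf hv hp2 hp3 (x + s) x
        rw [add_sub_cancel_left] at h2
        refine h2.trans ?_
        have := hmem s hs
        gcongr) Set.left_mem_uIcc ht
    simp only [add_zero, sub_self, zero_mul, sub_zero, Real.norm_eq_abs] at this
    refine this.trans ?_
    calc B * |h| ^ (p - 2) * |t| ≤ B * |h| ^ (p - 2) * |h| :=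
        mul_le_mul_of_nonneg_left (hmem t ht) (by positivity)
      _ = B * |h| ^ (p - 1) := by
        rw [mul_assoc, ← Real.rpow_add_one' (abs_nonneg _) (by linarith)]
        congr 2
        ring
  have hd : ∀ s ∈ Set.uIcc 0 h, HasDerivWithinAt
      (fun s => φ (x + s) - φ x - s * deriv φ x - s ^ 2 / 2 * gaussHess v f x)
      (deriv φ (x + s) - deriv φ x - s * gaussHess v f x) (Set.uIcc 0 h) s := fun s _ => by
    have := ((((hasDerivAt_gaussSmooth_deriv hf hv (x + s)).comp_const_add x s).sub_const
      (φ x)).sub ((hasDerivAt_id s).mul_const (deriv φ x))).sub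
        ((((hasDerivAt_id s).pow 2).div_const 2).mul_const (gaussHess v f x))
    refine HasDerivAt.hasDerivWithinAt ?_
    convert! this using 1
    simp [hφ]
  have := (convex_uIcc 0 h).norm_image_sub_le_of_norm_hasDerivWithin_le (C := B * |h| ^ (p - 1))
    hd h1 Set.left_mem_uIcc Set.right_mem_uIcc
  simp only [add_zero, sub_self, zero_mul, sub_zero, Real.norm_eq_abs] at this
  norm_num at this
  refine this.trans (le_of_eq ?_)
  rw [mul_assoc, ← Real.rpow_add_one' (abs_nonneg _) (by linarith)]
  congr 2
  ring

/-- Differentiation commutes with convolution, so raising the variance merely averages the second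
derivative. -/
lemma gaussHess_add {w : ℝ} (hw : 0 ≤ w) :
    gaussHess (w + v) f = gaussSmooth w (gaussHess v f) := by
  rw [gaussHess, ← gaussSmooth_gaussSmooth hf hw hv.le]
  have h1 : deriv (gaussSmooth w (gaussSmooth v f)) = gaussSmooth w (deriv (gaussSmooth v f)) :=
    funext fun x => (hasDerivAt_gaussSmooth_of_hasDerivAt (lipschitzWith_gaussSmooth hf v)
      (lipschitzWith_deriv_gaussSmooth hf hv).continuous
      (hasDerivAt_gaussSmooth_deriv hf hv) w x).deriv
  rw [h1]
  exact funext fun x => (hasDerivAt_gaussSmooth_of_hasDerivAt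
    (lipschitzWith_deriv_gaussSmooth hf hv) (continuous_gaussHess hf hv)
    (hasDerivAt_deriv_gaussSmooth hf hv) w x).deriv

omit hf hv

/-- The absolute moment of order `q` of the standard normal law. -/
noncomputable def gaussMoment (q : ℝ) : ℝ := ∫ z, |z| ^ q ∂(centeredGaussian 1)

lemma gaussMoment_nonneg (q : ℝ) : 0 ≤ gaussMoment q :=
  integral_nonneg fun _ => by positivity

lemma integrable_abs_rpow_centeredGaussian {q : ℝ} (hq : 0 < q) (v : ℝ) :
    Integrable (fun z => |z| ^ q) (centeredGaussian v) := by
  have := (memLp_id_centeredGaussian v (q := ENNReal.ofReal q) (by simp)).integrable_norm_rpow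
    (by simpa using hq) (by simp)
  simpa [ENNReal.toReal_ofReal hq.le] using this

lemma integral_abs_rpow_centeredGaussian {q s : ℝ} (hs : 0 ≤ s) :
    ∫ z, |z| ^ q ∂(centeredGaussian (s ^ 2)) = s ^ q * gaussMoment q := by
  have h1 : centeredGaussian (s ^ 2) = (centeredGaussian 1).map (s * ·) := by
    unfold centeredGaussian
    rw [gaussianReal_map_const_mul]
    congr 1
    · simp
    · ext
      simp [sq_nonneg]
  rw [h1, integral_map (by fun_prop) (f := fun z => |z| ^ q)
    (measurable_id.abs.pow_const q).aestronglyMeasurable, gaussMoment, ← integral_const_mul]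
  congr 1
  ext z
  rw [abs_mul, abs_of_nonneg hs, Real.mul_rpow hs (abs_nonneg z)]

include hf hv

/-- The second derivative at the larger variance is a normal average of the one at `v`; integrating
the Hölder bound in space thus controls a change of variance, with no estimate in the time of the
heat flow. -/
lemma abs_gaussHess_add_sub_le {p : ℝ} (hp2 : 2 < p) (hp3 : p ≤ 3) {s : ℝ} (hs : 0 ≤ s) (x : ℝ) :
    |gaussHess (s ^ 2 + v) f x - gaussHess v f x|
      ≤ holderConst p v * (s ^ (p - 2) * gaussMoment (p - 2)) := by
  rw [gaussHess_add hf hv (sq_nonneg s), ← integral_abs_rpow_centeredGaussian hs,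
    ← integral_const_mul]
  have h1 : gaussSmooth (s ^ 2) (gaussHess v f) x - gaussHess v f x
      = ∫ z, (gaussHess v f (x + z) - gaussHess v f x) ∂(centeredGaussian (s ^ 2)) := by
    rw [integral_sub (integrable_add_centeredGaussian (lipschitzWith_gaussHess hf hv) _ x)
      (integrable_const _)]
    simp [gaussSmooth]
  rw [h1]
  refine abs_integral_le_integral_abs.trans (integral_mono_of_nonneg
    (Filter.Eventually.of_forall fun z => abs_nonneg _)
    ((integrable_abs_rpow_centeredGaussian (by linarith) _).const_mul _)
    (Filter.Eventually.of_forall fun z => ?_))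
  simpa using abs_gaussHess_sub_le_rpow hf hv hp2 hp3 (x + z) x

/-- The Taylor formula is integrated over a normal displacement: its mean is zero and its second
moment is `s²`, so only the second order term and the remainder survive. -/
lemma abs_gaussSmooth_add_sub_le {p : ℝ} (hp2 : 2 < p) (hp3 : p ≤ 3) {s : ℝ} (hs : 0 ≤ s)
    (x : ℝ) : |gaussSmooth (s ^ 2 + v) f x - gaussSmooth v f x - s ^ 2 / 2 * gaussHess v f x|
      ≤ holderConst p v * (s ^ p * gaussMoment p) := by
  rw [← gaussSmooth_gaussSmooth hf (sq_nonneg s) hv.le, ← integral_abs_rpow_centeredGaussian hs,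
    ← integral_const_mul]
  set φ := gaussSmooth v f
  have i0 := integrable_add_centeredGaussian (lipschitzWith_gaussSmooth hf v) (s ^ 2) x
  have i1 := integrable_id_centeredGaussian (s ^ 2)
  have i2 : Integrable (fun z : ℝ => z ^ 2) (centeredGaussian (s ^ 2)) :=
    (memLp_id_centeredGaussian _ (q := 2) (by simp)).integrable_sq
  have h1 : gaussSmooth (s ^ 2) φ x - φ x - s ^ 2 / 2 * gaussHess v f x
      = ∫ z, (φ (x + z) - φ x - z * deriv φ x - z ^ 2 / 2 * gaussHess v f x)
          ∂(centeredGaussian (s ^ 2)) := by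
    have j1 : Integrable (fun z : ℝ => z * deriv φ x) (centeredGaussian (s ^ 2)) := i1.mul_const _
    have j2 : Integrable (fun z : ℝ => z ^ 2 / 2 * gaussHess v f x) (centeredGaussian (s ^ 2)) :=
      (i2.div_const 2).mul_const _
    have j3 : Integrable (fun z => φ (x + z) - φ x) (centeredGaussian (s ^ 2)) :=
      i0.sub (integrable_const _)
    have j4 : Integrable (fun z => φ (x + z) - φ x - z * deriv φ x) (centeredGaussian (s ^ 2)) :=
      j3.sub j1
    rw [integral_sub j4 j2, integral_sub j3 j1, integral_sub i0 (integrable_const _), integral_mul_const, integral_mul_const,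
      integral_div, integral_sq_centeredGaussian (sq_nonneg s), integral_id_centeredGaussian]
    have e : ∫ z, φ (x + z) ∂(centeredGaussian (s ^ 2)) = gaussSmooth (s ^ 2) φ x := rfl
    rw [e]
    simp
  rw [h1]
  refine abs_integral_le_integral_abs.trans (integral_mono_of_nonneg
    (Filter.Eventually.of_forall fun z => abs_nonneg _)
    ((integrable_abs_rpow_centeredGaussian (by linarith) _).const_mul _)
    (Filter.Eventually.of_forall fun z => ?_))
  exact abs_gaussSmooth_taylor_le hf hv hp2 hp3 x z

end Regularity

/-! ### Norms, conditional expectations and covariance inequalities. -/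

section Tools

variable {Ω : Type*} {m0 : MeasurableSpace Ω} {P : Measure Ω}

lemma integral_abs_rpow_eq_lpNorm_rpow {X : Ω → ℝ} {q : ℝ} (hq : 0 < q)
    (hX : MemLp X (ENNReal.ofReal q) P) :
    ∫ ω, |X ω| ^ q ∂P = lpNorm X (ENNReal.ofReal q) P ^ q := by
  rw [lpNorm_eq_integral_norm_rpow_toReal (by simpa using hq) (by simp) hX.aestronglyMeasurable,
    ENNReal.toReal_ofReal hq.le, ← Real.rpow_mul (integral_nonneg fun _ => by positivity),
    inv_mul_cancel₀ hq.ne', Real.rpow_one]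
  rfl

lemma integral_sq_eq_lpNorm_sq {X : Ω → ℝ} (hX : MemLp X 2 P) :
    ∫ ω, X ω ^ 2 ∂P = lpNorm X 2 P ^ 2 := by
  have h2 : (2 : ℝ≥0∞) = ENNReal.ofReal 2 := by simp
  rw [h2] at hX ⊢
  have := integral_abs_rpow_eq_lpNorm_rpow two_pos hX
  simpa using this

lemma sqrt_integral_sq_eq_lpNorm {X : Ω → ℝ} (hX : MemLp X 2 P) :
    √(∫ ω, X ω ^ 2 ∂P) = lpNorm X 2 P := by
  rw [integral_sq_eq_lpNorm_sq hX, Real.sqrt_sq lpNorm_nonneg]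

lemma lpNorm_sq_half {X : Ω → ℝ} {p : ℝ} (hp : 0 < p) (hX : MemLp X (ENNReal.ofReal p) P) :
    lpNorm (fun ω => X ω ^ 2) (ENNReal.ofReal (p / 2)) P = lpNorm X (ENNReal.ofReal p) P ^ 2 := by
  rw [lpNorm_eq_integral_norm_rpow_toReal (f := fun ω => X ω ^ 2) (by simpa using hp) (by simp)
    (hX.aestronglyMeasurable.pow 2), lpNorm_eq_integral_norm_rpow_toReal (by simpa using hp)
    (by simp) hX.aestronglyMeasurable, ENNReal.toReal_ofReal hp.le,
    ENNReal.toReal_ofReal (by positivity), ← Real.rpow_natCast,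
    ← Real.rpow_mul (integral_nonneg fun _ => by positivity)]
  congr 1
  · refine integral_congr_ae (Filter.Eventually.of_forall fun ω => ?_)
    simp only [norm_pow]
    rw [← Real.rpow_natCast, ← Real.rpow_mul (norm_nonneg _)]
    congr 1
    push_cast
    ring
  · push_cast
    field_simp

lemma holderTriple_half {p : ℝ} (hp : 0 < p) :
    ENNReal.HolderTriple (ENNReal.ofReal p) (ENNReal.ofReal p) (ENNReal.ofReal (p / 2)) := by
  constructor
  rw [← ENNReal.ofReal_inv_of_pos hp, ← ENNReal.ofReal_inv_of_pos (by positivity),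
    ← ENNReal.ofReal_add (by positivity) (by positivity)]
  congr 1
  field_simp
  norm_num

lemma memLp_mul_half {X Y : Ω → ℝ} {p : ℝ} (hp : 0 < p) (hX : MemLp X (ENNReal.ofReal p) P)
    (hY : MemLp Y (ENNReal.ofReal p) P) :
    MemLp (fun ω => X ω * Y ω) (ENNReal.ofReal (p / 2)) P :=
  have := holderTriple_half hp
  MemLp.mul (p := ENNReal.ofReal p) (q := ENNReal.ofReal p) hY hX

lemma memLp_sq_half {X : Ω → ℝ} {p : ℝ} (hp : 0 < p) (hX : MemLp X (ENNReal.ofReal p) P) :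
    MemLp (fun ω => X ω ^ 2) (ENNReal.ofReal (p / 2)) P := by
  simpa [sq] using memLp_mul_half hp hX hX

variable [IsProbabilityMeasure P]

lemma lpNorm_mono_exponent {X : Ω → ℝ} {q r : ℝ≥0∞} (hqr : q ≤ r) (hX : MemLp X r P) :
    lpNorm X q P ≤ lpNorm X r P := by
  rw [← toReal_eLpNorm hX.aestronglyMeasurable, ← toReal_eLpNorm hX.aestronglyMeasurable]
  exact ENNReal.toReal_mono hX.eLpNorm_ne_top
    (eLpNorm_le_eLpNorm_of_exponent_le hqr hX.aestronglyMeasurable)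

lemma lpNorm_sub_integral_le {Q : Ω → ℝ} {q : ℝ≥0∞} (hq : 1 ≤ q) (hQ : MemLp Q q P) :
    lpNorm (fun ω => Q ω - ∫ ω', Q ω' ∂P) q P ≤ 2 * lpNorm Q q P := by
  have h1 := lpNorm_sub_le (g := fun _ => ∫ ω', Q ω' ∂P) hQ hq
  have h2 : lpNorm (fun _ : Ω => ∫ ω', Q ω' ∂P) q P ≤ lpNorm Q q P := by
    rw [lpNorm_const (by positivity) (IsProbabilityMeasure.ne_zero P)]
    simp only [probReal_univ, Real.one_rpow, mul_one]
    refine (norm_integral_le_integral_norm _).trans ?_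
    rw [← lpNorm_one_eq_integral_norm hQ.aestronglyMeasurable]
    exact lpNorm_mono_exponent hq hQ
  have h3 : lpNorm (fun ω => Q ω - ∫ ω', Q ω' ∂P) q P
      = lpNorm (Q - fun _ => ∫ ω', Q ω' ∂P) q P := rfl
  linarith

/-- Hölder's inequality for a multiplier controlled by a power of an `L^p` variable. -/
lemma abs_integral_mul_le_of_abs_le {D Q e : Ω → ℝ} {p H s : ℝ} (hp : 2 < p) (hH : 0 ≤ H)
    (hs : 0 ≤ s) (he : MemLp e (ENNReal.ofReal p) P) (hQ : MemLp Q (ENNReal.ofReal (p / 2)) P)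
    (hD : ∀ ω, |D ω| ≤ H * (|e ω| ^ (p - 2) + s)) :
    |∫ ω, D ω * Q ω ∂P|
      ≤ H * (lpNorm e (ENNReal.ofReal p) P ^ (p - 2) + s) * lpNorm Q (ENNReal.ofReal (p / 2)) P := by
  have hp0 : 0 < p := by linarith
  have hp2 : 0 < p - 2 := by linarith
  -- These exponents are forced: `|e|^{p-2}` lies in `L^{p/(p-2)}` when `e` lies in `L^p`, and
  -- products of two `L^p` variables lie in `L^{p/2}`.
  have hpq : (p / (p - 2)).HolderConjugate (p / 2) := by
    rw [Real.holderConjugate_iff]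
    refine ⟨by rw [lt_div_iff₀ hp2]; linarith, ?_⟩
    field_simp
    ring
  have hQ1 : Integrable Q P := hQ.integrable (by
    rw [ENNReal.one_le_ofReal]; linarith)
  have he' : MemLp (fun ω => |e ω| ^ (p - 2)) (ENNReal.ofReal (p / (p - 2))) P := by
    have := he.norm_rpow_div (ENNReal.ofReal (p - 2))
    rw [ENNReal.toReal_ofReal hp2.le, ← ENNReal.ofReal_div_of_pos hp2] at this
    exact this
  have hprod : Integrable (fun ω => |e ω| ^ (p - 2) * |Q ω|) P := by
    have : ENNReal.HolderTriple (ENNReal.ofReal (p / (p - 2))) (ENNReal.ofReal (p / 2)) 1 := by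
      constructor
      rw [← ENNReal.ofReal_inv_of_pos (by positivity), ← ENNReal.ofReal_inv_of_pos (by positivity),
        ← ENNReal.ofReal_add (by positivity) (by positivity), hpq.inv_add_inv_eq_one]
      simp
    exact memLp_one_iff_integrable.1 (MemLp.mul (p := ENNReal.ofReal (p / (p - 2)))
      (q := ENNReal.ofReal (p / 2)) hQ.norm he')
  have h1 : ∫ ω, |e ω| ^ (p - 2) * |Q ω| ∂P
      ≤ lpNorm e (ENNReal.ofReal p) P ^ (p - 2) * lpNorm Q (ENNReal.ofReal (p / 2)) P := by
    have := integral_mul_le_Lp_mul_Lq_of_nonneg hpq (μ := P) (f := fun ω => |e ω| ^ (p - 2))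
      (g := fun ω => |Q ω|) (Filter.Eventually.of_forall fun _ => by positivity)
      (Filter.Eventually.of_forall fun _ => by positivity) he' hQ.norm
    refine this.trans (le_of_eq ?_)
    congr 1
    · have h2 : ∀ ω, (|e ω| ^ (p - 2)) ^ (p / (p - 2)) = |e ω| ^ p := fun ω => by
        rw [← Real.rpow_mul (abs_nonneg _)]
        congr 1
        field_simp
      simp only [h2]
      rw [integral_abs_rpow_eq_lpNorm_rpow hp0 he, ← Real.rpow_mul lpNorm_nonneg]
      congr 1
      field_simp
    · rw [integral_abs_rpow_eq_lpNorm_rpow (by positivity) hQ, ← Real.rpow_mul lpNorm_nonneg,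
        mul_one_div_cancel (by positivity), Real.rpow_one]
  have h2 : ∫ ω, |Q ω| ∂P ≤ lpNorm Q (ENNReal.ofReal (p / 2)) P := by
    have h := lpNorm_one_eq_integral_norm hQ.aestronglyMeasurable
    simp only [Real.norm_eq_abs] at h
    rw [← h]
    exact lpNorm_mono_exponent (by rw [ENNReal.one_le_ofReal]; linarith) hQ
  calc |∫ ω, D ω * Q ω ∂P| ≤ ∫ ω, |D ω * Q ω| ∂P := abs_integral_le_integral_abs
    _ ≤ ∫ ω, H * (|e ω| ^ (p - 2) * |Q ω| + s * |Q ω|) ∂P := by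
      refine integral_mono_of_nonneg (Filter.Eventually.of_forall fun _ => abs_nonneg _)
        ((hprod.add (hQ1.abs.const_mul s)).const_mul H) (Filter.Eventually.of_forall fun ω => ?_)
      simp only [abs_mul]
      calc |D ω| * |Q ω| ≤ (H * (|e ω| ^ (p - 2) + s)) * |Q ω| := by gcongr; exact hD ω
        _ = _ := by ring
    _ = H * (∫ ω, |e ω| ^ (p - 2) * |Q ω| ∂P + s * ∫ ω, |Q ω| ∂P) := by
      rw [integral_const_mul, integral_add hprod (hQ1.abs.const_mul s), integral_const_mul]
    _ ≤ H * (lpNorm e (ENNReal.ofReal p) P ^ (p - 2) * lpNorm Q (ENNReal.ofReal (p / 2)) P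
        + s * lpNorm Q (ENNReal.ofReal (p / 2)) P) := by gcongr
    _ = _ := by ring

lemma integral_mul_condExp {𝓖 : MeasurableSpace Ω} (h𝓖 : 𝓖 ≤ m0) {Z W : Ω → ℝ}
    (hZ : StronglyMeasurable[𝓖] Z) (hW : Integrable W P)
    (hZW : Integrable (fun ω => Z ω * W ω) P) :
    ∫ ω, Z ω * (P[W | 𝓖]) ω ∂P = ∫ ω, Z ω * W ω ∂P := by
  have h := condExp_mul_of_stronglyMeasurable_left hZ hZW hW
  rw [← integral_condExp h𝓖 (f := fun ω => Z ω * W ω)]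
  exact (integral_congr_ae h).symm

/-- The covariance of a bounded variable and an integrable one. -/
noncomputable def covar (P : Measure Ω) (U Q : Ω → ℝ) : ℝ :=
  ∫ ω, U ω * Q ω ∂P - (∫ ω, U ω ∂P) * ∫ ω, Q ω ∂P

lemma covar_const_left (c : ℝ) (Q : Ω → ℝ) : covar P (fun _ => c) Q = 0 := by
  simp [covar, integral_const_mul]

omit [IsProbabilityMeasure P] in
lemma integrable_bdd_mul {D Q : Ω → ℝ} {B : ℝ} (hD : AEStronglyMeasurable D P)
    (hB : ∀ ω, |D ω| ≤ B) (hQ : Integrable Q P) : Integrable (fun ω => D ω * Q ω) P :=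
  hQ.bdd_mul hD (Filter.Eventually.of_forall hB)

lemma integrable_of_abs_le {D : Ω → ℝ} {B : ℝ} (hD : AEStronglyMeasurable D P)
    (hB : ∀ ω, |D ω| ≤ B) : Integrable D P :=
  Integrable.of_bound hD B (Filter.Eventually.of_forall hB)

lemma covar_sub_left {U V Q : Ω → ℝ} {B B' : ℝ} (hU : AEStronglyMeasurable U P)
    (hUB : ∀ ω, |U ω| ≤ B) (hV : AEStronglyMeasurable V P) (hVB : ∀ ω, |V ω| ≤ B')
    (hQ : Integrable Q P) :
    covar P (fun ω => U ω - V ω) Q = covar P U Q - covar P V Q := by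
  simp only [covar, sub_mul]
  rw [integral_sub (integrable_bdd_mul hU hUB hQ) (integrable_bdd_mul hV hVB hQ),
    integral_sub (integrable_of_abs_le hU hUB) (integrable_of_abs_le hV hVB)]
  ring

lemma covar_eq_integral {D Q : Ω → ℝ} {B : ℝ} (hD : AEStronglyMeasurable D P)
    (hDB : ∀ ω, |D ω| ≤ B) (hQ : Integrable Q P) :
    covar P D Q = ∫ ω, D ω * (Q ω - ∫ ω', Q ω' ∂P) ∂P := by
  simp only [mul_sub]
  rw [integral_sub (integrable_bdd_mul hD hDB hQ) ((integrable_of_abs_le hD hDB).mul_const _),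
    integral_mul_const, covar]

/-- For use when no conditioning is available: centering `Q` costs the factor 2. -/
lemma abs_covar_le {D Q e : Ω → ℝ} {p H s B : ℝ} (hp : 2 < p) (hH : 0 ≤ H) (hs : 0 ≤ s)
    (he : MemLp e (ENNReal.ofReal p) P) (hQ : MemLp Q (ENNReal.ofReal (p / 2)) P)
    (hDm : AEStronglyMeasurable D P) (hDB : ∀ ω, |D ω| ≤ B)
    (hD : ∀ ω, |D ω| ≤ H * (|e ω| ^ (p - 2) + s)) :
    |covar P D Q| ≤ H * (lpNorm e (ENNReal.ofReal p) P ^ (p - 2) + s)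
      * (2 * lpNorm Q (ENNReal.ofReal (p / 2)) P) := by
  have h1 : (1 : ℝ≥0∞) ≤ ENNReal.ofReal (p / 2) := by rw [ENNReal.one_le_ofReal]; linarith
  rw [covar_eq_integral hDm hDB (hQ.integrable h1)]
  refine (abs_integral_mul_le_of_abs_le hp hH hs he (hQ.sub (memLp_const _)) hD).trans ?_
  have : 0 ≤ lpNorm e (ENNReal.ofReal p) P ^ (p - 2) := Real.rpow_nonneg lpNorm_nonneg _
  gcongr
  exact lpNorm_sub_integral_le h1 hQ

/-- Since `D` is measurable with respect to `𝓖`, the variable `Q` may be replaced by its conditional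
expectation, and mixing coefficients can enter. -/
lemma abs_covar_le_of_condExp {𝓖 : MeasurableSpace Ω} (h𝓖 : 𝓖 ≤ m0) {D Q e : Ω → ℝ}
    {p H s B : ℝ} (hp : 2 < p) (hH : 0 ≤ H) (hs : 0 ≤ s)
    (he : MemLp e (ENNReal.ofReal p) P) (hQ : MemLp Q (ENNReal.ofReal (p / 2)) P)
    (hDm : StronglyMeasurable[𝓖] D) (hDB : ∀ ω, |D ω| ≤ B)
    (hD : ∀ ω, |D ω| ≤ H * (|e ω| ^ (p - 2) + s)) :
    |covar P D Q| ≤ H * (lpNorm e (ENNReal.ofReal p) P ^ (p - 2) + s)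
      * lpNorm (fun ω => (P[Q | 𝓖]) ω - ∫ ω', Q ω' ∂P) (ENNReal.ofReal (p / 2)) P := by
  have h1 : (1 : ℝ≥0∞) ≤ ENNReal.ofReal (p / 2) := by rw [ENNReal.one_le_ofReal]; linarith
  have hQ1 := hQ.integrable h1
  have hDm' : AEStronglyMeasurable[m0] D P := (hDm.mono h𝓖).aestronglyMeasurable
  have h2 : covar P D Q = ∫ ω, D ω * ((P[Q | 𝓖]) ω - ∫ ω', Q ω' ∂P) ∂P := by
    have h3 := covar_eq_integral hDm' hDB (integrable_condExp (μ := P) (m := 𝓖) (f := Q))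
    rw [integral_condExp h𝓖] at h3
    rw [← h3, covar, covar, integral_condExp h𝓖, integral_mul_condExp h𝓖 hDm hQ1
      (integrable_bdd_mul hDm' hDB hQ1)]
  rw [h2]
  exact abs_integral_mul_le_of_abs_le hp hH hs he ((hQ.condExp h1).sub (memLp_const _)) hD

end Tools

/-! ### The martingale of conditional expectations and one Lindeberg step. -/

section Martingale

variable {Ω : Type*} {m0 : MeasurableSpace Ω}

/-- A sequence in `L^p` adapted to an increasing sequence of sigma-algebras. -/
structure AdaptedLp (P : Measure Ω) (𝓕 : ℕ → MeasurableSpace Ω) (X : ℕ → Ω → ℝ) (p : ℝ) :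
    Prop where
  mono : Monotone 𝓕
  le : ∀ k, 𝓕 k ≤ m0
  meas : ∀ k, StronglyMeasurable[𝓕 k] (X k)
  memLp : ∀ k, MemLp (X k) (ENNReal.ofReal p) P

/-- The remainder `X_{k+1} + ⋯ + X_n`. -/
def tail (X : ℕ → Ω → ℝ) (n k : ℕ) (ω : Ω) : ℝ := ∑ l ∈ Finset.Ioc k n, X l ω

/-- The projection of the remainder on the past. -/
noncomputable def proj (P : Measure Ω) (𝓕 : ℕ → MeasurableSpace Ω) (X : ℕ → Ω → ℝ) (n k : ℕ) :
    Ω → ℝ := P[tail X n k | 𝓕 k]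

/-- The martingale `E(X_1 + ⋯ + X_n | 𝓕_k)`, shifted by one index and started at zero. -/
noncomputable def mart (P : Measure Ω) (𝓕 : ℕ → MeasurableSpace Ω) (X : ℕ → Ω → ℝ) (n : ℕ) :
    ℕ → Ω → ℝ
  | 0 => fun _ => 0
  | k + 1 => fun ω => ∑ l ∈ Finset.Ioc 0 k, X l ω + proj P 𝓕 X n k ω

/-- The increments of `mart`. -/
noncomputable def step (P : Measure Ω) (𝓕 : ℕ → MeasurableSpace Ω) (X : ℕ → Ω → ℝ) (n k : ℕ)
    (ω : Ω) : ℝ := mart P 𝓕 X n (k + 1) ω - mart P 𝓕 X n k ω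

/-- The part of the remainder which is orthogonal to the past. -/
noncomputable def resid (P : Measure Ω) (𝓕 : ℕ → MeasurableSpace Ω) (X : ℕ → Ω → ℝ) (n k : ℕ)
    (ω : Ω) : ℝ := tail X n k ω - proj P 𝓕 X n k ω

/-- The conditional variance of the remainder, averaged. -/
noncomputable def residVar (P : Measure Ω) (𝓕 : ℕ → MeasurableSpace Ω) (X : ℕ → Ω → ℝ)
    (n k : ℕ) : ℝ := ∫ ω, resid P 𝓕 X n k ω ^ 2 ∂P

variable {P : Measure Ω} {𝓕 : ℕ → MeasurableSpace Ω} {X : ℕ → Ω → ℝ} {n k : ℕ} {p : ℝ}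

lemma tail_of_lt (hk : k < n) (ω : Ω) : tail X n k ω = X (k + 1) ω + tail X n (k + 1) ω := by
  unfold tail
  have h : Finset.Ioc k n = insert (k + 1) (Finset.Ioc (k + 1) n) := by
    ext l
    simp only [Finset.mem_insert, Finset.mem_Ioc]
    omega
  rw [h, Finset.sum_insert (by simp)]

lemma step_zero (ω : Ω) : step P 𝓕 X n 0 ω = proj P 𝓕 X n 0 ω := by
  simp [step, mart]

lemma step_succ (k : ℕ) (ω : Ω) : step P 𝓕 X n (k + 1) ω
    = X (k + 1) ω + proj P 𝓕 X n (k + 1) ω - proj P 𝓕 X n k ω := by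
  have h : Finset.Ioc 0 (k + 1) = insert (k + 1) (Finset.Ioc 0 k) := by
    ext l
    simp only [Finset.mem_insert, Finset.mem_Ioc]
    omega
  simp only [step, mart]
  rw [h, Finset.sum_insert (by simp)]
  ring

/-- The residual is `S_n - E(S_n | F_k)`, which loses one martingale increment when `k` grows by
one. -/
lemma resid_of_lt (hk : k < n) (ω : Ω) :
    resid P 𝓕 X n k ω = resid P 𝓕 X n (k + 1) ω + step P 𝓕 X n (k + 1) ω := by
  rw [resid, resid, step_succ, tail_of_lt hk]
  ring

lemma tail_self : tail X n n = 0 := by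
  ext ω; simp [tail]

lemma proj_self : proj P 𝓕 X n n = 0 := by
  rw [proj, tail_self, condExp_zero]

lemma residVar_self : residVar P 𝓕 X n n = 0 := by
  simp [residVar, resid, tail_self, proj_self]

lemma mart_top (ω : Ω) : mart P 𝓕 X n (n + 1) ω = ∑ l ∈ Finset.Ioc 0 n, X l ω := by
  simp [mart, proj_self]

lemma residVar_nonneg : 0 ≤ residVar P 𝓕 X n k := integral_nonneg fun _ => sq_nonneg _

lemma integrable_mul_of_memLp_two {a b : Ω → ℝ} (ha : MemLp a 2 P) (hb : MemLp b 2 P) :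
    Integrable (fun ω => a ω * b ω) P := ha.integrable_mul hb

lemma integral_add_sq_of_orthogonal {a b : Ω → ℝ} (ha : MemLp a 2 P) (hb : MemLp b 2 P)
    (hab : ∫ ω, b ω * a ω ∂P = 0) :
    ∫ ω, (a ω + b ω) ^ 2 ∂P = ∫ ω, a ω ^ 2 ∂P + ∫ ω, b ω ^ 2 ∂P := by
  have e : ∀ ω, (a ω + b ω) ^ 2 = a ω ^ 2 + b ω ^ 2 + 2 * (b ω * a ω) := fun ω => by ring
  have i1 : Integrable (fun ω => a ω ^ 2 + b ω ^ 2) P := ha.integrable_sq.add hb.integrable_sq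
  simp only [e]
  rw [integral_add i1 ((integrable_mul_of_memLp_two hb ha).const_mul 2),
    integral_add ha.integrable_sq hb.integrable_sq, integral_const_mul, hab]
  ring

namespace AdaptedLp

variable (h : AdaptedLp P 𝓕 X p)

include h

lemma memLp_tail (n k : ℕ) : MemLp (tail X n k) (ENNReal.ofReal p) P :=
  memLp_finsetSum _ fun l _ => h.memLp l

omit h in
lemma stronglyMeasurable_proj (n k : ℕ) : StronglyMeasurable[𝓕 k] (proj P 𝓕 X n k) :=
  stronglyMeasurable_condExp

lemma stronglyMeasurable_mart_succ (n k : ℕ) :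
    StronglyMeasurable[𝓕 k] (mart P 𝓕 X n (k + 1)) := by
  have h1 : StronglyMeasurable[𝓕 k] (fun ω => ∑ l ∈ Finset.Ioc 0 k, X l ω) :=
    Finset.stronglyMeasurable_fun_sum _ fun l hl =>
      (h.meas l).mono (h.mono (Finset.mem_Ioc.1 hl).2)
  exact h1.add (stronglyMeasurable_proj n k)

lemma stronglyMeasurable_mart (n k : ℕ) : StronglyMeasurable[𝓕 k] (mart P 𝓕 X n k) := by
  cases k with
  | zero => exact stronglyMeasurable_const
  | succ k => exact (h.stronglyMeasurable_mart_succ n k).mono (h.mono k.le_succ)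

lemma stronglyMeasurable_step (n k : ℕ) : StronglyMeasurable[𝓕 k] (step P 𝓕 X n k) :=
  (h.stronglyMeasurable_mart_succ n k).sub (h.stronglyMeasurable_mart n k)

variable [IsProbabilityMeasure P] (hp : 2 < p)

include hp

omit [IsProbabilityMeasure P] in
lemma memLp_proj (n k : ℕ) : MemLp (proj P 𝓕 X n k) (ENNReal.ofReal p) P :=
  (h.memLp_tail n k).condExp (by rw [ENNReal.one_le_ofReal]; linarith)

omit [IsProbabilityMeasure P] in
lemma memLp_resid (n k : ℕ) : MemLp (resid P 𝓕 X n k) (ENNReal.ofReal p) P :=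
  (h.memLp_tail n k).sub (h.memLp_proj hp n k)

lemma memLp_mart (n k : ℕ) : MemLp (mart P 𝓕 X n k) (ENNReal.ofReal p) P := by
  cases k with
  | zero => exact memLp_const _
  | succ k =>
    exact (memLp_finsetSum (f := fun l => X l) (Finset.Ioc 0 k) fun l _ => h.memLp l).add
      (h.memLp_proj hp n k)

lemma memLp_step (n k : ℕ) : MemLp (step P 𝓕 X n k) (ENNReal.ofReal p) P :=
  (h.memLp_mart hp n (k + 1)).sub (h.memLp_mart hp n k)

omit h in
lemma memLp_two {Z : Ω → ℝ} (hZ : MemLp Z (ENNReal.ofReal p) P) : MemLp Z 2 P :=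
  hZ.mono_exponent (by
    rw [← ENNReal.ofReal_ofNat 2]
    exact ENNReal.ofReal_le_ofReal hp.le)

lemma integral_resid_mul_eq_zero {Z : Ω → ℝ} (hZm : StronglyMeasurable[𝓕 k] Z)
    (hZ : MemLp Z 2 P) : ∫ ω, Z ω * resid P 𝓕 X n k ω ∂P = 0 := by
  have h1 := memLp_two hp (h.memLp_tail n k)
  have h2 := memLp_two hp (h.memLp_proj hp n k)
  have h3 := integral_mul_condExp (h.le k) hZm (h1.integrable one_le_two) (hZ.integrable_mul h1)
  simp only [resid, mul_sub]
  rw [integral_sub (integrable_mul_of_memLp_two hZ h1) (integrable_mul_of_memLp_two hZ h2),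
    sub_eq_zero]
  exact h3.symm

/-- The increment is the difference of two consecutive residuals, each of them orthogonal to the
square integrable `𝓕 k`-measurable variables. -/
lemma integral_step_mul_eq_zero (hk : k < n) {Z : Ω → ℝ} (hZm : StronglyMeasurable[𝓕 k] Z)
    (hZ : MemLp Z 2 P) : ∫ ω, Z ω * step P 𝓕 X n (k + 1) ω ∂P = 0 := by
  have h1 := h.integral_resid_mul_eq_zero hp (n := n) hZm hZ
  have h2 := h.integral_resid_mul_eq_zero hp (n := n) (hZm.mono (h.mono k.le_succ)) hZ
  simp only [resid_of_lt hk, mul_add] at h1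
  rw [integral_add (integrable_mul_of_memLp_two hZ (memLp_two hp (h.memLp_resid hp n _)))
    (integrable_mul_of_memLp_two hZ (memLp_two hp (h.memLp_step hp n _))), h2, zero_add] at h1
  exact h1

/-- Pythagoras. This is why the smoothing variance is taken to be `A + residVar`: it drops at each
step by exactly the second moment of the martingale increment. -/
lemma residVar_of_lt (hk : k < n) : residVar P 𝓕 X n k
    = ∫ ω, step P 𝓕 X n (k + 1) ω ^ 2 ∂P + residVar P 𝓕 X n (k + 1) := by
  have hr := memLp_two hp (h.memLp_resid hp n (k + 1))
  have hs := memLp_two hp (h.memLp_step hp n (k + 1))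
  have h1 := h.integral_resid_mul_eq_zero hp (n := n) (h.stronglyMeasurable_step n (k + 1)) hs
  rw [residVar, residVar, add_comm (∫ ω, step P 𝓕 X n (k + 1) ω ^ 2 ∂P),
    ← integral_add_sq_of_orthogonal hr hs h1]
  simp only [resid_of_lt hk]

lemma residVar_anti {j : ℕ} (hjk : k ≤ j) (hj : j ≤ n) :
    residVar P 𝓕 X n j ≤ residVar P 𝓕 X n k := by
  induction j, hjk using Nat.le_induction with
  | base => exact le_rfl
  | succ j hkj ih =>
    refine le_trans ?_ (ih (by omega))
    rw [h.residVar_of_lt hp (k := j) (by omega)]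
    have : 0 ≤ ∫ ω, step P 𝓕 X n (j + 1) ω ^ 2 ∂P := integral_nonneg fun _ => sq_nonneg _
    linarith

lemma integral_tail_sq (n k : ℕ) : ∫ ω, tail X n k ω ^ 2 ∂P
    = residVar P 𝓕 X n k + ∫ ω, proj P 𝓕 X n k ω ^ 2 ∂P := by
  have hr := memLp_two hp (h.memLp_resid hp n k)
  have hs := memLp_two hp (h.memLp_proj hp n k)
  have h1 := h.integral_resid_mul_eq_zero hp (n := n) (stronglyMeasurable_proj n k) hs
  have h2 : ∫ ω, proj P 𝓕 X n k ω * resid P 𝓕 X n k ω ∂P = 0 := h1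
  rw [residVar, ← integral_add_sq_of_orthogonal hr hs h2]
  simp only [resid, sub_add_cancel]

/-- Write `d = X + R' - R`, with `R'` the next projection. Squaring `d + R = X + R'` gives `d² = X²
+ 2 X R' + R'² - R² - 2 R d`. The term `R d` integrates to zero against `U` because `d` is a
martingale increment, and `X R'` may be exchanged for `X` times the tail because their difference is
a residual. -/
lemma integral_mul_step_sq (hk : k < n) {U : Ω → ℝ} {B : ℝ} (hU : StronglyMeasurable[𝓕 k] U)
    (hB : ∀ ω, |U ω| ≤ B) : ∫ ω, U ω * step P 𝓕 X n (k + 1) ω ^ 2 ∂P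
      = ∫ ω, U ω * X (k + 1) ω ^ 2 ∂P
        + 2 * ∫ ω, U ω * (X (k + 1) ω * tail X n (k + 1) ω) ∂P
        + ∫ ω, U ω * proj P 𝓕 X n (k + 1) ω ^ 2 ∂P - ∫ ω, U ω * proj P 𝓕 X n k ω ^ 2 ∂P := by
  have hU0 : AEStronglyMeasurable U P := (hU.mono (h.le k)).aestronglyMeasurable
  have hx := memLp_two hp (h.memLp (k + 1))
  have hr' := memLp_two hp (h.memLp_proj hp n (k + 1))
  have hr := memLp_two hp (h.memLp_proj hp n k)
  have ht := memLp_two hp (h.memLp_tail n (k + 1))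
  have hg := memLp_two hp (h.memLp_resid hp n (k + 1))
  have hd := memLp_two hp (h.memLp_step hp n (k + 1))
  have hU2 : ∀ {Z : Ω → ℝ}, MemLp Z 2 P → MemLp (fun ω => U ω * Z ω) 2 P := fun {Z} hZ => by
    refine (hZ.const_mul B).mono (hU0.mul hZ.aestronglyMeasurable)
      (Filter.Eventually.of_forall fun ω => ?_)
    rw [norm_mul, norm_mul]
    gcongr
    exact (hB ω).trans (le_abs_self B)
  have z1 : ∫ ω, U ω * proj P 𝓕 X n k ω * step P 𝓕 X n (k + 1) ω ∂P = 0 :=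
    h.integral_step_mul_eq_zero hp hk (hU.mul (stronglyMeasurable_proj n k)) (hU2 hr)
  have z2 : ∫ ω, U ω * X (k + 1) ω * resid P 𝓕 X n (k + 1) ω ∂P = 0 :=
    h.integral_resid_mul_eq_zero hp ((hU.mono (h.mono k.le_succ)).mul (h.meas (k + 1))) (hU2 hx)
  have i1 : Integrable (fun ω => U ω * X (k + 1) ω ^ 2) P :=
    integrable_bdd_mul hU0 hB hx.integrable_sq
  have i2 : Integrable (fun ω => U ω * (X (k + 1) ω * tail X n (k + 1) ω)) P :=
    integrable_bdd_mul hU0 hB (hx.integrable_mul ht)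
  have i3 : Integrable (fun ω => U ω * proj P 𝓕 X n (k + 1) ω ^ 2) P :=
    integrable_bdd_mul hU0 hB hr'.integrable_sq
  have i4 : Integrable (fun ω => U ω * proj P 𝓕 X n k ω ^ 2) P :=
    integrable_bdd_mul hU0 hB hr.integrable_sq
  have i5 : Integrable (fun ω => U ω * proj P 𝓕 X n k ω * step P 𝓕 X n (k + 1) ω) P :=
    (hU2 hr).integrable_mul hd
  have i6 : Integrable (fun ω => U ω * X (k + 1) ω * resid P 𝓕 X n (k + 1) ω) P :=
    (hU2 hx).integrable_mul hg
  have e : ∀ ω, U ω * step P 𝓕 X n (k + 1) ω ^ 2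
      = U ω * X (k + 1) ω ^ 2 + 2 * (U ω * (X (k + 1) ω * tail X n (k + 1) ω))
        + U ω * proj P 𝓕 X n (k + 1) ω ^ 2 - U ω * proj P 𝓕 X n k ω ^ 2
        - 2 * (U ω * proj P 𝓕 X n k ω * step P 𝓕 X n (k + 1) ω)
        - 2 * (U ω * X (k + 1) ω * resid P 𝓕 X n (k + 1) ω) := fun ω => by
    rw [step_succ, resid]; ring
  have j2 : Integrable (fun ω => U ω * X (k + 1) ω ^ 2
      + 2 * (U ω * (X (k + 1) ω * tail X n (k + 1) ω))) P := i1.add (i2.const_mul 2)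
  have j3 : Integrable (fun ω => U ω * X (k + 1) ω ^ 2
      + 2 * (U ω * (X (k + 1) ω * tail X n (k + 1) ω))
      + U ω * proj P 𝓕 X n (k + 1) ω ^ 2) P := j2.add i3
  have j4 : Integrable (fun ω => U ω * X (k + 1) ω ^ 2
      + 2 * (U ω * (X (k + 1) ω * tail X n (k + 1) ω))
      + U ω * proj P 𝓕 X n (k + 1) ω ^ 2 - U ω * proj P 𝓕 X n k ω ^ 2) P := j3.sub i4
  have j5 : Integrable (fun ω => U ω * X (k + 1) ω ^ 2
      + 2 * (U ω * (X (k + 1) ω * tail X n (k + 1) ω))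
      + U ω * proj P 𝓕 X n (k + 1) ω ^ 2 - U ω * proj P 𝓕 X n k ω ^ 2
      - 2 * (U ω * proj P 𝓕 X n k ω * step P 𝓕 X n (k + 1) ω)) P := j4.sub (i5.const_mul 2)
  simp only [e]
  rw [integral_sub j5 (i6.const_mul 2), integral_sub j4 (i5.const_mul 2), integral_sub j3 i4,
    integral_add j2 i3, integral_add i1 (i2.const_mul 2), integral_const_mul, integral_const_mul,
    integral_const_mul, z1, z2]
  ring

/-- The choice `U = 1` in the preceding identity gives the mean of the squared increment, so the
identity passes to covariances. -/
lemma covar_step_sq (hk : k < n) {U : Ω → ℝ} {B : ℝ} (hU : StronglyMeasurable[𝓕 k] U)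
    (hB : ∀ ω, |U ω| ≤ B) : covar P U (fun ω => step P 𝓕 X n (k + 1) ω ^ 2)
      = covar P U (fun ω => X (k + 1) ω ^ 2)
        + 2 * covar P U (fun ω => X (k + 1) ω * tail X n (k + 1) ω)
        + covar P U (fun ω => proj P 𝓕 X n (k + 1) ω ^ 2)
        - covar P U (fun ω => proj P 𝓕 X n k ω ^ 2) := by
  have h1 := h.integral_mul_step_sq hp hk hU hB
  have h2 := h.integral_mul_step_sq hp hk (U := fun _ => 1) stronglyMeasurable_const (B := 1)
    (fun _ => by simp)
  simp only [one_mul] at h2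
  simp only [covar, h1, h2]
  ring

/-- One step of the Lindeberg replacement along the martingale. -/
lemma integral_gaussSmooth_step_le (hp3 : p ≤ 3) (hk : k < n) {f : ℝ → ℝ}
    (hf : LipschitzWith 1 f) {A : ℝ} (hA : 0 < A) :
    ∫ ω, gaussSmooth (A + residVar P 𝓕 X n (k + 1)) f (mart P 𝓕 X n (k + 2) ω) ∂P
      - ∫ ω, gaussSmooth (A + residVar P 𝓕 X n k) f (mart P 𝓕 X n (k + 1) ω) ∂P
    ≤ covar P (fun ω => gaussHess (A + residVar P 𝓕 X n (k + 1)) f (mart P 𝓕 X n (k + 1) ω))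
        (fun ω => step P 𝓕 X n (k + 1) ω ^ 2) / 2
      + holderConst p (A + residVar P 𝓕 X n (k + 1)) * (1 + gaussMoment p)
        * lpNorm (step P 𝓕 X n (k + 1)) (ENNReal.ofReal p) P ^ p := by
  set v := A + residVar P 𝓕 X n (k + 1) with hv
  have hv0 : 0 < v := by have := residVar_nonneg (P := P) (𝓕 := 𝓕) (X := X) (n := n) (k := k + 1)
                         positivity
  set d := step P 𝓕 X n (k + 1) with hd
  set N := mart P 𝓕 X n (k + 1) with hN
  set s := lpNorm d 2 P with hs
  have hs0 : 0 ≤ s := lpNorm_nonneg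
  have hdp := h.memLp_step hp n (k + 1)
  have hd2 := memLp_two hp hdp
  -- The variance released by the smoothing equals `‖d‖_2²`; hence the second order terms combine
  -- into a covariance.
  have hw : A + residVar P 𝓕 X n k = s ^ 2 + v := by
    rw [h.residVar_of_lt hp hk, integral_sq_eq_lpNorm_sq hd2, hv]
    ring
  have hNm := h.stronglyMeasurable_mart_succ n k
  have hNi : Integrable N P := (memLp_two hp (h.memLp_mart hp n (k + 1))).integrable one_le_two
  have hN2 : ∀ ω, mart P 𝓕 X n (k + 2) ω = N ω + d ω := fun ω => by
    simp only [hd, step, hN]; ring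
  have hdi : Integrable d P := hd2.integrable one_le_two
  rw [hw]
  set U := fun ω => gaussHess v f (N ω) with hU
  set V := fun ω => deriv (gaussSmooth v f) (N ω) with hV
  have hUm : StronglyMeasurable[𝓕 k] U :=
    (continuous_gaussHess hf hv0).comp_stronglyMeasurable hNm
  have hVm : StronglyMeasurable[𝓕 k] V :=
    (lipschitzWith_deriv_gaussSmooth hf hv0).continuous.comp_stronglyMeasurable hNm
  have hUm0 : AEStronglyMeasurable U P := (hUm.mono (h.le k)).aestronglyMeasurable
  have hVm0 : AEStronglyMeasurable V P := (hVm.mono (h.le k)).aestronglyMeasurable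
  have hUB : ∀ ω, |U ω| ≤ 2 / √v := fun ω => abs_gaussHess_le hf hv0 _
  have hVB : ∀ ω, |V ω| ≤ 1 := fun ω => abs_deriv_gaussSmooth_le hf _
  have hV2 : MemLp V 2 P := MemLp.of_bound hVm0 1 (Filter.Eventually.of_forall hVB)
  have z : ∫ ω, V ω * d ω ∂P = 0 := h.integral_step_mul_eq_zero hp hk hVm hV2
  set H := holderConst p v with hH
  have hH0 : 0 ≤ H := holderConst_nonneg hv0.le
  have iU : Integrable U P := integrable_of_abs_le hUm0 hUB
  have iUd : Integrable (fun ω => U ω * d ω ^ 2) P :=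
    integrable_bdd_mul hUm0 hUB hd2.integrable_sq
  have iVd : Integrable (fun ω => V ω * d ω) P := integrable_bdd_mul hVm0 hVB hdi
  have i1 : Integrable (fun ω => gaussSmooth v f (N ω + d ω)) P :=
    integrable_comp_of_lipschitz (lipschitzWith_gaussSmooth hf v) (hNi.add hdi)
  have i2 : Integrable (fun ω => gaussSmooth (s ^ 2 + v) f (N ω)) P :=
    integrable_comp_of_lipschitz (lipschitzWith_gaussSmooth hf _) hNi
  have i3 : Integrable (fun ω => |d ω| ^ p) P := by
    have := hdp.integrable_norm_rpow (by simp; linarith) (by simp)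
    rw [ENNReal.toReal_ofReal (by linarith)] at this
    exact this
  simp only [hN2]
  rw [← integral_sub i1 i2]
  -- Both the increment and the normal step of variance `s²` are expanded around `N ω`. After
  -- integration the linear term vanishes because `d` is a martingale increment.
  have hpt : ∀ ω, gaussSmooth v f (N ω + d ω) - gaussSmooth (s ^ 2 + v) f (N ω)
      ≤ V ω * d ω + (U ω * d ω ^ 2) / 2 - U ω * (s ^ 2 / 2) + H * |d ω| ^ p
        + H * (s ^ p * gaussMoment p) := fun ω => by
    have h1 := (abs_le.1 (abs_gaussSmooth_taylor_le hf hv0 hp hp3 (N ω) (d ω))).2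
    have h2 := (abs_le.1 (abs_gaussSmooth_add_sub_le hf hv0 hp hp3 hs0 (N ω))).1
    simp only [hU, hV]
    linarith
  have j1 : Integrable (fun ω => V ω * d ω + (U ω * d ω ^ 2) / 2) P := iVd.add (iUd.div_const 2)
  have j2 : Integrable (fun ω => V ω * d ω + (U ω * d ω ^ 2) / 2 - U ω * (s ^ 2 / 2)) P :=
    j1.sub (iU.mul_const _)
  have j3 : Integrable (fun ω => V ω * d ω + (U ω * d ω ^ 2) / 2 - U ω * (s ^ 2 / 2)
      + H * |d ω| ^ p) P := j2.add (i3.const_mul H)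
  refine (integral_mono (i1.sub i2) (j3.add (integrable_const (H * (s ^ p * gaussMoment p))))
    hpt).trans ?_
  simp only [Pi.add_apply]
  rw [integral_add j3 (integrable_const _), integral_add j2 (i3.const_mul H),
    integral_sub j1 (iU.mul_const _), integral_add iVd (iUd.div_const 2), z, integral_div,
    integral_mul_const, integral_const_mul, integral_abs_rpow_eq_lpNorm_rpow (by linarith) hdp,
    integral_const, covar, integral_sq_eq_lpNorm_sq hd2, probReal_univ, one_smul]
  have h5 : s ^ p ≤ lpNorm d (ENNReal.ofReal p) P ^ p := by
    refine Real.rpow_le_rpow hs0 (lpNorm_mono_exponent ?_ hdp) (by linarith)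
    rw [← ENNReal.ofReal_ofNat 2]
    exact ENNReal.ofReal_le_ofReal hp.le
  have h6 : H * (s ^ p * gaussMoment p)
      ≤ H * (lpNorm d (ENNReal.ofReal p) P ^ p * gaussMoment p) := by
    have := gaussMoment_nonneg p
    gcongr
  rw [← hs]
  nlinarith [h6]

end AdaptedLp

end Martingale

/-! ### Deterministic sums with monotone weights. -/

section Sums

lemma sum_comp_le_sum {ι κ : Type*} [DecidableEq κ] {s : Finset ι} {t : Finset κ} {φ : ι → κ}
    {g : κ → ℝ} (hφ : Set.InjOn φ s) (hst : ∀ i ∈ s, φ i ∈ t) (hg : ∀ j ∈ t, 0 ≤ g j) :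
    ∑ i ∈ s, g (φ i) ≤ ∑ j ∈ t, g j := by
  rw [← Finset.sum_image (f := g) hφ]
  exact Finset.sum_le_sum_of_subset_of_nonneg (Finset.image_subset_iff.2 hst)
    fun j hj _ => hg j hj

lemma sum_range_sum_Ioc_le {n : ℕ} {h g : ℕ → ℝ} {G : ℝ} (hh : ∀ l ∈ Finset.Ioc 0 n, 0 ≤ h l)
    (hG : ∀ l ∈ Finset.Ioc 0 n, ∑ k ∈ Finset.range l, g (l - k) ≤ G) :
    ∑ k ∈ Finset.range n, ∑ l ∈ Finset.Ioc k n, h l * g (l - k)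
      ≤ G * ∑ l ∈ Finset.Ioc 0 n, h l := by
  rw [Finset.sum_comm' (t' := Finset.Ioc 0 n) (s' := fun l => Finset.range l)
    (by intro x y; simp only [Finset.mem_range, Finset.mem_Ioc]; omega), Finset.mul_sum]
  refine Finset.sum_le_sum fun l hl => ?_
  rw [← Finset.mul_sum, mul_comm]
  exact mul_le_mul_of_nonneg_right (hG l hl) (hh l hl)

/-- The bound for the projections and the increments given by the triangle inequality. -/
def projBound (α c : ℕ → ℝ) (n k : ℕ) : ℝ :=
  ∑ l ∈ Finset.Ioc k n, |α l| * (c (l - k) + c (l - k - 1))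

variable {α c : ℕ → ℝ} {n k : ℕ}

lemma sum_shift_le (hc : ∀ r, 0 ≤ c r) :
    ∑ l ∈ Finset.Ioc k n, (c (l - k) + c (l - k - 1)) ≤ 2 * ∑ r ∈ Finset.range (n + 1), c r := by
  rw [Finset.sum_add_distrib, two_mul]
  refine add_le_add ?_ ?_
  · refine sum_comp_le_sum (φ := fun l => l - k) ?_ ?_ fun j _ => hc j
    · intro a ha b hb hab
      simp only [Finset.coe_Ioc, Set.mem_Ioc] at ha hb hab
      omega
    · intro a ha
      simp only [Finset.mem_Ioc, Finset.mem_range] at ha ⊢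
      omega
  · refine sum_comp_le_sum (φ := fun l => l - k - 1) ?_ ?_ fun j _ => hc j
    · intro a ha b hb hab
      simp only [Finset.coe_Ioc, Set.mem_Ioc] at ha hb hab
      omega
    · intro a ha
      simp only [Finset.mem_Ioc, Finset.mem_range] at ha ⊢
      omega

lemma projBound_le (hc : ∀ r, 0 ≤ c r) {m : ℝ} (hm : ∀ l ∈ Finset.Ioc 0 n, |α l| ≤ m)
    (hm0 : 0 ≤ m) : projBound α c n k ≤ 2 * m * ∑ r ∈ Finset.range (n + 1), c r := by
  calc projBound α c n k ≤ ∑ l ∈ Finset.Ioc k n, m * (c (l - k) + c (l - k - 1)) := by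
        refine Finset.sum_le_sum fun l hl => ?_
        have := hm l (by simp only [Finset.mem_Ioc] at hl ⊢; omega)
        exact mul_le_mul_of_nonneg_right this (add_nonneg (hc _) (hc _))
    _ = m * ∑ l ∈ Finset.Ioc k n, (c (l - k) + c (l - k - 1)) := by rw [Finset.mul_sum]
    _ ≤ m * (2 * ∑ r ∈ Finset.range (n + 1), c r) := by
        gcongr
        exact sum_shift_le hc
    _ = _ := by ring

/-- Cauchy-Schwarz with the weights `c (l - k) + c (l - k - 1)`: the price is the total mass of `c`,
not the number of terms, and each `α l ^ 2` stays in place. -/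
lemma projBound_sq_le (hc : ∀ r, 0 ≤ c r) : projBound α c n k ^ 2
    ≤ (2 * ∑ r ∈ Finset.range (n + 1), c r)
      * ∑ l ∈ Finset.Ioc k n, α l ^ 2 * (c (l - k) + c (l - k - 1)) := by
  refine (Finset.sum_sq_le_sum_mul_sum_of_sq_le_mul (Finset.Ioc k n)
    (f := fun l => c (l - k) + c (l - k - 1))
    (g := fun l => α l ^ 2 * (c (l - k) + c (l - k - 1))) (fun l _ => add_nonneg (hc _) (hc _))
    (fun l _ => mul_nonneg (sq_nonneg _) (add_nonneg (hc _) (hc _))) fun l _ => ?_).trans ?_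
  · rw [mul_pow, sq_abs]; exact le_of_eq (by ring)
  · refine mul_le_mul_of_nonneg_right (sum_shift_le hc) (Finset.sum_nonneg fun l _ =>
      mul_nonneg (sq_nonneg _) (add_nonneg (hc _) (hc _)))

/-- As `h` is nondecreasing, `h (k + 1) ≤ h l` for `l > k`, so the weight moves to the index `l`
before the sums are exchanged. In the application `h` is the Hölder constant, which grows as the
remaining variance decreases. -/
lemma sum_mul_projBound_sq_le (hc : ∀ r, 0 ≤ c r) {h : ℕ → ℝ} (h0 : ∀ l ≤ n, 0 ≤ h l)
    (hmono : ∀ k l, k ≤ l → l ≤ n → h k ≤ h l) :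
    ∑ k ∈ Finset.range n, h (k + 1) * projBound α c n k ^ 2
      ≤ 4 * (∑ r ∈ Finset.range (n + 1), c r) ^ 2 * ∑ l ∈ Finset.Ioc 0 n, h l * α l ^ 2 := by
  set η := ∑ r ∈ Finset.range (n + 1), c r with hη
  have hη0 : 0 ≤ η := Finset.sum_nonneg fun r _ => hc r
  have h1 : ∑ k ∈ Finset.range n, h (k + 1) * projBound α c n k ^ 2
      ≤ ∑ k ∈ Finset.range n, (2 * η) *
        ∑ l ∈ Finset.Ioc k n, (h l * α l ^ 2) * (c (l - k) + c (l - k - 1)) := by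
    refine Finset.sum_le_sum fun k hk => ?_
    have hk' := Finset.mem_range.1 hk
    calc h (k + 1) * projBound α c n k ^ 2
        ≤ h (k + 1) * (2 * η * ∑ l ∈ Finset.Ioc k n, α l ^ 2 * (c (l - k) + c (l - k - 1))) :=
          mul_le_mul_of_nonneg_left (projBound_sq_le hc) (h0 _ (by omega))
      _ = 2 * η * ∑ l ∈ Finset.Ioc k n, h (k + 1) * (α l ^ 2 * (c (l - k) + c (l - k - 1))) := by
          rw [← Finset.mul_sum]; ring
      _ ≤ _ := by
          refine mul_le_mul_of_nonneg_left (Finset.sum_le_sum fun l hl => ?_) (by positivity)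
          have hl' := Finset.mem_Ioc.1 hl
          rw [mul_assoc]
          exact mul_le_mul_of_nonneg_right (hmono _ _ (by omega) (by omega))
            (mul_nonneg (sq_nonneg _) (add_nonneg (hc _) (hc _)))
  refine h1.trans ?_
  rw [← Finset.mul_sum]
  have h2 := sum_range_sum_Ioc_le (n := n) (h := fun l => h l * α l ^ 2)
    (g := fun r => c r + c (r - 1)) (G := 2 * η)
    (fun l hl => mul_nonneg (h0 l (Finset.mem_Ioc.1 hl).2) (sq_nonneg _)) (fun l hl => by
      have hl' := Finset.mem_Ioc.1 hl
      rw [Finset.sum_add_distrib, two_mul]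
      refine add_le_add ?_ ?_
      · refine sum_comp_le_sum (φ := fun k => l - k) ?_ ?_ fun j _ => hc j
        · intro a ha b hb hab
          simp only [Finset.coe_range, Set.mem_Iio] at ha hb hab
          omega
        · intro a ha
          simp only [Finset.mem_range] at ha ⊢
          omega
      · refine sum_comp_le_sum (φ := fun k => l - k - 1) ?_ ?_ fun j _ => hc j
        · intro a ha b hb hab
          simp only [Finset.coe_range, Set.mem_Iio] at ha hb hab
          omega
        · intro a ha
          simp only [Finset.mem_range] at ha ⊢
          omega)
  calc _ ≤ 2 * η * (2 * η * ∑ l ∈ Finset.Ioc 0 n, h l * α l ^ 2) := by gcongr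
    _ = _ := by ring

/-- The mixing weight of a pair at distance `r`, summed over the distance to the past. -/
def pairWeight (lamb : ℕ → ℝ) (n r : ℕ) : ℝ :=
  ∑ j ∈ Finset.Icc 1 n, if r ≤ j then lamb j else lamb r

lemma pairWeight_nonneg {lamb : ℕ → ℝ} (hl : ∀ j, 1 ≤ j → 0 ≤ lamb j) (r : ℕ) :
    0 ≤ pairWeight lamb n r := by
  refine Finset.sum_nonneg fun j hj => ?_
  have := (Finset.mem_Icc.1 hj).1
  split_ifs with h
  · exact hl j this
  · exact hl r (by omega)

/-- Counting: `lamb j` occurs for at most `j + 1` values `r ≤ j`, and `lamb r` for at most `r`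
values `j < r`. Since `2 j + 1 ≤ 3 j` for `j ≥ 1`, the factor 3 appears. -/
lemma sum_pairWeight_le {lamb : ℕ → ℝ} (hl : ∀ j, 1 ≤ j → 0 ≤ lamb j) :
    ∑ r ∈ Finset.range n, pairWeight lamb n r ≤ 3 * ∑ j ∈ Finset.Icc 1 n, (j : ℝ) * lamb j := by
  have h1 : ∑ r ∈ Finset.range n, pairWeight lamb n r
      ≤ ∑ j ∈ Finset.Icc 1 n, ∑ r ∈ Finset.range (j + 1), lamb j
        + ∑ r ∈ Finset.Icc 1 n, ∑ j ∈ Finset.range r, lamb r := by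
    have e : ∀ r, pairWeight lamb n r = ∑ j ∈ Finset.Icc 1 n, (if r ≤ j then lamb j else 0)
        + ∑ j ∈ Finset.Icc 1 n, (if r ≤ j then 0 else lamb r) := fun r => by
      rw [pairWeight, ← Finset.sum_add_distrib]
      refine Finset.sum_congr rfl fun j _ => ?_
      split_ifs <;> simp
    simp only [e]
    rw [Finset.sum_add_distrib]
    refine add_le_add ?_ ?_
    · rw [Finset.sum_comm]
      refine Finset.sum_le_sum fun j hj => ?_
      have := (Finset.mem_Icc.1 hj).1
      rw [← Finset.sum_filter]
      refine Finset.sum_le_sum_of_subset_of_nonneg ?_ fun _ _ _ => hl j this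
      intro r hr
      simp only [Finset.mem_filter, Finset.mem_range] at hr ⊢
      omega
    · have h2 : ∑ r ∈ Finset.range n, ∑ j ∈ Finset.Icc 1 n, (if r ≤ j then 0 else lamb r)
          ≤ ∑ r ∈ Finset.range n, ∑ j ∈ Finset.range r, lamb r := by
        refine Finset.sum_le_sum fun r _ => ?_
        have : ∀ j, (if r ≤ j then 0 else lamb r) = if j < r then lamb r else 0 := fun j => by
          split_ifs <;> first | rfl | omega
        simp only [this]
        rw [← Finset.sum_filter]
        refine Finset.sum_le_sum_of_subset_of_nonneg ?_ fun j hj _ => hl r (by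
          simp only [Finset.mem_range] at hj; omega)
        intro j hj
        simp only [Finset.mem_filter, Finset.mem_range] at hj ⊢
        omega
      refine h2.trans ?_
      rw [Finset.sum_subset (s₁ := Finset.Icc 1 n) (s₂ := Finset.range (n + 1))]
      · refine Finset.sum_le_sum_of_subset_of_nonneg (Finset.range_subset_range.2 n.le_succ) ?_
        intro r _ _
        exact Finset.sum_nonneg fun j hj => hl r (by simp only [Finset.mem_range] at hj; omega)
      · intro r hr
        simp only [Finset.mem_Icc, Finset.mem_range] at hr ⊢
        omega
      · intro r hr hr'
        simp only [Finset.mem_Icc, Finset.mem_range] at hr hr'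
        have : r = 0 := by omega
        simp [this]
  refine h1.trans ?_
  rw [Finset.mul_sum, ← Finset.sum_add_distrib]
  refine Finset.sum_le_sum fun j hj => ?_
  have hj1 := (Finset.mem_Icc.1 hj).1
  simp only [Finset.sum_const, Finset.card_range, nsmul_eq_mul]
  push_cast
  have h3 : (1 : ℝ) ≤ j := by exact_mod_cast hj1
  nlinarith [hl j hj1]

/-- By `2 |x y| ≤ x² + y²` each pair splits into two squares. The square at `k + 1` already carries
its own weight; for the one at `l` monotonicity replaces `h (k + 1)` by `h l`. Each half contributes
a factor 3. -/
lemma sum_mul_pairWeight_le {lamb : ℕ → ℝ} (hl : ∀ j, 1 ≤ j → 0 ≤ lamb j) {h : ℕ → ℝ}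
    (h0 : ∀ l ≤ n, 0 ≤ h l) (hmono : ∀ k l, k ≤ l → l ≤ n → h k ≤ h l) :
    ∑ k ∈ Finset.range n, h (k + 1) * ∑ l ∈ Finset.Ioc k n,
        2 * |α (k + 1) * α l| * pairWeight lamb n (l - k - 1)
      ≤ 6 * (∑ j ∈ Finset.Icc 1 n, (j : ℝ) * lamb j) * ∑ l ∈ Finset.Ioc 0 n, h l * α l ^ 2 := by
  set Λ := ∑ j ∈ Finset.Icc 1 n, (j : ℝ) * lamb j with hΛ
  have hT := sum_pairWeight_le (n := n) hl
  have hτ := pairWeight_nonneg (n := n) hl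
  have h1 : ∑ k ∈ Finset.range n, h (k + 1) * ∑ l ∈ Finset.Ioc k n,
        2 * |α (k + 1) * α l| * pairWeight lamb n (l - k - 1)
      ≤ ∑ k ∈ Finset.range n, h (k + 1) * α (k + 1) ^ 2 * (3 * Λ)
        + ∑ k ∈ Finset.range n, ∑ l ∈ Finset.Ioc k n,
          (h l * α l ^ 2) * pairWeight lamb n (l - k - 1) := by
    rw [← Finset.sum_add_distrib]
    refine Finset.sum_le_sum fun k hk => ?_
    have hk' := Finset.mem_range.1 hk
    have hh := h0 (k + 1) (by omega)
    have e1 : ∑ l ∈ Finset.Ioc k n, pairWeight lamb n (l - k - 1) ≤ 3 * Λ := by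
      refine le_trans (sum_comp_le_sum (t := Finset.range n) (φ := fun l => l - k - 1)
        (g := fun r => pairWeight lamb n r) ?_ ?_ fun j _ => hτ j) hT
      · intro a ha b hb hab
        simp only [Finset.coe_Ioc, Set.mem_Ioc] at ha hb hab
        omega
      · intro a ha
        simp only [Finset.mem_Ioc, Finset.mem_range] at ha ⊢
        omega
    have e2 : h (k + 1) * α (k + 1) ^ 2 * ∑ l ∈ Finset.Ioc k n, pairWeight lamb n (l - k - 1)
        ≤ h (k + 1) * α (k + 1) ^ 2 * (3 * Λ) := by gcongr
    refine le_trans ?_ (add_le_add e2 le_rfl)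
    rw [Finset.mul_sum, Finset.mul_sum, ← Finset.sum_add_distrib]
    refine Finset.sum_le_sum fun l hl => ?_
    have hl' := Finset.mem_Ioc.1 hl
    have h3 : 2 * |α (k + 1) * α l| ≤ α (k + 1) ^ 2 + α l ^ 2 := by
      rw [abs_mul, ← sq_abs (α (k + 1)), ← sq_abs (α l)]
      nlinarith [sq_nonneg (|α (k + 1)| - |α l|)]
    have h4 : h (k + 1) * α l ^ 2 ≤ h l * α l ^ 2 :=
      mul_le_mul_of_nonneg_right (hmono _ _ (by omega) (by omega)) (sq_nonneg _)
    calc h (k + 1) * (2 * |α (k + 1) * α l| * pairWeight lamb n (l - k - 1))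
        = h (k + 1) * (2 * |α (k + 1) * α l|) * pairWeight lamb n (l - k - 1) := by ring
      _ ≤ (h (k + 1) * (α (k + 1) ^ 2 + α l ^ 2)) * pairWeight lamb n (l - k - 1) :=
          mul_le_mul_of_nonneg_right (mul_le_mul_of_nonneg_left h3 hh) (hτ _)
      _ ≤ (h (k + 1) * α (k + 1) ^ 2 + h l * α l ^ 2) * pairWeight lamb n (l - k - 1) :=
          mul_le_mul_of_nonneg_right (by rw [mul_add]; linarith) (hτ _)
      _ = _ := by ring
  refine h1.trans ?_
  have h2 := sum_range_sum_Ioc_le (n := n) (h := fun l => h l * α l ^ 2)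
    (g := fun r => pairWeight lamb n (r - 1)) (G := 3 * Λ)
    (fun l hl => mul_nonneg (h0 l (Finset.mem_Ioc.1 hl).2) (sq_nonneg _)) (fun l hl => by
      have hl' := Finset.mem_Ioc.1 hl
      refine le_trans (sum_comp_le_sum (t := Finset.range n) (φ := fun k => l - k - 1)
        (g := fun r => pairWeight lamb n r) ?_ ?_ fun j _ => hτ j) hT
      · intro a ha b hb hab
        simp only [Finset.coe_range, Set.mem_Iio] at ha hb hab
        omega
      · intro a ha
        simp only [Finset.mem_range] at ha ⊢
        omega)
  have h3 : ∑ k ∈ Finset.range n, h (k + 1) * α (k + 1) ^ 2 * (3 * Λ)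
      = 3 * Λ * ∑ l ∈ Finset.Ioc 0 n, h l * α l ^ 2 := by
    rw [← Finset.sum_mul, mul_comm]
    congr 1
    rw [Finset.range_eq_Ico, Finset.sum_Ico_add' (fun l => h l * α l ^ 2) 0 n 1]
    refine Finset.sum_congr ?_ fun _ _ => rfl
    ext l
    simp only [Finset.mem_Ico, Finset.mem_Ioc]
    omega
  rw [h3]
  linarith

end Sums

/-! ### Summation of the Lindeberg steps under projective bounds. -/

section Lindeberg

variable {Ω : Type*} {m0 : MeasurableSpace Ω}

lemma lpNorm_congr_ae {P : Measure Ω} {f g : Ω → ℝ} {q : ℝ≥0∞} (hfg : f =ᵐ[P] g) :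
    lpNorm f q P = lpNorm g q P := by
  simp only [lpNorm, eLpNorm_congr_ae hfg]
  by_cases hf : AEStronglyMeasurable f P
  · rw [if_pos hf, if_pos (hf.congr hfg)]
  · rw [if_neg hf, if_neg fun hg => hf (hg.congr hfg.symm)]

lemma lpNorm_const_mul_real {P : Measure Ω} (a : ℝ) (f : Ω → ℝ) (q : ℝ≥0∞) :
    lpNorm (fun ω => a * f ω) q P = |a| * lpNorm f q P := by
  have := lpNorm_const_smul (𝕜 := ℝ) a f P (p := q)
  rw [coe_nnnorm, Real.norm_eq_abs] at this
  exact this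

/-- An adapted sequence in `L^p` with bounds `c` for the norms of the projections and `lamb`
for the mixing coefficients of order two. -/
structure ProjectiveBounds (P : Measure Ω) (𝓕 : ℕ → MeasurableSpace Ω) (Y : ℕ → Ω → ℝ) (p : ℝ)
    (c lamb : ℕ → ℝ) : Prop extends AdaptedLp P 𝓕 Y p where
  cond : ∀ k r, lpNorm (P[Y (k + r) | 𝓕 k]) (ENNReal.ofReal p) P ≤ c r
  cross : ∀ k r, 1 ≤ r →
    lpNorm (fun ω => Y k ω * (P[Y (k + r) | 𝓕 k]) ω) (ENNReal.ofReal (p / 2)) P ≤ lamb r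
  pair : ∀ i j r, 1 ≤ j →
    lpNorm (fun ω => (P[fun ω' => Y (i + j) ω' * Y (i + j + r) ω' | 𝓕 i]) ω
      - ∫ ω', Y (i + j) ω' * Y (i + j + r) ω' ∂P) (ENNReal.ofReal (p / 2)) P ≤ lamb j

variable {P : Measure Ω} [IsProbabilityMeasure P] {𝓕 : ℕ → MeasurableSpace Ω} {Y : ℕ → Ω → ℝ}
  {p : ℝ} {c lamb : ℕ → ℝ}

omit [IsProbabilityMeasure P] in
lemma AdaptedLp.const_mul (h : AdaptedLp P 𝓕 Y p) (α : ℕ → ℝ) :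
    AdaptedLp P 𝓕 (fun l ω => α l * Y l ω) p where
  mono := h.mono
  le := h.le
  meas k := (h.meas k).const_mul (α k)
  memLp k := (h.memLp k).const_mul (α k)

/-- Triangle inequality. The exponent is free because both `p` (for the increments) and `2` (for the
smoothing scale) are needed. -/
lemma lpNorm_proj_le (α : ℕ → ℝ) {q : ℝ≥0∞} (hq : 1 ≤ q)
    (hYq : ∀ k, MemLp (Y k) q P) (hc : ∀ k r, lpNorm (P[Y (k + r) | 𝓕 k]) q P ≤ c r)
    (n k : ℕ) : lpNorm (proj P 𝓕 (fun l ω => α l * Y l ω) n k) q P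
      ≤ ∑ l ∈ Finset.Ioc k n, |α l| * c (l - k) := by
  have hae : proj P 𝓕 (fun l ω => α l * Y l ω) n k
      =ᵐ[P] ∑ l ∈ Finset.Ioc k n, fun ω => α l * (P[Y l | 𝓕 k]) ω := by
    have e : tail (fun l ω => α l * Y l ω) n k = ∑ l ∈ Finset.Ioc k n, α l • Y l := by
      ext ω
      simp [tail]
    rw [proj, e]
    refine (condExp_finsetSum (fun l _ => ((hYq l).integrable hq).smul (α l)) _).trans ?_
    refine eventuallyEq_sum fun l _ => ?_
    exact condExp_smul (α l) (Y l) (𝓕 k)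
  rw [lpNorm_congr_ae hae]
  refine (lpNorm_sum_le (fun l _ => ((hYq l).condExp hq).const_mul (α l)) hq).trans ?_
  refine Finset.sum_le_sum fun l hl => ?_
  rw [lpNorm_const_mul_real]
  have hl' := (Finset.mem_Ioc.1 hl).1
  have := hc k (l - k)
  rw [show k + (l - k) = l by omega] at this
  gcongr

namespace ProjectiveBounds

variable (h : ProjectiveBounds P 𝓕 Y p c lamb)

include h

omit [IsProbabilityMeasure P] in
lemma c_nonneg (r : ℕ) : 0 ≤ c r := lpNorm_nonneg.trans (h.cond 0 r)

omit [IsProbabilityMeasure P] in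
lemma lamb_nonneg (j : ℕ) (hj : 1 ≤ j) : 0 ≤ lamb j := lpNorm_nonneg.trans (h.cross 0 j hj)

lemma lpNorm_le (k : ℕ) (hp : 2 < p) : lpNorm (Y k) (ENNReal.ofReal p) P ≤ c 0 := by
  have h1 := h.cond k 0
  rwa [add_zero, condExp_of_stronglyMeasurable (h.le k) (h.meas k)
    ((h.memLp k).integrable (by rw [ENNReal.one_le_ofReal]; linarith))] at h1

variable (α : ℕ → ℝ) (hp : 2 < p)

include hp

lemma lpNorm_proj_le_projBound (n k : ℕ) :
    lpNorm (proj P 𝓕 (fun l ω => α l * Y l ω) n k) (ENNReal.ofReal p) P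
      ≤ projBound α c n k := by
  refine (LinearStatistic.lpNorm_proj_le α (by rw [ENNReal.one_le_ofReal]; linarith) h.memLp
    h.cond n k).trans (Finset.sum_le_sum fun l _ => ?_)
  have := h.c_nonneg (l - k - 1)
  gcongr
  linarith

lemma lpNorm_step_zero_le (n : ℕ) :
    lpNorm (step P 𝓕 (fun l ω => α l * Y l ω) n 0) (ENNReal.ofReal p) P
      ≤ projBound α c n 0 := by
  have : step P 𝓕 (fun l ω => α l * Y l ω) n 0 = proj P 𝓕 (fun l ω => α l * Y l ω) n 0 :=
    funext step_zero
  rw [this]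
  exact h.lpNorm_proj_le_projBound α hp n 0

/-- The terms `c (l - k - 1)` of `projBound` come from `X (k + 1)` and the projection at time `k +
1`, the terms `c (l - k)` from the projection at time `k`. -/
lemma lpNorm_step_succ_le {n k : ℕ} (hk : k < n) :
    lpNorm (step P 𝓕 (fun l ω => α l * Y l ω) n (k + 1)) (ENNReal.ofReal p) P
      ≤ projBound α c n k := by
  have hA := h.toAdaptedLp.const_mul α
  have h1p : (1 : ℝ≥0∞) ≤ ENNReal.ofReal p := by rw [ENNReal.one_le_ofReal]; linarith
  have e : step P 𝓕 (fun l ω => α l * Y l ω) n (k + 1)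
      = (fun ω => α (k + 1) * Y (k + 1) ω) + proj P 𝓕 (fun l ω => α l * Y l ω) n (k + 1)
        - proj P 𝓕 (fun l ω => α l * Y l ω) n k := by
    ext ω
    rw [step_succ]
    rfl
  rw [e]
  have m1 := hA.memLp (k + 1)
  have m2 := hA.memLp_proj hp n (k + 1)
  refine (lpNorm_sub_le (m1.add m2) h1p).trans ?_
  refine (add_le_add (lpNorm_add_le m1 h1p) le_rfl).trans ?_
  rw [lpNorm_const_mul_real]
  have a1 := LinearStatistic.lpNorm_proj_le α h1p h.memLp h.cond n (k + 1)
  have a2 := LinearStatistic.lpNorm_proj_le α h1p h.memLp h.cond n k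
  have a3 : |α (k + 1)| * lpNorm (Y (k + 1)) (ENNReal.ofReal p) P ≤ |α (k + 1)| * c 0 :=
    mul_le_mul_of_nonneg_left (h.lpNorm_le (k + 1) hp) (abs_nonneg _)
  have hs : Finset.Ioc k n = insert (k + 1) (Finset.Ioc (k + 1) n) := by
    ext l
    simp only [Finset.mem_insert, Finset.mem_Ioc]
    omega
  have e2 : projBound α c n k = ∑ l ∈ Finset.Ioc k n, |α l| * c (l - k)
      + (|α (k + 1)| * c 0 + ∑ l ∈ Finset.Ioc (k + 1) n, |α l| * c (l - (k + 1))) := by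
    simp only [projBound, mul_add]
    rw [Finset.sum_add_distrib]
    congr 1
    rw [hs, Finset.sum_insert (by simp)]
    simp [Nat.sub_sub]
  rw [e2]
  linarith

section Bounds

variable {n : ℕ} {m η : ℝ} (hm0 : 0 ≤ m) (hm : ∀ l ∈ Finset.Ioc 0 n, |α l| ≤ m)
  (hη : ∑ r ∈ Finset.range (n + 1), c r = η)

include hm0 hm hη

lemma lpNorm_step_rpow_le {i : ℕ} (hi : i ≤ n) :
    lpNorm (step P 𝓕 (fun l ω => α l * Y l ω) n i) (ENNReal.ofReal p) P ^ (p - 2)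
      ≤ (2 * m * η) ^ (p - 2) := by
  refine Real.rpow_le_rpow lpNorm_nonneg ?_ (by linarith)
  have hb : ∀ k, projBound α c n k ≤ 2 * m * η := fun k => by
    rw [← hη]; exact projBound_le h.c_nonneg hm hm0
  cases i with
  | zero => exact (h.lpNorm_step_zero_le α hp n).trans (hb 0)
  | succ k => exact (h.lpNorm_step_succ_le α hp (by omega)).trans (hb k)

/-- Covariance of a product with an increment of a Hölder function of the martingale. -/
lemma abs_covar_increment_le (hp3 : p ≤ 3) {f : ℝ → ℝ} (hf : LipschitzWith 1 f) {v : ℝ}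
    (hv : 0 < v) {k r i : ℕ} (hk : k < n) (hi : i ≤ k) :
    |covar P (fun ω => gaussHess v f (mart P 𝓕 (fun l ω => α l * Y l ω) n (i + 1) ω)
        - gaussHess v f (mart P 𝓕 (fun l ω => α l * Y l ω) n i ω))
        (fun ω => Y (k + 1) ω * Y (k + 1 + r) ω)|
      ≤ holderConst p v * (2 * m * η) ^ (p - 2)
        * (2 * (if r ≤ k + 1 - i then lamb (k + 1 - i) else lamb r)) := by
  have hA := h.toAdaptedLp.const_mul α
  have hp0 : 0 < p := by linarith
  set H := holderConst p v with hH
  have hH0 : 0 ≤ H := holderConst_nonneg hv.le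
  set N := mart P 𝓕 (fun l ω => α l * Y l ω) n with hN
  set D := fun ω => gaussHess v f (N (i + 1) ω) - gaussHess v f (N i ω) with hD
  have hc := continuous_gaussHess hf hv
  have hDm : StronglyMeasurable[𝓕 i] D :=
    (hc.comp_stronglyMeasurable (hA.stronglyMeasurable_mart_succ n i)).sub
      (hc.comp_stronglyMeasurable (hA.stronglyMeasurable_mart n i))
  have hDm0 : AEStronglyMeasurable D P := (hDm.mono (h.le i)).aestronglyMeasurable
  have hDB : ∀ ω, |D ω| ≤ 2 / √v + 2 / √v := fun ω =>
    (abs_sub _ _).trans (add_le_add (abs_gaussHess_le hf hv _) (abs_gaussHess_le hf hv _))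
  have hDH : ∀ ω, |D ω| ≤ H * (|step P 𝓕 (fun l ω => α l * Y l ω) n i ω| ^ (p - 2) + 0) :=
    fun ω => by
      rw [add_zero]
      exact abs_gaussHess_sub_le_rpow hf hv hp hp3 _ _
  have he := hA.memLp_step hp n i
  have hQ := memLp_mul_half hp0 (h.memLp (k + 1)) (h.memLp (k + 1 + r))
  have hE := h.lpNorm_step_rpow_le α hp hm0 hm hη (i := i) (by omega)
  have hE0 : 0 ≤ lpNorm (step P 𝓕 (fun l ω => α l * Y l ω) n i) (ENNReal.ofReal p) P ^ (p - 2) :=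
    Real.rpow_nonneg lpNorm_nonneg _
  have hη0 : 0 ≤ η := by rw [← hη]; exact Finset.sum_nonneg fun r _ => h.c_nonneg r
  -- The larger of two gaps is exploited. If the distance `k + 1 - i` to the past is at least `r`,
  -- the whole pair is conditioned on `𝓕 i`; otherwise the later factor is projected on `𝓕 (k + 1)`,
  -- and centering costs a factor 2.
  split_ifs with hr
  · refine (abs_covar_le_of_condExp (h.le i) hp hH0 le_rfl he hQ hDm hDB hDH).trans ?_
    have h1 := h.pair i (k + 1 - i) r (by omega)
    rw [show i + (k + 1 - i) = k + 1 by omega] at h1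
    have h2 : lpNorm (fun ω => (P[fun ω' => Y (k + 1) ω' * Y (k + 1 + r) ω' | 𝓕 i]) ω
      - ∫ ω', Y (k + 1) ω' * Y (k + 1 + r) ω' ∂P) (ENNReal.ofReal (p / 2)) P
        ≤ 2 * lamb (k + 1 - i) := by
      have := h.lamb_nonneg (k + 1 - i) (by omega)
      linarith
    rw [add_zero]
    gcongr
    exact lpNorm_nonneg
  · have hY1 := AdaptedLp.memLp_two hp (h.memLp (k + 1))
    have hY2 := AdaptedLp.memLp_two hp (h.memLp (k + 1 + r))
    have hYi : Integrable (fun ω => Y (k + 1) ω * Y (k + 1 + r) ω) P :=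
      integrable_mul_of_memLp_two hY1 hY2
    have h1p : (1 : ℝ≥0∞) ≤ ENNReal.ofReal p := by rw [ENNReal.one_le_ofReal]; linarith
    have hQ' := memLp_mul_half hp0 (h.memLp (k + 1))
      ((h.memLp (k + 1 + r)).condExp (m := 𝓕 (k + 1)) h1p)
    -- Both `D` and `Y (k + 1)` are measurable with respect to `𝓕 (k + 1)`, so only the later factor
    -- is affected by this conditioning.
    have e : covar P D (fun ω => Y (k + 1) ω * Y (k + 1 + r) ω)
        = covar P D (fun ω => Y (k + 1) ω * (P[Y (k + 1 + r) | 𝓕 (k + 1)]) ω) := by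
      have hle : 𝓕 i ≤ 𝓕 (k + 1) := h.mono (by omega)
      have e1 := integral_mul_condExp (h.le (k + 1)) (h.meas (k + 1))
        (hY2.integrable one_le_two) hYi
      have e2 := integral_mul_condExp (h.le (k + 1)) ((hDm.mono hle).mul (h.meas (k + 1)))
        (hY2.integrable one_le_two) (by
          simpa [mul_assoc] using integrable_bdd_mul hDm0 hDB hYi)
      simp only [Pi.mul_apply, mul_assoc] at e2
      rw [covar, covar, e1, e2]
    rw [e]
    refine (abs_covar_le hp hH0 le_rfl he hQ' hDm0 hDB hDH).trans ?_
    have h1 := h.cross (k + 1) r (by omega)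
    rw [add_zero]
    have h3 : (0 : ℝ) ≤ lpNorm (fun ω => Y (k + 1) ω * (P[Y (k + 1 + r) | 𝓕 (k + 1)]) ω)
      (ENNReal.ofReal (p / 2)) P := lpNorm_nonneg
    gcongr

/-- At fixed variance the second derivative is telescoped along the martingale from time 0. The
increment at time `i` is at distance `k + 1 - i` from the pair, and summing over this distance
yields `pairWeight`. -/
lemma abs_covar_gaussHess_mul_le (hp3 : p ≤ 3) {f : ℝ → ℝ} (hf : LipschitzWith 1 f) {v : ℝ}
    (hv : 0 < v) {k r : ℕ} (hk : k < n) :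
    |covar P (fun ω => gaussHess v f (mart P 𝓕 (fun l ω => α l * Y l ω) n (k + 1) ω))
        (fun ω => Y (k + 1) ω * Y (k + 1 + r) ω)|
      ≤ holderConst p v * (2 * m * η) ^ (p - 2) * (2 * pairWeight lamb n r) := by
  have hA := h.toAdaptedLp.const_mul α
  have hc := continuous_gaussHess hf hv
  have hQi : Integrable (fun ω => Y (k + 1) ω * Y (k + 1 + r) ω) P :=
    integrable_mul_of_memLp_two (AdaptedLp.memLp_two hp (h.memLp (k + 1)))
      (AdaptedLp.memLp_two hp (h.memLp (k + 1 + r)))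
  have hm' : ∀ i, AEStronglyMeasurable
      (fun ω => gaussHess v f (mart P 𝓕 (fun l ω => α l * Y l ω) n i ω)) P := fun i =>
    ((hc.comp_stronglyMeasurable (hA.stronglyMeasurable_mart n i)).mono
      (h.le i)).aestronglyMeasurable
  have key : ∀ i ≤ k + 1,
      |covar P (fun ω => gaussHess v f (mart P 𝓕 (fun l ω => α l * Y l ω) n i ω))
        (fun ω => Y (k + 1) ω * Y (k + 1 + r) ω)|
      ≤ ∑ i' ∈ Finset.range i, holderConst p v * (2 * m * η) ^ (p - 2)
        * (2 * (if r ≤ k + 1 - i' then lamb (k + 1 - i') else lamb r)) := by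
    intro i hi
    induction i with
    -- The martingale is started at the constant 0 so that this covariance vanishes.
    | zero =>
      simp only [mart]
      rw [covar_const_left]
      simp
    | succ i ih =>
      rw [Finset.sum_range_succ]
      have h1 := ih (by omega)
      have h2 := h.abs_covar_increment_le α hp hm0 hm hη hp3 hf hv (r := r) hk (i := i) (by omega)
      rw [covar_sub_left (hm' _) (fun ω => abs_gaussHess_le hf hv _) (hm' _)
        (fun ω => abs_gaussHess_le hf hv _) hQi] at h2
      have h3 := abs_sub_abs_le_abs_sub
        (covar P (fun ω => gaussHess v f (mart P 𝓕 (fun l ω => α l * Y l ω) n (i + 1) ω))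
          (fun ω => Y (k + 1) ω * Y (k + 1 + r) ω))
        (covar P (fun ω => gaussHess v f (mart P 𝓕 (fun l ω => α l * Y l ω) n i ω))
          (fun ω => Y (k + 1) ω * Y (k + 1 + r) ω))
      linarith
  refine (key (k + 1) le_rfl).trans ?_
  rw [← Finset.mul_sum, ← Finset.mul_sum]
  have hH0 : 0 ≤ holderConst p v := holderConst_nonneg hv.le
  have hη0 : 0 ≤ η := by rw [← hη]; exact Finset.sum_nonneg fun r _ => h.c_nonneg r
  have hE0 : 0 ≤ (2 * m * η) ^ (p - 2) := Real.rpow_nonneg (by positivity) _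
  refine mul_le_mul_of_nonneg_left ?_ (mul_nonneg hH0 hE0)
  refine mul_le_mul_of_nonneg_left ?_ two_pos.le
  refine sum_comp_le_sum (φ := fun i => k + 1 - i)
    (g := fun j => if r ≤ j then lamb j else lamb r) ?_ ?_ ?_
  · intro a ha b hb hab
    simp only [Finset.coe_range, Set.mem_Iio] at ha hb hab
    omega
  · intro a ha
    simp only [Finset.mem_range, Finset.mem_Icc] at ha ⊢
    omega
  · intro j hj
    have hj1 := (Finset.mem_Icc.1 hj).1
    split_ifs
    · exact h.lamb_nonneg j hj1
    · exact h.lamb_nonneg r (by omega)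

/-- The diagonal and off-diagonal terms of the second order expansion. -/
lemma covar_sq_add_covar_tail_le (hp3 : p ≤ 3) {f : ℝ → ℝ} (hf : LipschitzWith 1 f) {v : ℝ}
    (hv : 0 < v) {k : ℕ} (hk : k < n) :
    covar P (fun ω => gaussHess v f (mart P 𝓕 (fun l ω => α l * Y l ω) n (k + 1) ω))
        (fun ω => (α (k + 1) * Y (k + 1) ω) ^ 2)
      + 2 * covar P (fun ω => gaussHess v f (mart P 𝓕 (fun l ω => α l * Y l ω) n (k + 1) ω))
        (fun ω => α (k + 1) * Y (k + 1) ω * tail (fun l ω => α l * Y l ω) n (k + 1) ω)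
      ≤ 2 * (2 * m * η) ^ (p - 2) * (holderConst p v * ∑ l ∈ Finset.Ioc k n,
        2 * |α (k + 1) * α l| * pairWeight lamb n (l - k - 1)) := by
  have hA := h.toAdaptedLp.const_mul α
  set U := fun ω => gaussHess v f (mart P 𝓕 (fun l ω => α l * Y l ω) n (k + 1) ω) with hU
  have hUm : AEStronglyMeasurable U P :=
    (((continuous_gaussHess hf hv).comp_stronglyMeasurable
      (hA.stronglyMeasurable_mart n (k + 1))).mono (h.le (k + 1))).aestronglyMeasurable
  have hUB : ∀ ω, |U ω| ≤ 2 / √v := fun ω => abs_gaussHess_le hf hv _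
  have hint : ∀ l, Integrable (fun ω => Y (k + 1) ω * Y l ω) P := fun l =>
    integrable_mul_of_memLp_two (AdaptedLp.memLp_two hp (h.memLp (k + 1)))
      (AdaptedLp.memLp_two hp (h.memLp l))
  have hcm : ∀ (a : ℝ) (Q : Ω → ℝ), covar P U (fun ω => a * Q ω) = a * covar P U Q := by
    intro a Q
    simp only [covar, mul_left_comm _ a]
    rw [integral_const_mul, integral_const_mul]
    ring
  have e1 : covar P U (fun ω => (α (k + 1) * Y (k + 1) ω) ^ 2)
      = α (k + 1) * α (k + 1) * covar P U (fun ω => Y (k + 1) ω * Y (k + 1) ω) := by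
    rw [← hcm]
    congr 1
    ext ω
    ring
  have e2 : covar P U
      (fun ω => α (k + 1) * Y (k + 1) ω * tail (fun l ω => α l * Y l ω) n (k + 1) ω)
      = ∑ l ∈ Finset.Ioc (k + 1) n, α (k + 1) * α l
          * covar P U (fun ω => Y (k + 1) ω * Y l ω) := by
    have e3 : ∀ ω, α (k + 1) * Y (k + 1) ω * tail (fun l ω => α l * Y l ω) n (k + 1) ω
        = ∑ l ∈ Finset.Ioc (k + 1) n, α (k + 1) * α l * (Y (k + 1) ω * Y l ω) := fun ω => by
      rw [tail, Finset.mul_sum]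
      exact Finset.sum_congr rfl fun l _ => by ring
    simp only [covar, e3, Finset.mul_sum, mul_sub]
    rw [integral_finsetSum _ fun l _ => integrable_bdd_mul hUm hUB ((hint l).const_mul _),
      integral_finsetSum _ fun l _ => (hint l).const_mul _, Finset.mul_sum,
      ← Finset.sum_sub_distrib]
    refine Finset.sum_congr rfl fun l _ => ?_
    have := hcm (α (k + 1) * α l) (fun ω => Y (k + 1) ω * Y l ω)
    simp only [covar] at this
    rw [this]
    ring
  have hb : ∀ l ∈ Finset.Ioc k n, α (k + 1) * α l * covar P U (fun ω => Y (k + 1) ω * Y l ω)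
      ≤ |α (k + 1) * α l| * (holderConst p v * (2 * m * η) ^ (p - 2)
        * (2 * pairWeight lamb n (l - k - 1))) := by
    intro l hl
    have hl' := Finset.mem_Ioc.1 hl
    have h1 := h.abs_covar_gaussHess_mul_le α hp hm0 hm hη hp3 hf hv hk (r := l - k - 1)
    rw [show k + 1 + (l - k - 1) = l by omega] at h1
    refine (le_abs_self _).trans ?_
    rw [abs_mul]
    gcongr
  have hs : Finset.Ioc k n = insert (k + 1) (Finset.Ioc (k + 1) n) := by
    ext l
    simp only [Finset.mem_insert, Finset.mem_Ioc]
    omega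
  have hη0 : 0 ≤ η := by rw [← hη]; exact Finset.sum_nonneg fun r _ => h.c_nonneg r
  have hE0 : 0 ≤ (2 * m * η) ^ (p - 2) := Real.rpow_nonneg (by positivity) _
  have hH0 : 0 ≤ holderConst p v := holderConst_nonneg hv.le
  have hτ := pairWeight_nonneg (n := n) h.lamb_nonneg
  have h1 := hb (k + 1) (Finset.mem_Ioc.2 ⟨by omega, by omega⟩)
  have h2 : ∑ l ∈ Finset.Ioc (k + 1) n, α (k + 1) * α l
          * covar P U (fun ω => Y (k + 1) ω * Y l ω)
      ≤ ∑ l ∈ Finset.Ioc (k + 1) n, |α (k + 1) * α l| * (holderConst p v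
        * (2 * m * η) ^ (p - 2) * (2 * pairWeight lamb n (l - k - 1))) :=
    Finset.sum_le_sum fun l hl => hb l (by rw [hs]; exact Finset.mem_insert_of_mem hl)
  rw [e1, e2, hs, Finset.sum_insert (by simp), mul_add, mul_add]
  have h3 : 2 * ∑ l ∈ Finset.Ioc (k + 1) n, |α (k + 1) * α l| * (holderConst p v
        * (2 * m * η) ^ (p - 2) * (2 * pairWeight lamb n (l - k - 1)))
      = 2 * (2 * m * η) ^ (p - 2) * (holderConst p v * ∑ l ∈ Finset.Ioc (k + 1) n,
        2 * |α (k + 1) * α l| * pairWeight lamb n (l - k - 1)) := by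
    rw [Finset.mul_sum, Finset.mul_sum, Finset.mul_sum]
    exact Finset.sum_congr rfl fun l _ => by ring
  -- The right side counts the diagonal twice, like the other pairs; nonnegativity pays for the
  -- extra copy.
  have h4 : 0 ≤ |α (k + 1) * α (k + 1)| * (holderConst p v * (2 * m * η) ^ (p - 2)
        * (2 * pairWeight lamb n (k + 1 - k - 1))) := by
    have := hτ (k + 1 - k - 1)
    positivity
  rw [← h3]
  linarith

/-- The covariance with the squared projection of the increment of the weights. -/
lemma abs_covar_sub_proj_sq_le (hp3 : p ≤ 3) {f : ℝ → ℝ} (hf : LipschitzWith 1 f) {A : ℝ}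
    (hA : 0 < A) {k : ℕ} (hk : k < n) :
    |covar P (fun ω => gaussHess (A + residVar P 𝓕 (fun l ω => α l * Y l ω) n k) f
          (mart P 𝓕 (fun l ω => α l * Y l ω) n k ω)
        - gaussHess (A + residVar P 𝓕 (fun l ω => α l * Y l ω) n (k + 1)) f
          (mart P 𝓕 (fun l ω => α l * Y l ω) n (k + 1) ω))
        (fun ω => proj P 𝓕 (fun l ω => α l * Y l ω) n k ω ^ 2)|
      ≤ 2 * (1 + gaussMoment (p - 2)) * (2 * m * η) ^ (p - 2)
        * (holderConst p (A + residVar P 𝓕 (fun l ω => α l * Y l ω) n (k + 1))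
          * projBound α c n k ^ 2) := by
  set X := fun (l : ℕ) (ω : Ω) => α l * Y l ω with hX
  have hAd : AdaptedLp P 𝓕 X p := h.toAdaptedLp.const_mul α
  have hp0 : 0 < p := by linarith
  set v := A + residVar P 𝓕 X n (k + 1) with hv
  have hv0 : 0 < v := by
    have := residVar_nonneg (P := P) (𝓕 := 𝓕) (X := X) (n := n) (k := k + 1)
    positivity
  have hd := hAd.memLp_step hp n (k + 1)
  set s := lpNorm (step P 𝓕 X n (k + 1)) 2 P with hs
  have hs0 : 0 ≤ s := lpNorm_nonneg
  have hw : A + residVar P 𝓕 X n k = s ^ 2 + v := by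
    rw [hAd.residVar_of_lt hp hk, integral_sq_eq_lpNorm_sq (AdaptedLp.memLp_two hp hd), hv]
    ring
  rw [hw]
  have hv1 : 0 < s ^ 2 + v := by positivity
  set H := holderConst p v with hH
  have hH0 : 0 ≤ H := holderConst_nonneg hv0.le
  set U := fun ω => gaussHess (s ^ 2 + v) f (mart P 𝓕 X n k ω)
    - gaussHess v f (mart P 𝓕 X n (k + 1) ω) with hU
  have hUm : AEStronglyMeasurable U P :=
    ((((continuous_gaussHess hf hv1).comp_stronglyMeasurable
      (hAd.stronglyMeasurable_mart n k)).mono (h.le _)).sub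
      (((continuous_gaussHess hf hv0).comp_stronglyMeasurable
      (hAd.stronglyMeasurable_mart n (k + 1))).mono (h.le _))).aestronglyMeasurable
  have hUB : ∀ ω, |U ω| ≤ 2 / √(s ^ 2 + v) + 2 / √v := fun ω =>
    (abs_sub _ _).trans (add_le_add (abs_gaussHess_le hf hv1 _) (abs_gaussHess_le hf hv0 _))
  have hκ := gaussMoment_nonneg (p - 2)
  -- The variance and the argument both change. They are changed one at a time, at the cost of a
  -- power of the norm of the new increment and of a power of the current increment.
  have hUH : ∀ ω, |U ω| ≤ H * (|step P 𝓕 X n k ω| ^ (p - 2)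
      + s ^ (p - 2) * gaussMoment (p - 2)) := fun ω => by
    have h1 := abs_gaussHess_add_sub_le hf hv0 hp hp3 hs0 (mart P 𝓕 X n k ω)
    have h2 := abs_gaussHess_sub_le_rpow hf hv0 hp hp3 (mart P 𝓕 X n k ω)
      (mart P 𝓕 X n (k + 1) ω)
    rw [abs_sub_comm (mart P 𝓕 X n k ω)] at h2
    have h3 := abs_sub_le (gaussHess (s ^ 2 + v) f (mart P 𝓕 X n k ω))
      (gaussHess v f (mart P 𝓕 X n k ω)) (gaussHess v f (mart P 𝓕 X n (k + 1) ω))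
    simp only [step, mul_add]
    linarith
  have hr := hAd.memLp_proj hp n k
  refine (abs_covar_le hp hH0 (by positivity) (hAd.memLp_step hp n k) (memLp_sq_half hp0 hr) hUm
    hUB hUH).trans ?_
  rw [lpNorm_sq_half hp0 hr]
  have a1 := h.lpNorm_step_rpow_le α hp hm0 hm hη (i := k) hk.le
  have a2 := h.lpNorm_step_rpow_le α hp hm0 hm hη (i := k + 1) hk
  have a3 : s ^ (p - 2) ≤ (2 * m * η) ^ (p - 2) := by
    refine le_trans (Real.rpow_le_rpow hs0 (lpNorm_mono_exponent ?_ hd) (by linarith)) a2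
    rw [← ENNReal.ofReal_ofNat 2]
    exact ENNReal.ofReal_le_ofReal hp.le
  have a4 := h.lpNorm_proj_le_projBound α hp n k
  have a5 : lpNorm (step P 𝓕 X n k) (ENNReal.ofReal p) P ^ (p - 2)
      + s ^ (p - 2) * gaussMoment (p - 2) ≤ (1 + gaussMoment (p - 2)) * (2 * m * η) ^ (p - 2) := by
    have := mul_le_mul_of_nonneg_right a3 hκ
    linarith
  have a6 : (0 : ℝ) ≤ lpNorm (proj P 𝓕 X n k) (ENNReal.ofReal p) P := lpNorm_nonneg
  have a7 : 0 ≤ (1 + gaussMoment (p - 2)) * (2 * m * η) ^ (p - 2) := by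
    refine le_trans ?_ a5
    have : 0 ≤ lpNorm (step P 𝓕 X n k) (ENNReal.ofReal p) P ^ (p - 2) :=
      Real.rpow_nonneg lpNorm_nonneg _
    positivity
  calc _ ≤ H * ((1 + gaussMoment (p - 2)) * (2 * m * η) ^ (p - 2))
        * (2 * projBound α c n k ^ 2) := by gcongr
    _ = _ := by ring

/-- The Lindeberg bound for the smoothed difference. -/
theorem integral_gaussSmooth_sub_le (hp3 : p ≤ 3) {f : ℝ → ℝ} (hf : LipschitzWith 1 f) {A : ℝ}
    (hA : 0 < A) :
    ∫ ω, gaussSmooth A f (∑ l ∈ Finset.Ioc 0 n, α l * Y l ω) ∂P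
      - ∫ ω, gaussSmooth (A + residVar P 𝓕 (fun l ω => α l * Y l ω) n 0) f
          (proj P 𝓕 (fun l ω => α l * Y l ω) n 0 ω) ∂P
    ≤ (2 * m * η) ^ (p - 2) * (6 * (∑ j ∈ Finset.Icc 1 n, (j : ℝ) * lamb j)
        + 4 * (2 + gaussMoment (p - 2) + gaussMoment p) * η ^ 2)
      * ∑ l ∈ Finset.Ioc 0 n,
        holderConst p (A + residVar P 𝓕 (fun l ω => α l * Y l ω) n l) * α l ^ 2 := by
  set X := fun (l : ℕ) (ω : Ω) => α l * Y l ω with hX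
  have hAd : AdaptedLp P 𝓕 X p := h.toAdaptedLp.const_mul α
  set E := (2 * m * η) ^ (p - 2) with hE
  set w := fun k => A + residVar P 𝓕 X n k with hw
  set H := fun k => holderConst p (w k) with hH
  set U := fun (k : ℕ) (ω : Ω) => gaussHess (w k) f (mart P 𝓕 X n k ω) with hU
  have hη0 : 0 ≤ η := by rw [← hη]; exact Finset.sum_nonneg fun r _ => h.c_nonneg r
  have hE0 : 0 ≤ E := Real.rpow_nonneg (by positivity) _
  have hw0 : ∀ k, 0 < w k := fun k => by
    have := residVar_nonneg (P := P) (𝓕 := 𝓕) (X := X) (n := n) (k := k)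
    simp only [hw]
    positivity
  have hH0 : ∀ l ≤ n, 0 ≤ H l := fun l _ => holderConst_nonneg (hw0 l).le
  have hHm : ∀ k l, k ≤ l → l ≤ n → H k ≤ H l := fun k l hkl hl =>
    holderConst_anti hp (hw0 l) (by
      have := hAd.residVar_anti hp hkl hl
      simp only [hw]
      linarith)
  have hUm : ∀ k, StronglyMeasurable[𝓕 k] (U k) := fun k =>
    (continuous_gaussHess hf (hw0 k)).comp_stronglyMeasurable (hAd.stronglyMeasurable_mart n k)
  have hUB : ∀ k ω, |U k ω| ≤ 2 / √(w k) := fun k ω => abs_gaussHess_le hf (hw0 k) _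
  -- Boundary terms of the summation by parts of the squared projections. What remains of each step
  -- is the covariance of `U k - U (k + 1)` with the squared projection at time `k`.
  set a := fun k => covar P (U k) (fun ω => proj P 𝓕 X n k ω ^ 2) with ha
  have hstep : ∀ k ∈ Finset.range n,
      ∫ ω, gaussSmooth (w (k + 1)) f (mart P 𝓕 X n (k + 2) ω) ∂P
        - ∫ ω, gaussSmooth (w k) f (mart P 𝓕 X n (k + 1) ω) ∂P
      ≤ E * (H (k + 1) * ∑ l ∈ Finset.Ioc k n,
          2 * |α (k + 1) * α l| * pairWeight lamb n (l - k - 1))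
        + (2 + gaussMoment (p - 2) + gaussMoment p) * E
          * (H (k + 1) * projBound α c n k ^ 2) + (a (k + 1) - a k) / 2 := by
    intro k hk
    have hk' := Finset.mem_range.1 hk
    have h1 := hAd.integral_gaussSmooth_step_le hp hp3 hk' hf hA
    have h2 := hAd.covar_step_sq hp hk' (U := U (k + 1))
      ((continuous_gaussHess hf (hw0 _)).comp_stronglyMeasurable
        (hAd.stronglyMeasurable_mart_succ n k)) (hUB _)
    have h3 := h.covar_sq_add_covar_tail_le α hp hm0 hm hη hp3 hf (hw0 (k + 1)) hk'
    have h4 := h.abs_covar_sub_proj_sq_le α hp hm0 hm hη hp3 hf hA hk'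
    have hmk : ∀ k, AEStronglyMeasurable (U k) P := fun k =>
      ((hUm k).mono (h.le k)).aestronglyMeasurable
    have h4' := covar_sub_left (hmk k) (hUB k) (hmk (k + 1)) (hUB (k + 1))
      (AdaptedLp.memLp_two hp (hAd.memLp_proj hp n k)).integrable_sq
    have h5 : covar P (U k) (fun ω => proj P 𝓕 X n k ω ^ 2)
        - covar P (U (k + 1)) (fun ω => proj P 𝓕 X n k ω ^ 2)
        ≤ 2 * (1 + gaussMoment (p - 2)) * E * (H (k + 1) * projBound α c n k ^ 2) := by
      rw [← h4']
      exact (le_abs_self _).trans h4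
    have h6 : lpNorm (step P 𝓕 X n (k + 1)) (ENNReal.ofReal p) P ^ p
        ≤ E * projBound α c n k ^ 2 := by
      have b1 := h.lpNorm_step_rpow_le α hp hm0 hm hη (i := k + 1) hk'
      have b2 := h.lpNorm_step_succ_le α hp hk'
      have b3 : (0 : ℝ) ≤ lpNorm (step P 𝓕 X n (k + 1)) (ENNReal.ofReal p) P := lpNorm_nonneg
      have b4 : lpNorm (step P 𝓕 X n (k + 1)) (ENNReal.ofReal p) P ^ p
          = lpNorm (step P 𝓕 X n (k + 1)) (ENNReal.ofReal p) P ^ (p - 2)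
            * lpNorm (step P 𝓕 X n (k + 1)) (ENNReal.ofReal p) P ^ 2 := by
        rw [← Real.rpow_natCast, ← Real.rpow_add' b3 (by norm_num; linarith)]
        norm_num
      rw [b4]
      gcongr
    have h7 : H (k + 1) * (1 + gaussMoment p)
          * lpNorm (step P 𝓕 X n (k + 1)) (ENNReal.ofReal p) P ^ p
        ≤ (1 + gaussMoment p) * E * (H (k + 1) * projBound α c n k ^ 2) := by
      have := gaussMoment_nonneg p
      calc _ ≤ H (k + 1) * (1 + gaussMoment p) * (E * projBound α c n k ^ 2) :=
            mul_le_mul_of_nonneg_left h6 (mul_nonneg (hH0 _ hk') (by positivity))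
        _ = _ := by ring
    have h8 : a (k + 1) - a k = covar P (U (k + 1)) (fun ω => proj P 𝓕 X n (k + 1) ω ^ 2)
        - covar P (U k) (fun ω => proj P 𝓕 X n k ω ^ 2) := rfl
    rw [h8]
    change _ ≤ covar P (U (k + 1)) (fun ω => step P 𝓕 X n (k + 1) ω ^ 2) / 2 + _ at h1
    rw [h2] at h1
    change covar P (U (k + 1)) (fun ω => X (k + 1) ω ^ 2)
      + 2 * covar P (U (k + 1)) (fun ω => X (k + 1) ω * tail X n (k + 1) ω)
      ≤ 2 * E * (H (k + 1) * _) at h3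
    refine h1.trans ?_
    change _ + H (k + 1) * (1 + gaussMoment p) * _ ≤ _
    linarith
  have hsum := Finset.sum_le_sum hstep
  rw [Finset.sum_range_sub (fun k => ∫ ω, gaussSmooth (w k) f (mart P 𝓕 X n (k + 1) ω) ∂P),
    Finset.sum_add_distrib, Finset.sum_add_distrib, ← Finset.mul_sum, ← Finset.mul_sum,
    ← Finset.sum_div, Finset.sum_range_sub] at hsum
  -- Both boundary terms vanish: the last projection is zero, and the first weight is constant
  -- because the martingale starts at 0.
  have han : a n = 0 := by
    simp only [ha, proj_self]
    simp [covar]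
  have ha0 : a 0 = 0 := by
    simp only [ha, hU, mart]
    exact covar_const_left _ _
  rw [han, ha0] at hsum
  have hwn : w n = A := by simp [hw, residVar_self]
  rw [hwn] at hsum
  have hm1 : ∀ ω, mart P 𝓕 X n (0 + 1) ω = proj P 𝓕 X n 0 ω := fun ω => by simp [mart]
  simp only [mart_top, hm1] at hsum
  have s1 := sum_mul_pairWeight_le (n := n) (α := α) h.lamb_nonneg hH0 hHm
  have s2 := sum_mul_projBound_sq_le (n := n) (α := α) h.c_nonneg hH0 hHm
  rw [hη] at s2
  have hκ1 := gaussMoment_nonneg p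
  have hκ2 := gaussMoment_nonneg (p - 2)
  refine hsum.trans ?_
  have t1 := mul_le_mul_of_nonneg_left s1 hE0
  have t2 := mul_le_mul_of_nonneg_left s2
    (show 0 ≤ (2 + gaussMoment (p - 2) + gaussMoment p) * E by positivity)
  refine (add_le_add (add_le_add t1 t2) le_rfl).trans (le_of_eq ?_)
  simp only [sub_self, zero_div, add_zero]
  ring

end Bounds

end ProjectiveBounds

end Lindeberg

/-! ### Comparison of the weighted sum of squares with an integral. -/

section Weights

lemma sum_Ioc_eq_sum_range (F : ℕ → ℝ) (n : ℕ) :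
    ∑ l ∈ Finset.Ioc 0 n, F l = ∑ k ∈ Finset.range n, F (k + 1) := by
  rw [Finset.range_eq_Ico, Finset.sum_Ico_add' F 0 n 1]
  refine Finset.sum_congr ?_ fun _ _ => rfl
  ext l
  simp only [Finset.mem_Ico, Finset.mem_Ioc]
  omega

/-- Concavity of `t ↦ t^q`, through Bernoulli's inequality: the left side bounds the integral of
`t^{q-1}` over `[x, y]` from below by the value at the right end. -/
lemma mul_rpow_le_sub_rpow {q x y : ℝ} (hq0 : 0 < q) (hq1 : q ≤ 1) (hx : 0 < x) (hxy : x ≤ y) :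
    (y - x) * y ^ (q - 1) ≤ (y ^ q - x ^ q) / q := by
  have hy : 0 < y := hx.trans_le hxy
  have h1 := rpow_one_add_le_one_add_mul_self (s := x / y - 1) (by
    have : 0 ≤ x / y := by positivity
    linarith) hq0.le hq1
  rw [add_sub_cancel, Real.div_rpow hx.le hy.le, div_le_iff₀ (by positivity)] at h1
  rw [le_div_iff₀ hq0, Real.rpow_sub_one hy.ne']
  have h2 : (1 + q * (x / y - 1)) * y ^ q = y ^ q - (y - x) * (y ^ q / y) * q := by
    field_simp
    ring
  linarith

lemma div_le_log_sub_log {x y : ℝ} (hx : 0 < x) (hxy : x ≤ y) :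
    (y - x) * y⁻¹ ≤ Real.log y - Real.log x := by
  have hy : 0 < y := hx.trans_le hxy
  have h1 := Real.log_le_sub_one_of_pos (x := x / y) (by positivity)
  rw [Real.log_div hx.ne' hy.ne'] at h1
  have h2 : (y - x) * y⁻¹ = 1 - x / y := by field_simp
  linarith

variable {α : ℕ → ℝ} {n : ℕ} {B : ℝ}

lemma sum_Ioc_sq_of_lt {k : ℕ} (hk : k < n) : ∑ j ∈ Finset.Ioc k n, α j ^ 2
    = α (k + 1) ^ 2 + ∑ j ∈ Finset.Ioc (k + 1) n, α j ^ 2 := by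
  simpa [tail] using tail_of_lt (X := fun l (_ : Unit) => α l ^ 2) hk ()

/-- Comparison of a weighted sum of squares with a telescoping sum. -/
lemma sum_rpow_mul_sq_le_telescope {s : ℝ} (hs0 : 0 ≤ s) (hs1 : s ≤ 1) (hB : 0 < B)
    (hα : ∀ l ∈ Finset.Ioc 0 n, α l ^ 2 ≤ B) {g : ℝ → ℝ}
    (hg : ∀ x y, 0 < x → x ≤ y → (y - x) * y ^ (-s) ≤ g y - g x) :
    ∑ l ∈ Finset.Ioc 0 n, (B + ∑ j ∈ Finset.Ioc l n, α j ^ 2) ^ (-s) * α l ^ 2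
      ≤ 2 * (g (B + ∑ j ∈ Finset.Ioc 0 n, α j ^ 2) - g B) := by
  set b := fun l => B + ∑ j ∈ Finset.Ioc l n, α j ^ 2 with hb
  have hb0 : ∀ l, B ≤ b l := fun l => by
    have : 0 ≤ ∑ j ∈ Finset.Ioc l n, α j ^ 2 := Finset.sum_nonneg fun _ _ => sq_nonneg _
    simp only [hb]
    linarith
  have hbn : b n = B := by simp [hb]
  rw [sum_Ioc_eq_sum_range]
  change ∑ k ∈ Finset.range n, b (k + 1) ^ (-s) * α (k + 1) ^ 2 ≤ 2 * (g (b 0) - g B)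
  have h1 : 2 * (g (b 0) - g B) = ∑ k ∈ Finset.range n, 2 * (g (b k) - g (b (k + 1))) := by
    rw [← Finset.mul_sum, Finset.sum_range_sub' (fun k => g (b k)), hbn]
  rw [h1]
  refine Finset.sum_le_sum fun k hk => ?_
  have hk' := Finset.mem_range.1 hk
  have hx : 0 < b (k + 1) := hB.trans_le (hb0 _)
  have hbk : b k = b (k + 1) + α (k + 1) ^ 2 := by
    simp only [hb]
    rw [sum_Ioc_sq_of_lt hk']
    ring
  have hy : 0 < b k := hB.trans_le (hb0 _)
  -- Since `α (k + 1) ^ 2 ≤ B ≤ b (k + 1)`, consecutive values of `b` differ at most by a factor 2,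
  -- so the weight can be evaluated at the other endpoint. With exponent at most 1 this costs the
  -- factor 2 of the statement.
  have hy2 : b k ≤ 2 * b (k + 1) := by
    have := hα (k + 1) (Finset.mem_Ioc.2 ⟨by omega, by omega⟩)
    have := hb0 (k + 1)
    linarith
  have h2 := hg (b (k + 1)) (b k) hx (by rw [hbk]; nlinarith [sq_nonneg (α (k + 1))])
  have h3 : b (k + 1) ^ (-s) ≤ 2 * b k ^ (-s) := by
    have h4 : (2 * b (k + 1)) ^ (-s) ≤ b k ^ (-s) :=
      Real.rpow_le_rpow_of_nonpos hy hy2 (by linarith)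
    rw [Real.mul_rpow two_pos.le hx.le] at h4
    have h5 : (1 / 2 : ℝ) ≤ 2 ^ (-s) := by
      have := Real.rpow_le_rpow_of_exponent_le (x := 2) one_le_two (neg_le_neg hs1)
      rwa [Real.rpow_neg_one, ← one_div] at this
    have h6 : (0 : ℝ) ≤ b (k + 1) ^ (-s) := by positivity
    nlinarith
  have h7 : b k - b (k + 1) = α (k + 1) ^ 2 := by rw [hbk]; ring
  rw [h7] at h2
  nlinarith [sq_nonneg (α (k + 1))]

lemma sum_rpow_mul_sq_le_rpow {p : ℝ} (hp2 : 2 < p) (hp3 : p < 3) (hB : 0 < B)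
    (hα : ∀ l ∈ Finset.Ioc 0 n, α l ^ 2 ≤ B) :
    ∑ l ∈ Finset.Ioc 0 n, (B + ∑ j ∈ Finset.Ioc l n, α j ^ 2) ^ (-((p - 1) / 2)) * α l ^ 2
      ≤ 4 / (3 - p) * (∑ j ∈ Finset.Ioc 0 n, α j ^ 2) ^ ((3 - p) / 2) := by
  set q := (3 - p) / 2 with hq
  have hq0 : 0 < q := by rw [hq]; linarith
  refine (sum_rpow_mul_sq_le_telescope (s := (p - 1) / 2) (by linarith) (by linarith) hB hα
    (g := fun x => x ^ q / q) fun x y hx hxy => ?_).trans ?_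
  · have := mul_rpow_le_sub_rpow hq0 (by rw [hq]; linarith) hx hxy
    rw [← sub_div]
    convert! this using 3
    rw [hq]; ring
  · set A := ∑ j ∈ Finset.Ioc 0 n, α j ^ 2
    have hA : 0 ≤ A := Finset.sum_nonneg fun _ _ => sq_nonneg _
    -- Subadditivity of `x ↦ x^q` bounds `(B + A)^q - B^q` by `A^q`, which removes the smoothing
    -- scale from the bound.
    have h1 := Real.rpow_add_le_add_rpow hB.le hA hq0.le (by rw [hq]; linarith)
    have h2 : 4 / (3 - p) = 2 / q := by
      rw [hq]; field_simp; norm_num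
    rw [h2, ← sub_div, div_mul_eq_mul_div, mul_div_assoc']
    gcongr
    linarith

lemma sum_inv_mul_sq_le_log {m : ℝ} (hm : 0 < m) (hB : m ^ 2 ≤ B)
    (hα : ∀ l ∈ Finset.Ioc 0 n, α l ^ 2 ≤ B) (hA : 2 * m ^ 2 ≤ ∑ j ∈ Finset.Ioc 0 n, α j ^ 2) :
    ∑ l ∈ Finset.Ioc 0 n, (B + ∑ j ∈ Finset.Ioc l n, α j ^ 2) ^ (-1 : ℝ) * α l ^ 2
      ≤ 4 * Real.log ((∑ j ∈ Finset.Ioc 0 n, α j ^ 2) / m ^ 2) := by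
  have hm2 : 0 < m ^ 2 := by positivity
  have hB0 : 0 < B := hm2.trans_le hB
  refine (sum_rpow_mul_sq_le_telescope (s := 1) zero_le_one le_rfl hB0 hα
    (g := Real.log) fun x y hx hxy => ?_).trans ?_
  · rw [Real.rpow_neg_one]
    exact div_le_log_sub_log hx hxy
  · set A := ∑ j ∈ Finset.Ioc 0 n, α j ^ 2
    have hA0 : 0 < A := by linarith
    have h2 : 2 ≤ A / m ^ 2 := by rwa [le_div_iff₀ hm2]
    -- With `x = A / m²` one has `(B + A) / B ≤ 1 + x ≤ x²`; the last inequality is where `x ≥ 2` is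
    -- needed.
    have h3 : Real.log (B + A) - Real.log B ≤ 2 * Real.log (A / m ^ 2) := by
      rw [← Real.log_div (by positivity) hB0.ne']
      have : 2 * Real.log (A / m ^ 2) = Real.log ((A / m ^ 2) ^ 2) := by
        rw [Real.log_pow]; norm_num
      rw [this]
      refine Real.log_le_log (by positivity) ?_
      have h4 : (B + A) / B = 1 + A / B := by field_simp
      have h5 : A / B ≤ A / m ^ 2 := by gcongr
      rw [h4]
      nlinarith
    linarith

end Weights

/-! ### From the smoothed comparison to a Lipschitz test function. -/

section Main

variable {Ω : Type*} {m0 : MeasurableSpace Ω} {P : Measure Ω} [IsProbabilityMeasure P]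
  {𝓕 : ℕ → MeasurableSpace Ω} {Y : ℕ → Ω → ℝ} {p : ℝ} {c c₂ lamb : ℕ → ℝ}

/-- The bound for a Lipschitz test function, before summation of the weights. -/
theorem ProjectiveBounds.integral_sub_integral_centeredGaussian_le
    (h : ProjectiveBounds P 𝓕 Y p c lamb) (hp : 2 < p) (hp3 : p ≤ 3)
    (hc₂ : ∀ k r, lpNorm (P[Y (k + r) | 𝓕 k]) 2 P ≤ c₂ r) (α : ℕ → ℝ) {n : ℕ} {m η δ κ K : ℝ}
    (hm0 : 0 < m) (hm : ∀ l ∈ Finset.Ioc 0 n, |α l| ≤ m)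
    (hη : ∑ r ∈ Finset.range (n + 1), c r = η) (hδ : ∑ r ∈ Finset.range (n + 1), c₂ r = δ)
    (hδ0 : 0 < δ) (hκ0 : 0 < κ) (hκ1 : κ ≤ 1 / 2) (hK : 2 ≤ K)
    (hκ : ∀ k, κ * ∑ l ∈ Finset.Ioc k n, α l ^ 2
      ≤ ∫ ω, tail (fun l ω => α l * Y l ω) n k ω ^ 2 ∂P)
    {f : ℝ → ℝ} (hf : LipschitzWith 1 f) :
    ∫ ω, f (∑ l ∈ Finset.Ioc 0 n, α l * Y l ω) ∂P
      - ∫ x, f x ∂(centeredGaussian (∫ ω, tail (fun l ω => α l * Y l ω) n 0 ω ^ 2 ∂P))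
    ≤ (2 * K + 2) * (m * δ)
      + (2 * m * η) ^ (p - 2) * (6 * (∑ j ∈ Finset.Icc 1 n, (j : ℝ) * lamb j)
        + 4 * (2 + gaussMoment (p - 2) + gaussMoment p) * η ^ 2)
        * (4 * κ ^ (-((p - 1) / 2)) * ∑ l ∈ Finset.Ioc 0 n,
          ((K * m * δ) ^ 2 + ∑ j ∈ Finset.Ioc l n, α j ^ 2) ^ (-((p - 1) / 2)) * α l ^ 2) := by
  set X := fun (l : ℕ) (ω : Ω) => α l * Y l ω with hX
  have hAd : AdaptedLp P 𝓕 X p := h.toAdaptedLp.const_mul α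
  set a := K * m * δ with ha
  have ha0 : 0 < a := by positivity
  have hY2 : ∀ k, MemLp (Y k) 2 P := fun k => AdaptedLp.memLp_two hp (h.memLp k)
  have hc₂0 : ∀ r, 0 ≤ c₂ r := fun r => lpNorm_nonneg.trans (hc₂ 0 r)
  have hproj : ∀ k, lpNorm (proj P 𝓕 X n k) 2 P ≤ m * δ := fun k => by
    refine (lpNorm_proj_le α one_le_two hY2 hc₂ n k).trans ?_
    rw [← hδ]
    calc _ ≤ ∑ l ∈ Finset.Ioc k n, m * c₂ (l - k) := by
          refine Finset.sum_le_sum fun l hl => mul_le_mul_of_nonneg_right (hm l ?_) (hc₂0 _)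
          simp only [Finset.mem_Ioc] at hl ⊢
          omega
      _ = m * ∑ l ∈ Finset.Ioc k n, c₂ (l - k) := by rw [Finset.mul_sum]
      _ ≤ _ := by
          refine mul_le_mul_of_nonneg_left (sum_comp_le_sum (φ := fun l => l - k) ?_ ?_
            fun j _ => hc₂0 j) hm0.le
          · intro a ha b hb hab
            simp only [Finset.coe_Ioc, Set.mem_Ioc] at ha hb hab
            omega
          · intro a ha
            simp only [Finset.mem_Ioc, Finset.mem_range] at ha ⊢
            omega
  have hp2 : ∀ k, MemLp (proj P 𝓕 X n k) 2 P := fun k =>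
    AdaptedLp.memLp_two hp (hAd.memLp_proj hp n k)
  have htail : ∀ k, ∫ ω, tail X n k ω ^ 2 ∂P
      = residVar P 𝓕 X n k + lpNorm (proj P 𝓕 X n k) 2 P ^ 2 := fun k => by
    rw [hAd.integral_tail_sq hp, integral_sq_eq_lpNorm_sq (hp2 k)]
  -- The residual variance is the second moment of the tail minus that of its projection, which is
  -- at most `(m δ)² ≤ a² / 4` because `K ≥ 2`. At least half of `a²` is left, which suffices since
  -- `κ ≤ 1 / 2`.
  have hw : ∀ k, κ * (a ^ 2 + ∑ j ∈ Finset.Ioc k n, α j ^ 2)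
      ≤ a ^ 2 + residVar P 𝓕 X n k := fun k => by
    have h1 := hκ k
    rw [htail k] at h1
    have h2 : lpNorm (proj P 𝓕 X n k) 2 P ^ 2 ≤ (m * δ) ^ 2 :=
      pow_le_pow_left₀ lpNorm_nonneg (hproj k) 2
    have h3 : a ^ 2 = K ^ 2 * (m * δ) ^ 2 := by rw [ha]; ring
    have h4 : 4 ≤ K ^ 2 := by nlinarith
    have h5 : 4 * (m * δ) ^ 2 ≤ a ^ 2 := by
      rw [h3]
      gcongr
    have h6 : κ * a ^ 2 ≤ 1 / 2 * a ^ 2 := by gcongr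
    linarith [sq_nonneg (m * δ)]
  have hη0 : 0 ≤ η := by rw [← hη]; exact Finset.sum_nonneg fun r _ => h.c_nonneg r
  have main := h.integral_gaussSmooth_sub_le α hp hm0.le hm hη hp3 hf (A := a ^ 2) (by positivity)
  have hsum : ∑ l ∈ Finset.Ioc 0 n,
        holderConst p (a ^ 2 + residVar P 𝓕 X n l) * α l ^ 2
      ≤ 4 * κ ^ (-((p - 1) / 2)) * ∑ l ∈ Finset.Ioc 0 n,
          (a ^ 2 + ∑ j ∈ Finset.Ioc l n, α j ^ 2) ^ (-((p - 1) / 2)) * α l ^ 2 := by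
    rw [Finset.mul_sum]
    refine Finset.sum_le_sum fun l _ => ?_
    have hA : 0 ≤ ∑ j ∈ Finset.Ioc l n, α j ^ 2 := Finset.sum_nonneg fun _ _ => sq_nonneg _
    have h1 := holderConst_anti hp (by positivity) (hw l)
    rw [← mul_assoc]
    refine mul_le_mul_of_nonneg_right (h1.trans (le_of_eq ?_)) (sq_nonneg _)
    rw [holderConst, Real.mul_rpow hκ0.le (by positivity), mul_assoc]
  have hΛ0 : 0 ≤ ∑ j ∈ Finset.Icc 1 n, (j : ℝ) * lamb j := Finset.sum_nonneg fun j hj =>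
    mul_nonneg (Nat.cast_nonneg j) (h.lamb_nonneg j (Finset.mem_Icc.1 hj).1)
  have hg1 := gaussMoment_nonneg p
  have hg2 := gaussMoment_nonneg (p - 2)
  have hE0 : 0 ≤ (2 * m * η) ^ (p - 2) := Real.rpow_nonneg (by positivity) _
  have main' := main.trans (mul_le_mul_of_nonneg_left hsum (by positivity))
  have hSi : Integrable (fun ω => ∑ l ∈ Finset.Ioc 0 n, α l * Y l ω) P :=
    integrable_finsetSum _ fun l _ => ((hY2 l).integrable one_le_two).const_mul _
  set w₀ := a ^ 2 + residVar P 𝓕 X n 0 with hw₀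
  have hrv := residVar_nonneg (P := P) (𝓕 := 𝓕) (X := X) (n := n) (k := 0)
  have hw₀0 : 0 ≤ w₀ := by positivity
  set S := fun ω => ∑ l ∈ Finset.Ioc 0 n, α l * Y l ω with hS
  set V := ∫ ω, tail X n 0 ω ^ 2 ∂P with hV
  have hV0 : 0 ≤ V := integral_nonneg fun _ => sq_nonneg _
  have hLip := lipschitzWith_gaussSmooth hf
  have b1 : ∫ ω, f (S ω) ∂P - ∫ ω, gaussSmooth (a ^ 2) f (S ω) ∂P ≤ a := by
    rw [← integral_sub (integrable_comp_of_lipschitz hf hSi)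
      (integrable_comp_of_lipschitz (hLip _) hSi)]
    refine (integral_mono ((integrable_comp_of_lipschitz hf hSi).sub
      (integrable_comp_of_lipschitz (hLip _) hSi)) (integrable_const a) fun ω => ?_).trans
      (by simp)
    have := (abs_le.1 (abs_gaussSmooth_sub_le hf (sq_nonneg a) (S ω))).1
    rw [Real.sqrt_sq ha0.le] at this
    simp only [Pi.sub_apply]
    linarith
  set r := lpNorm (proj P 𝓕 X n 0) 2 P with hr
  have hr0 : 0 ≤ r := lpNorm_nonneg
  have hpi : Integrable (proj P 𝓕 X n 0) P := (hp2 0).integrable one_le_two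
  -- The martingale is at `E(S_n | F_0)` when the replacement begins; moving this value to 0 costs
  -- its norm.
  have b2 : ∫ ω, gaussSmooth w₀ f (proj P 𝓕 X n 0 ω) ∂P - gaussSmooth w₀ f 0 ≤ m * δ := by
    have i1 := integrable_comp_of_lipschitz (hLip w₀) hpi
    have e : ∫ ω, gaussSmooth w₀ f (proj P 𝓕 X n 0 ω) ∂P - gaussSmooth w₀ f 0
        = ∫ ω, (gaussSmooth w₀ f (proj P 𝓕 X n 0 ω) - gaussSmooth w₀ f 0) ∂P := by
      rw [integral_sub i1 (integrable_const _)]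
      simp
    rw [e]
    refine (integral_mono (i1.sub (integrable_const _)) hpi.abs fun ω => ?_).trans
      (((integral_abs_le_sqrt (hp2 0)).trans (le_of_eq (sqrt_integral_sq_eq_lpNorm (hp2 0)))).trans
        (hproj 0))
    have := (hLip w₀).dist_le_mul (proj P 𝓕 X n 0 ω) 0
    simp only [Real.dist_eq, NNReal.coe_one, one_mul, sub_zero] at this
    exact (le_abs_self _).trans this
  -- The full variance `V` exceeds the residual variance at time 0 by the squared norm `r²` of the
  -- same projection; it is restored by one more smoothing.
  have b3 : gaussSmooth w₀ f 0 - gaussSmooth (a ^ 2 + V) f 0 ≤ m * δ := by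
    have e : a ^ 2 + V = r ^ 2 + w₀ := by rw [hV, htail 0, hw₀]; ring
    rw [e, ← gaussSmooth_gaussSmooth hf (sq_nonneg r) hw₀0]
    have := (abs_le.1 (abs_gaussSmooth_sub_le (hLip w₀) (sq_nonneg r) 0)).1
    rw [Real.sqrt_sq hr0] at this
    linarith [hproj 0]
  have b4 : gaussSmooth (a ^ 2 + V) f 0 - ∫ x, f x ∂(centeredGaussian V) ≤ a := by
    rw [← gaussSmooth_gaussSmooth hf (sq_nonneg a) hV0]
    have := (abs_le.1 (abs_gaussSmooth_sub_le (hLip V) (sq_nonneg a) 0)).2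
    rw [Real.sqrt_sq ha0.le] at this
    have e : gaussSmooth V f 0 = ∫ x, f x ∂(centeredGaussian V) := by simp [gaussSmooth]
    rw [← e]
    exact this
  have e5 : (2 * K + 2) * (m * δ) = 2 * a + 2 * (m * δ) := by rw [ha]; ring
  rw [e5]
  change ∫ ω, f (S ω) ∂P - _ ≤ _
  change ∫ ω, gaussSmooth (a ^ 2) f (S ω) ∂P - _ ≤ _ at main'
  linarith

end Main

/-! ### Transfer of stationarity to conditional expectations. -/

section Stationary

/-- Conditional expectation commutes with measure preserving maps. -/
lemma condExp_comp_measurePreserving {Ω Ω' : Type*} {m0 : MeasurableSpace Ω}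
    {m' m0' : MeasurableSpace Ω'} {P : Measure Ω} {μ : Measure Ω'} [IsFiniteMeasure P]
    [IsFiniteMeasure μ] {T : Ω → Ω'} (hT : MeasurePreserving T P μ)
    (hm' : m' ≤ m0') {f : Ω' → ℝ} (hf : Integrable f μ) :
    P[fun ω => f (T ω) | m'.comap T] =ᵐ[P] fun ω => (μ[f | m']) (T ω) := by
  have hle : m'.comap T ≤ m0 :=
    (MeasurableSpace.comap_mono hm').trans hT.measurable.comap_le
  have hfT : Integrable (fun ω => f (T ω)) P := hT.integrable_comp_of_integrable hf
  have hgT : Integrable (fun ω => (μ[f | m']) (T ω)) P :=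
    hT.integrable_comp_of_integrable integrable_condExp
  refine (ae_eq_condExp_of_forall_setIntegral_eq hle hfT (fun s _ _ => hgT.integrableOn) ?_
    ?_).symm
  · rintro s ⟨t, ht, rfl⟩ -
    have h1 : ∀ {g : Ω' → ℝ}, AEStronglyMeasurable[m0'] g μ →
        ∫ ω in T ⁻¹' t, g (T ω) ∂P = ∫ x in t, g x ∂μ := fun {g} hg => by
      rw [← hT.map_eq, setIntegral_map (hm' t ht) (by rwa [hT.map_eq])
        hT.measurable.aemeasurable]
    rw [h1 integrable_condExp.aestronglyMeasurable, h1 hf.aestronglyMeasurable,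
      setIntegral_condExp hm' hf ht]
  · exact (stronglyMeasurable_condExp.comp_measurable
      (comap_measurable T)).aestronglyMeasurable

lemma lpNorm_comp_measurePreserving {Ω Ω' : Type*} {m0 : MeasurableSpace Ω}
    {m0' : MeasurableSpace Ω'} {P : Measure Ω} {μ : Measure Ω'} {T : Ω → Ω'}
    (hT : MeasurePreserving T P μ) {g : Ω' → ℝ} (hg : AEStronglyMeasurable g μ) (q : ℝ≥0∞) :
    lpNorm (fun ω => g (T ω)) q P = lpNorm g q μ := by
  rw [← toReal_eLpNorm hg,
    ← toReal_eLpNorm (f := fun ω => g (T ω)) (hg.comp_measurePreserving hT)]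
  exact congrArg _ (eLpNorm_comp_measurePreserving hg hT)

variable {Ω : Type*} [MeasurableSpace Ω] {P : Measure Ω} [IsProbabilityMeasure P]
  {Y : ℤ → Ω → ℝ}

/-- The path of the process, shifted by `h`. -/
def path (Y : ℤ → Ω → ℝ) (h : ℤ) (ω : Ω) : ℤ → ℝ := fun i => Y (i + h) ω

omit [IsProbabilityMeasure P] in
lemma measurePreserving_path (hYm : ∀ i, Measurable (Y i)) (hY : StrictlyStationary P Y) (h : ℤ) :
    MeasurePreserving (path Y h) P (P.map (path Y 0)) := by
  refine ⟨measurable_pi_lambda _ fun i => hYm _, ?_⟩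
  have := hY h
  unfold path
  simpa using this

omit [MeasurableSpace Ω] in
-- The past up to time `h` is the pullback of the canonical past up to time 0, so all shifts are
-- read from one model on path space.
lemma comap_path (h : ℤ) :
    (past (fun (i : ℤ) (x : ℤ → ℝ) => x i) 0).comap (path Y h) = past Y h := by
  unfold past
  simp only [MeasurableSpace.comap_iSup, MeasurableSpace.comap_comp]
  refine le_antisymm (iSup₂_le fun i hi => ?_) (iSup₂_le fun i hi => ?_)
  · exact le_iSup₂_of_le (i + h) (by omega) le_rfl
  · refine le_iSup₂_of_le (i - h) (by omega) (le_of_eq ?_)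
    congr 1
    ext ω
    simp [path]

lemma past_le (hYm : ∀ i, Measurable (Y i)) (k : ℤ) : past Y k ≤ ‹MeasurableSpace Ω› :=
  iSup₂_le fun i _ => (hYm i).comap_le

omit [MeasurableSpace Ω] in
lemma past_mono {k l : ℤ} (hkl : k ≤ l) : past Y k ≤ past Y l :=
  iSup₂_le fun i hi => le_iSup₂_of_le (f := fun (i : ℤ) (_ : i ≤ l) =>
    MeasurableSpace.comap (Y i) inferInstance) i (hi.trans hkl) le_rfl

omit [MeasurableSpace Ω] in
lemma measurable_past {i k : ℤ} (hik : i ≤ k) : Measurable[past Y k] (Y i) :=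
  measurable_iff_comap_le.2 (le_iSup₂_of_le (f := fun (i : ℤ) (_ : i ≤ k) =>
    MeasurableSpace.comap (Y i) inferInstance) i hik le_rfl)

variable (hYm : ∀ i, Measurable (Y i)) (hY : StrictlyStationary P Y)

include hYm hY

omit [IsProbabilityMeasure P] in
lemma integrable_comp_path_iff {g : (ℤ → ℝ) → ℝ} (hg : Measurable g) (h : ℤ) :
    Integrable (fun ω => g (path Y h ω)) P ↔ Integrable g (P.map (path Y 0)) :=
  (measurePreserving_path hYm hY h).integrable_comp hg.aestronglyMeasurable

omit [IsProbabilityMeasure P] in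
lemma integral_comp_path {g : (ℤ → ℝ) → ℝ} (hg : Measurable g) (h : ℤ) :
    ∫ ω, g (path Y h ω) ∂P = ∫ x, g x ∂(P.map (path Y 0)) := by
  rw [← (measurePreserving_path hYm hY h).map_eq, integral_map
    (measurePreserving_path hYm hY h).measurable.aemeasurable hg.aestronglyMeasurable]

/-- The conditional expectation at time `h` is a fixed function, independent of `h`, of the shifted
path, whose law is also independent of `h`. -/
lemma condExp_comp_path {g : (ℤ → ℝ) → ℝ} (hg : Integrable g (P.map (path Y 0))) (h : ℤ) :
    P[fun ω => g (path Y h ω) | past Y h] =ᵐ[P] fun ω =>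
      ((P.map (path Y 0))[g | past (fun (i : ℤ) (x : ℤ → ℝ) => x i) 0]) (path Y h ω) := by
  have hp := measurePreserving_path hYm hY h
  have : IsProbabilityMeasure (P.map (path Y 0)) :=
    Measure.isProbabilityMeasure_map (measurePreserving_path hYm hY 0).measurable.aemeasurable
  rw [← comap_path]
  exact condExp_comp_measurePreserving hp (past_le (fun i => measurable_pi_apply i) 0) hg

/-- The norms of the projections on the past do not depend on the time origin. -/
lemma lpNorm_condExp_shift (hYi : ∀ i, Integrable (Y i) P) (q : ℝ≥0∞) (h r : ℤ) :
    lpNorm (P[Y (r + h) | past Y h]) q P = lpNorm (P[Y r | past Y 0]) q P := by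
  have hg : Integrable (fun x : ℤ → ℝ => x r) (P.map (path Y 0)) :=
    (integrable_comp_path_iff hYm hY (measurable_pi_apply r) h).1 (hYi _)
  -- The right side is a norm on path space in which `h` does not occur; comparing with `h = 0`
  -- concludes.
  have key : ∀ h, lpNorm (P[Y (r + h) | past Y h]) q P = lpNorm ((P.map (path Y 0))[fun x => x r |
      past (fun (i : ℤ) (x : ℤ → ℝ) => x i) 0]) q (P.map (path Y 0)) := fun h => by
    rw [← lpNorm_comp_measurePreserving (measurePreserving_path hYm hY h)
      integrable_condExp.aestronglyMeasurable]
    exact lpNorm_congr_ae (condExp_comp_path hYm hY hg h)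
  have h0 := key 0
  rw [add_zero] at h0
  rw [key h, h0]

lemma lpNorm_mul_condExp_shift (hYi : ∀ i, Integrable (Y i) P) (q : ℝ≥0∞) (h r : ℤ) :
    lpNorm (fun ω => Y h ω * (P[Y (r + h) | past Y h]) ω) q P
      = lpNorm (fun ω => Y 0 ω * (P[Y r | past Y 0]) ω) q P := by
  have hg : Integrable (fun x : ℤ → ℝ => x r) (P.map (path Y 0)) :=
    (integrable_comp_path_iff hYm hY (measurable_pi_apply r) h).1 (hYi _)
  have key : ∀ h, lpNorm (fun ω => Y h ω * (P[Y (r + h) | past Y h]) ω) q P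
      = lpNorm (fun x => x 0 * ((P.map (path Y 0))[fun x => x r |
        past (fun (i : ℤ) (x : ℤ → ℝ) => x i) 0]) x) q (P.map (path Y 0)) := fun h => by
    rw [← lpNorm_comp_measurePreserving (measurePreserving_path hYm hY h)
      (g := fun x => x 0 * ((P.map (path Y 0))[fun x => x r |
        past (fun (i : ℤ) (x : ℤ → ℝ) => x i) 0]) x)
      ((measurable_pi_apply 0).aestronglyMeasurable.mul
        integrable_condExp.aestronglyMeasurable)]
    refine lpNorm_congr_ae ?_
    filter_upwards [condExp_comp_path hYm hY hg h] with ω hω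
    simp only [path, zero_add] at hω ⊢
    rw [← hω]
  have h0 := key 0
  rw [add_zero] at h0
  rw [key h, h0]

lemma lpNorm_condExp_mul_sub_shift (hYi : ∀ i j, Integrable (fun ω => Y i ω * Y j ω) P)
    (q : ℝ≥0∞) (h i j : ℤ) :
    lpNorm (fun ω => (P[fun ω' => Y (i + h) ω' * Y (j + h) ω' | past Y h]) ω
        - ∫ ω', Y (i + h) ω' * Y (j + h) ω' ∂P) q P
      = lpNorm (fun ω => (P[fun ω' => Y i ω' * Y j ω' | past Y 0]) ω
        - ∫ ω', Y i ω' * Y j ω' ∂P) q P := by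
  have hm : Measurable fun x : ℤ → ℝ => x i * x j :=
    (measurable_pi_apply i).mul (measurable_pi_apply j)
  have hg : Integrable (fun x : ℤ → ℝ => x i * x j) (P.map (path Y 0)) :=
    (integrable_comp_path_iff hYm hY hm h).1 (hYi _ _)
  have key : ∀ h, lpNorm (fun ω => (P[fun ω' => Y (i + h) ω' * Y (j + h) ω' | past Y h]) ω
        - ∫ ω', Y (i + h) ω' * Y (j + h) ω' ∂P) q P
      = lpNorm (fun x => ((P.map (path Y 0))[fun x => x i * x j |
        past (fun (i : ℤ) (x : ℤ → ℝ) => x i) 0]) x - ∫ x, x i * x j ∂(P.map (path Y 0))) q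
        (P.map (path Y 0)) := fun h => by
    rw [← lpNorm_comp_measurePreserving (measurePreserving_path hYm hY h)
      (g := fun x => ((P.map (path Y 0))[fun x => x i * x j |
        past (fun (i : ℤ) (x : ℤ → ℝ) => x i) 0]) x - ∫ x, x i * x j ∂(P.map (path Y 0)))
      (integrable_condExp.aestronglyMeasurable.sub aestronglyMeasurable_const)]
    refine lpNorm_congr_ae ?_
    have h1 := integral_comp_path hYm hY hm h
    filter_upwards [condExp_comp_path hYm hY hg h] with ω hω
    rw [← hω, ← h1]
    rfl
  have h0 := key 0
  simp only [add_zero] at h0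
  rw [key h, h0]

omit [IsProbabilityMeasure P] in
lemma integral_mul_shift (h i j : ℤ) :
    ∫ ω, Y (i + h) ω * Y (j + h) ω ∂P = ∫ ω, Y i ω * Y j ω ∂P := by
  have hm : Measurable fun x : ℤ → ℝ => x i * x j :=
    (measurable_pi_apply i).mul (measurable_pi_apply j)
  have h1 := integral_comp_path hYm hY hm h
  have h0 := integral_comp_path hYm hY hm 0
  simp only [path, add_zero] at h0 h1
  rw [h1, h0]

omit [IsProbabilityMeasure P] in
lemma eLpNorm_shift (q : ℝ≥0∞) (h : ℤ) : eLpNorm (Y h) q P = eLpNorm (Y 0) q P := by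
  have key : ∀ h, eLpNorm (Y h) q P = eLpNorm (fun x : ℤ → ℝ => x 0) q (P.map (path Y 0)) :=
    fun h => by
    rw [← eLpNorm_comp_measurePreserving (measurable_pi_apply 0).aestronglyMeasurable
      (measurePreserving_path hYm hY h)]
    congr 1
    ext ω
    simp [path]
  rw [key h, key 0]

variable {p : ℝ} (hp : 2 < p) (hYp : ∀ i, MemLp (Y i) (ENNReal.ofReal p) P)

include hp hYp

/-- A bound uniform in `i` and `j`, by Hölder and stationarity: it makes the supremum in `lam`
finite. -/
lemma eLpNorm_condExp_mul_sub_le (i j : ℤ) :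
    eLpNorm (fun ω => (P[fun ω' => Y i ω' * Y j ω' | past Y 0]) ω - ∫ ω', Y i ω' * Y j ω' ∂P)
        (ENNReal.ofReal (p / 2)) P ≤ 2 * eLpNorm (Y 0) (ENNReal.ofReal p) P ^ 2 := by
  have hp0 : 0 < p := by linarith
  have h1 : (1 : ℝ≥0∞) ≤ ENNReal.ofReal (p / 2) := by rw [ENNReal.one_le_ofReal]; linarith
  have := holderTriple_half hp0
  set Q := fun ω => Y i ω * Y j ω with hQ
  have hQp : MemLp Q (ENNReal.ofReal (p / 2)) P := memLp_mul_half hp0 (hYp i) (hYp j)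
  have hQn : eLpNorm Q (ENNReal.ofReal (p / 2)) P ≤ eLpNorm (Y 0) (ENNReal.ofReal p) P ^ 2 := by
    have := eLpNorm_smul_le_mul_eLpNorm (p := ENNReal.ofReal p) (q := ENNReal.ofReal p)
      (r := ENNReal.ofReal (p / 2)) (hYp j).aestronglyMeasurable (hYp i).aestronglyMeasurable
    rw [eLpNorm_shift hYm hY _ i, eLpNorm_shift hYm hY _ j, ← sq] at this
    exact this
  have hc : eLpNorm (fun _ : Ω => ∫ ω', Q ω' ∂P) (ENNReal.ofReal (p / 2)) P
      ≤ eLpNorm Q (ENNReal.ofReal (p / 2)) P := by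
    rw [eLpNorm_const _ (by positivity) (IsProbabilityMeasure.ne_zero P)]
    simp only [measure_univ, ENNReal.one_rpow, mul_one]
    refine (enorm_integral_le_lintegral_enorm Q).trans ?_
    rw [← eLpNorm_one_eq_lintegral_enorm]
    exact eLpNorm_le_eLpNorm_of_exponent_le h1 hQp.aestronglyMeasurable
  refine (eLpNorm_sub_le (integrable_condExp.aestronglyMeasurable) aestronglyMeasurable_const
    h1).trans ?_
  rw [two_mul]
  exact add_le_add ((eLpNorm_condExp_le_eLpNorm _ h1).trans hQn) (hc.trans hQn)

/-- A stationary sequence satisfies the projective bounds with its own coefficients. -/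
theorem projectiveBounds_of_stationary :
    ProjectiveBounds P (fun k : ℕ => past Y k) (fun k : ℕ => Y k) p (condNorm P Y p)
      (lam P Y p) where
  mono k l hkl := past_mono (by exact_mod_cast hkl)
  le k := past_le hYm k
  meas k := (measurable_past le_rfl).stronglyMeasurable
  memLp k := hYp k
  cond k r := by
    have hYi : ∀ i, Integrable (Y i) P := fun i =>
      (hYp i).integrable (by rw [ENNReal.one_le_ofReal]; linarith)
    have := lpNorm_condExp_shift hYm hY hYi (ENNReal.ofReal p) k r
    rw [condNorm, ← this]
    push_cast
    rw [add_comm]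
  cross k r _ := by
    have hYi : ∀ i, Integrable (Y i) P := fun i =>
      (hYp i).integrable (by rw [ENNReal.one_le_ofReal]; linarith)
    have := lpNorm_mul_condExp_shift hYm hY hYi (ENNReal.ofReal (p / 2)) k r
    refine le_trans (le_of_eq ?_) (le_max_left _ _)
    rw [← this]
    push_cast
    rw [add_comm]
  pair i j r _ := by
    have hYi : ∀ i j, Integrable (fun ω => Y i ω * Y j ω) P := fun i j =>
      integrable_mul_of_memLp_two (AdaptedLp.memLp_two hp (hYp i))
        (AdaptedLp.memLp_two hp (hYp j))
    have h1 := lpNorm_condExp_mul_sub_shift hYm hY hYi (ENNReal.ofReal (p / 2)) i j (j + r)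
    have h2 : lpNorm (fun ω => (P[fun ω' => Y j ω' * Y (j + r) ω' | past Y 0]) ω
        - ∫ ω', Y j ω' * Y (j + r) ω' ∂P) (ENNReal.ofReal (p / 2)) P ≤ lam P Y p j := by
      refine le_trans ?_ (le_max_right _ _)
      rw [← toReal_eLpNorm (f := fun ω => (P[fun ω' => Y j ω' * Y (j + r) ω' | past Y 0]) ω
        - ∫ ω', Y j ω' * Y (j + r) ω' ∂P) (integrable_condExp.aestronglyMeasurable.sub
        aestronglyMeasurable_const)]
      refine ENNReal.toReal_mono ?_ (le_iSup_of_le (j : ℤ) (le_iSup_of_le ((j : ℤ) + r)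
        (le_iSup_of_le ⟨le_rfl, by omega⟩ le_rfl)))
      -- Finiteness is essential here, because `toReal` would send an infinite supremum to 0 and the
      -- comparison would fail.
      refine ne_top_of_le_ne_top (b := 2 * eLpNorm (Y 0) (ENNReal.ofReal p) P ^ 2) ?_
        (iSup_le fun i => iSup_le fun j => iSup_le fun _ =>
          eLpNorm_condExp_mul_sub_le hYm hY hp hYp i j)
      exact ENNReal.mul_ne_top (by simp) (ENNReal.pow_ne_top (hYp 0).eLpNorm_ne_top)
    rw [← h1] at h2
    have e1 : ((i + j : ℕ) : ℤ) = j + i := by push_cast; ring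
    have e2 : ((i + j + r : ℕ) : ℤ) = j + r + i := by push_cast; ring
    simp only [e1, e2]
    exact h2

end Stationary

/-! ### Toeplitz quadratic forms and their symbol. -/

section Spectral

open Real

/-- The cosine series with coefficients `γ`. -/
noncomputable def cosSeries (γ : ℤ → ℝ) (θ : ℝ) : ℝ := ∑' k : ℤ, γ k * cos (k * θ)

lemma integral_cos_int_mul (j : ℤ) :
    ∫ θ in (-π)..π, cos (j * θ) = if j = 0 then 2 * π else 0 := by
  split_ifs with hj
  · simp [hj]; ring
  · have hj' : (j : ℝ) ≠ 0 := by exact_mod_cast hj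
    rw [intervalIntegral.integral_comp_mul_left (fun x => cos x) hj', integral_cos]
    have h : sin ((j : ℝ) * π) = 0 := sin_int_mul_pi j
    simp [h]

lemma integral_cos_mul_cos (k d : ℤ) :
    ∫ θ in (-π)..π, cos (k * θ) * cos (d * θ)
      = π * ((if k = d then 1 else 0) + (if k = -d then 1 else 0)) := by
  have h : ∀ θ : ℝ, cos (k * θ) * cos (d * θ)
      = 1 / 2 * (cos (((k - d : ℤ) : ℝ) * θ) + cos (((k + d : ℤ) : ℝ) * θ)) := fun θ => by
    push_cast
    rw [sub_mul, add_mul, cos_sub, cos_add]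
    ring
  simp_rw [h]
  rw [intervalIntegral.integral_const_mul, intervalIntegral.integral_add
    (Continuous.intervalIntegrable (by fun_prop) _ _)
    (Continuous.intervalIntegrable (by fun_prop) _ _), integral_cos_int_mul, integral_cos_int_mul]
  simp only [sub_eq_zero, add_eq_zero_iff_eq_neg]
  split_ifs <;> ring

variable {γ : ℤ → ℝ} (hγ : Summable fun k => |γ k|)

lemma abs_mul_cos_le (a x : ℝ) : ‖a * cos x‖ ≤ |a| := by
  rw [norm_mul, Real.norm_eq_abs, Real.norm_eq_abs]
  exact mul_le_of_le_one_right (abs_nonneg _) (abs_cos_le_one _)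

include hγ

lemma summable_mul_cos (θ : ℝ) : Summable fun k : ℤ => γ k * cos (k * θ) :=
  Summable.of_norm_bounded hγ fun k => abs_mul_cos_le (γ k) _

lemma continuous_cosSeries : Continuous (cosSeries γ) :=
  continuous_tsum (fun k => by fun_prop) hγ fun k θ => abs_mul_cos_le (γ k) _

lemma abs_cosSeries_le (θ : ℝ) : |cosSeries γ θ| ≤ ∑' k, |γ k| :=
  tsum_of_norm_bounded hγ.hasSum fun k => abs_mul_cos_le (γ k) _

/-- Fourier inversion by termwise integration. Both `k = d` and `k = -d` contribute, and evenness
merges them, also when `d = 0`. -/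
lemma integral_cosSeries_mul_cos (heven : ∀ k, γ (-k) = γ k) (d : ℤ) :
    ∫ θ in (-π)..π, cosSeries γ θ * cos (d * θ) = 2 * π * γ d := by
  have h1 : HasSum (fun k : ℤ => ∫ θ in (-π)..π, γ k * (cos (k * θ) * cos (d * θ)))
      (∫ θ in (-π)..π, cosSeries γ θ * cos (d * θ)) := by
    refine intervalIntegral.hasSum_integral_of_dominated_convergence (fun k _ => |γ k|)
      (fun k => (Continuous.aestronglyMeasurable (by fun_prop)))
      (fun k => ae_of_all _ fun θ _ => ?_) (ae_of_all _ fun θ _ => hγ)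
      intervalIntegrable_const (ae_of_all _ fun θ _ => ?_)
    · rw [← mul_assoc, norm_mul]
      exact (mul_le_of_le_one_right (norm_nonneg _) (abs_cos_le_one _)).trans
        (abs_mul_cos_le _ _)
    · have := (summable_mul_cos hγ θ).hasSum.mul_right (cos (d * θ))
      simp only [mul_assoc] at this
      exact this
  have h2 : HasSum (fun k : ℤ => ∫ θ in (-π)..π, γ k * (cos (k * θ) * cos (d * θ)))
      (π * (γ d + γ (-d))) := by
    have e : ∀ k : ℤ, ∫ θ in (-π)..π, γ k * (cos (k * θ) * cos (d * θ))
        = π * ((if k = d then γ k else 0) + (if k = -d then γ k else 0)) := fun k => by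
      rw [intervalIntegral.integral_const_mul, integral_cos_mul_cos]
      split_ifs <;> ring
    simp_rw [e]
    refine HasSum.mul_left _ (HasSum.add ?_ ?_)
    · convert! hasSum_ite_eq d (γ d) using 2 with k
      split_ifs with h <;> simp [h]
    · convert! hasSum_ite_eq (-d) (γ (-d)) using 2 with k
      split_ifs with h <;> simp [h]
  rw [h1.unique h2, heven]
  ring

/-- Only the modulus is assumed bounded below. The series is continuous and its integral `2π γ 0` is
nonnegative, so it is nonnegative somewhere; a negative value would then force a zero by the
intermediate value theorem. -/
lemma le_cosSeries (heven : ∀ k, γ (-k) = γ k) (h0 : 0 ≤ γ 0) {c : ℝ} (hc : 0 < c)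
    (hG : ∀ θ ∈ Set.Icc (-π) π, c ≤ |cosSeries γ θ|) :
    ∀ θ ∈ Set.Icc (-π) π, c ≤ cosSeries γ θ := by
  have hcont := continuous_cosSeries hγ
  have hπ := pi_pos
  obtain ⟨θ₀, hθ₀, hpos⟩ : ∃ θ₀ ∈ Set.Icc (-π) π, 0 ≤ cosSeries γ θ₀ := by
    by_contra! hneg
    have hI := integral_cosSeries_mul_cos hγ heven 0
    simp only [Int.cast_zero, zero_mul, cos_zero, mul_one] at hI
    have : 0 < ∫ θ in (-π)..π, -cosSeries γ θ :=
      intervalIntegral.intervalIntegral_pos_of_pos_on (hcont.neg.intervalIntegrable _ _)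
        (fun θ hθ => by have := hneg θ ⟨hθ.1.le, hθ.2.le⟩; linarith) (by linarith)
    rw [intervalIntegral.integral_neg, hI] at this
    have : 0 ≤ 2 * π * γ 0 := by positivity
    linarith
  intro θ hθ
  rcases le_abs.1 (hG θ hθ) with h | h
  · exact h
  obtain ⟨x, hx, hx0⟩ : ∃ x ∈ Set.Icc (-π) π, cosSeries γ x = 0 :=
    isPreconnected_Icc.intermediate_value hθ hθ₀ hcont.continuousOn
      (show (0 : ℝ) ∈ Set.Icc (cosSeries γ θ) (cosSeries γ θ₀) from ⟨by linarith, hpos⟩)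
  have := hG x hx
  rw [hx0, abs_zero] at this
  linarith

omit hγ in
lemma sum_sum_mul_cos_sub (s : Finset ℕ) (β : ℕ → ℝ) (θ : ℝ) :
    ∑ l ∈ s, ∑ m ∈ s, β l * β m * cos (((l : ℤ) - (m : ℤ) : ℤ) * θ)
      = (∑ l ∈ s, β l * cos (l * θ)) ^ 2 + (∑ l ∈ s, β l * sin (l * θ)) ^ 2 := by
  simp only [sq, Finset.sum_mul_sum, ← Finset.sum_add_distrib]
  refine Finset.sum_congr rfl fun l _ => Finset.sum_congr rfl fun m _ => ?_
  push_cast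
  rw [sub_mul, cos_sub]
  ring

/-- Toeplitz quadratic forms are controlled by their symbol. -/
lemma sum_sum_mul_bounds (heven : ∀ k, γ (-k) = γ k) {a b : ℝ}
    (hG : ∀ θ ∈ Set.Icc (-π) π, a ≤ cosSeries γ θ ∧ cosSeries γ θ ≤ b)
    (s : Finset ℕ) (β : ℕ → ℝ) :
    a * ∑ l ∈ s, β l ^ 2 ≤ ∑ l ∈ s, ∑ m ∈ s, β l * β m * γ ((l : ℤ) - m) ∧
      ∑ l ∈ s, ∑ m ∈ s, β l * β m * γ ((l : ℤ) - m) ≤ b * ∑ l ∈ s, β l ^ 2 := by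
  have hcont := continuous_cosSeries hγ
  have hπ := pi_pos
  -- The squared modulus of the trigonometric polynomial with coefficients `β`. It is nonnegative
  -- and, integrated against the symbol, reproduces the quadratic form.
  set T : ℝ → ℝ := fun θ =>
    ∑ l ∈ s, ∑ m ∈ s, β l * β m * cos (((l : ℤ) - (m : ℤ) : ℤ) * θ) with hT
  have hTc : Continuous T := by rw [hT]; fun_prop
  have hT0 : ∀ θ, 0 ≤ T θ := fun θ => by
    simp only [hT, sum_sum_mul_cos_sub]; positivity
  have hTi : ∫ θ in (-π)..π, T θ = 2 * π * ∑ l ∈ s, β l ^ 2 := by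
    simp only [hT]
    rw [intervalIntegral.integral_finsetSum
      fun l _ => Continuous.intervalIntegrable (by fun_prop) _ _, Finset.mul_sum]
    refine Finset.sum_congr rfl fun l hl => ?_
    rw [intervalIntegral.integral_finsetSum
      fun m _ => Continuous.intervalIntegrable (by fun_prop) _ _]
    simp_rw [intervalIntegral.integral_const_mul, integral_cos_int_mul, sub_eq_zero, Nat.cast_inj]
    simp [hl]
    ring
  have hGT : ∫ θ in (-π)..π, cosSeries γ θ * T θ
      = 2 * π * ∑ l ∈ s, ∑ m ∈ s, β l * β m * γ ((l : ℤ) - m) := by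
    simp only [hT, Finset.mul_sum]
    rw [intervalIntegral.integral_finsetSum
      fun l _ => Continuous.intervalIntegrable (by fun_prop) _ _]
    refine Finset.sum_congr rfl fun l hl => ?_
    rw [intervalIntegral.integral_finsetSum
      fun m _ => Continuous.intervalIntegrable (by fun_prop) _ _]
    refine Finset.sum_congr rfl fun m hm => ?_
    have e : ∀ θ, cosSeries γ θ * (β l * β m * cos (((l : ℤ) - (m : ℤ) : ℤ) * θ))
        = β l * β m * (cosSeries γ θ * cos (((l : ℤ) - (m : ℤ) : ℤ) * θ)) := fun θ => by ring
    simp_rw [e]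
    rw [intervalIntegral.integral_const_mul, integral_cosSeries_mul_cos hγ heven]
    ring
  have hle : -π ≤ π := by linarith
  constructor
  · have := intervalIntegral.integral_mono_on (μ := volume) (f := fun θ => a * T θ)
      (g := fun θ => cosSeries γ θ * T θ) hle
      (Continuous.intervalIntegrable (by fun_prop) _ _)
      (Continuous.intervalIntegrable (by fun_prop) _ _)
      fun θ hθ => mul_le_mul_of_nonneg_right (hG θ hθ).1 (hT0 θ)
    rw [intervalIntegral.integral_const_mul, hTi, hGT] at this
    have h2 : 0 < 2 * π := by positivity
    refine le_of_mul_le_mul_left ?_ h2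
    linarith
  · have := intervalIntegral.integral_mono_on (μ := volume) (f := fun θ => cosSeries γ θ * T θ)
      (g := fun θ => b * T θ) hle
      (Continuous.intervalIntegrable (by fun_prop) _ _)
      (Continuous.intervalIntegrable (by fun_prop) _ _)
      fun θ hθ => mul_le_mul_of_nonneg_right (hG θ hθ).2 (hT0 θ)
    rw [intervalIntegral.integral_const_mul, hTi, hGT] at this
    have h2 : 0 < 2 * π := by positivity
    refine le_of_mul_le_mul_left ?_ h2
    linarith

/-- Adding the series to its image under `k ↦ -k` cancels the sines and counts the cosines twice. -/
lemma tsum_mul_cexp_eq_cosSeries (heven : ∀ k, γ (-k) = γ k) (θ : ℝ) :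
    ∑' k : ℤ, (γ k : ℂ) * Complex.exp (Complex.I * (k : ℂ) * (θ : ℂ)) = (cosSeries γ θ : ℂ) := by
  set F : ℤ → ℂ := fun k => (γ k : ℂ) * Complex.exp (Complex.I * (k : ℂ) * (θ : ℂ)) with hF
  have hFs : Summable F := by
    refine Summable.of_norm_bounded hγ fun k => ?_
    have : Complex.I * (k : ℂ) * (θ : ℂ) = ((k * θ : ℝ) : ℂ) * Complex.I := by push_cast; ring
    simp only [hF]
    rw [norm_mul, this, Complex.norm_exp_ofReal_mul_I, mul_one, Complex.norm_real,
      Real.norm_eq_abs]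
  have hneg : ∑' k : ℤ, F (-k) = ∑' k, F k := (Equiv.neg ℤ).tsum_eq F
  have hFn : Summable fun k : ℤ => F (-k) := (Equiv.neg ℤ).summable_iff.2 hFs
  have h2 : ∑' k : ℤ, F k + ∑' k : ℤ, F k = ((cosSeries γ θ + cosSeries γ θ : ℝ) : ℂ) := by
    nth_rw 2 [← hneg]
    have hs := summable_mul_cos hγ θ
    rw [← hFs.tsum_add hFn, cosSeries, ← hs.tsum_add hs, Complex.ofReal_tsum]
    refine tsum_congr fun k => ?_
    simp only [hF, heven]
    have := Complex.two_cos ((k * θ : ℝ) : ℂ)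
    push_cast at this ⊢
    rw [← mul_add, ← mul_add, ← two_mul, this]
    ring_nf
  push_cast at h2
  linear_combination h2 / 2

end Spectral

/-! ### Variance of linear combinations of the process. -/

section Autocovariance

variable {Ω : Type*} [MeasurableSpace Ω] {P : Measure Ω} [IsProbabilityMeasure P]
  {Y : ℤ → Ω → ℝ} (hYm : ∀ i, Measurable (Y i)) (hY : StrictlyStationary P Y)
  (hY2 : ∀ i, MemLp (Y i) 2 P) (hYc : ∀ i, ∫ ω, Y i ω ∂P = 0)

include hY2 hYc

lemma autocov_eq_integral (k : ℤ) : autocov P Y k = ∫ ω, Y 0 ω * Y k ω ∂P := by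
  rw [autocov, covariance_eq_sub (hY2 0) (hY2 k), hYc, hYc]
  simp

include hYm hY

lemma integral_mul_eq_autocov (i j : ℤ) : ∫ ω, Y i ω * Y j ω ∂P = autocov P Y (j - i) := by
  have := integral_mul_shift hYm hY i 0 (j - i)
  rw [zero_add, sub_add_cancel] at this
  rw [this, autocov_eq_integral hY2 hYc]

lemma autocov_neg (k : ℤ) : autocov P Y (-k) = autocov P Y k := by
  have h := integral_mul_eq_autocov hYm hY hY2 hYc k 0
  rw [zero_sub] at h
  rw [← h, autocov_eq_integral hY2 hYc]
  simp_rw [mul_comm]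

lemma integral_sum_sq (s : Finset ℕ) (β : ℕ → ℝ) :
    ∫ ω, (∑ l ∈ s, β l * Y l ω) ^ 2 ∂P
      = ∑ l ∈ s, ∑ m ∈ s, β l * β m * autocov P Y ((l : ℤ) - m) := by
  have e : ∀ ω, (∑ l ∈ s, β l * Y l ω) ^ 2
      = ∑ l ∈ s, ∑ m ∈ s, β l * β m * (Y m ω * Y l ω) := fun ω => by
    rw [sq, Finset.sum_mul_sum]
    refine Finset.sum_congr rfl fun l _ => Finset.sum_congr rfl fun m _ => by ring
  have hi : ∀ l m : ℕ, Integrable (fun ω => β l * β m * (Y m ω * Y l ω)) P := fun l m =>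
    (integrable_mul_of_memLp_two (hY2 m) (hY2 l)).const_mul _
  simp_rw [e]
  rw [integral_finsetSum _ fun l _ => integrable_finsetSum _ fun m _ => hi l m]
  refine Finset.sum_congr rfl fun l _ => ?_
  rw [integral_finsetSum _ fun m _ => hi l m]
  refine Finset.sum_congr rfl fun m _ => ?_
  rw [integral_const_mul, integral_mul_eq_autocov hYm hY hY2 hYc]

/-- If the spectral density is bounded away from zero and the autocovariances are summable, the
variance of a linear statistic is comparable to the sum of the squares of its coefficients. -/
theorem exists_bounds_integral_sum_sq (hcov : Summable fun k : ℕ => |autocov P Y (k : ℤ)|)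
    (hspec : 0 < ⨅ t : Set.Icc (-Real.pi) Real.pi, ‖spectralDensity P Y (t : ℝ)‖) :
    ∃ κ Γ : ℝ, 0 < κ ∧ ∀ (s : Finset ℕ) (β : ℕ → ℝ),
      κ * ∑ l ∈ s, β l ^ 2 ≤ ∫ ω, (∑ l ∈ s, β l * Y l ω) ^ 2 ∂P ∧
        ∫ ω, (∑ l ∈ s, β l * Y l ω) ^ 2 ∂P ≤ Γ * ∑ l ∈ s, β l ^ 2 := by
  have heven := autocov_neg hYm hY hY2 hYc
  have hγ : Summable fun k : ℤ => |autocov P Y k| :=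
    Summable.of_nat_of_neg hcov (by simpa only [heven] using hcov)
  have hπ := Real.pi_pos
  set c := ⨅ t : Set.Icc (-Real.pi) Real.pi, ‖spectralDensity P Y (t : ℝ)‖ with hc
  have h0 : 0 ≤ autocov P Y 0 := by
    rw [autocov_eq_integral hY2 hYc]
    exact integral_nonneg fun ω => mul_self_nonneg _
  -- The factor `2π` undoes the normalization of the spectral density.
  have hG : ∀ θ ∈ Set.Icc (-Real.pi) Real.pi,
      2 * Real.pi * c ≤ |cosSeries (autocov P Y) θ| := fun θ hθ => by
    have h1 : c ≤ ‖spectralDensity P Y θ‖ :=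
      ciInf_le (f := fun t : Set.Icc (-Real.pi) Real.pi => ‖spectralDensity P Y (t : ℝ)‖)
        ⟨0, by rintro _ ⟨t, rfl⟩; exact norm_nonneg _⟩ ⟨θ, hθ⟩
    rw [spectralDensity, tsum_mul_cexp_eq_cosSeries hγ heven, norm_mul, Complex.norm_real,
      Real.norm_eq_abs] at h1
    have h2 : ‖(1 / (2 * (Real.pi : ℂ)))‖ = 1 / (2 * Real.pi) := by
      rw [norm_div, norm_mul, Complex.norm_real, Real.norm_of_nonneg hπ.le]
      simp
    rw [h2, one_div, ← div_eq_inv_mul, le_div_iff₀ (by positivity)] at h1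
    linarith
  refine ⟨2 * Real.pi * c, ∑' k, |autocov P Y k|, by positivity, fun s β => ?_⟩
  rw [integral_sum_sq hYm hY hY2 hYc]
  exact sum_sum_mul_bounds hγ heven (fun θ hθ =>
    ⟨le_cosSeries hγ heven h0 (by positivity) hG θ hθ,
      (le_abs_self _).trans (abs_cosSeries_le hγ θ)⟩) s β

end Autocovariance

/-! ### Wasserstein bounds for a random variable, and the trivial bound. -/

section Wasserstein

variable {Ω : Type*} [MeasurableSpace Ω] {P : Measure Ω} [IsProbabilityMeasure P] {S : Ω → ℝ}

lemma wasserstein1_map_centeredGaussian_le (hSm : Measurable S) (hS : Integrable S P) (v : ℝ)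
    {K : ℝ} (h : ∀ f : ℝ → ℝ, LipschitzWith 1 f →
      ∫ ω, f (S ω) ∂P - ∫ x, f x ∂(centeredGaussian v) ≤ K) :
    wasserstein1 (P.map S) (centeredGaussian v) ≤ ENNReal.ofReal K := by
  have : IsProbabilityMeasure (P.map S) := Measure.isProbabilityMeasure_map hSm.aemeasurable
  refine wasserstein1_le ?_ (integrable_id_centeredGaussian v) fun f hf => ?_
  · rw [integrable_map_measure (by fun_prop) hSm.aemeasurable]
    exact hS
  · rw [integral_map hSm.aemeasurable hf.continuous.aestronglyMeasurable]
    exact h f hf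

/-- A square integrable variable and the centered normal law with the same second moment are at
distance at most twice its norm. -/
lemma integral_sub_integral_centeredGaussian_le_two_mul_sqrt (hS : MemLp S 2 P) {f : ℝ → ℝ}
    (hf : LipschitzWith 1 f) :
    ∫ ω, f (S ω) ∂P - ∫ x, f x ∂(centeredGaussian (∫ ω, S ω ^ 2 ∂P))
      ≤ 2 * √(∫ ω, S ω ^ 2 ∂P) := by
  set v := ∫ ω, S ω ^ 2 ∂P with hv
  have hv0 : 0 ≤ v := integral_nonneg fun ω => sq_nonneg _
  have hSi : Integrable S P := hS.integrable one_le_two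
  have hab : ∀ x, |f x - f 0| ≤ |x| := fun x => by
    simpa [Real.dist_eq] using hf.dist_le_mul x 0
  have h1 : ∫ ω, f (S ω) ∂P ≤ f 0 + √v := by
    calc ∫ ω, f (S ω) ∂P ≤ ∫ ω, (f 0 + |S ω|) ∂P :=
          integral_mono (integrable_comp_of_lipschitz hf hSi)
            ((integrable_const _).add hSi.abs) fun ω => by
              have := (abs_le.1 (hab (S ω))).2
              simp only
              linarith
      _ = f 0 + ∫ ω, |S ω| ∂P := by rw [integral_add (integrable_const _) hSi.abs]; simp
      _ ≤ f 0 + √v := by gcongr; exact integral_abs_le_sqrt hS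
  have hid : Integrable (fun x : ℝ => x) (centeredGaussian v) := integrable_id_centeredGaussian v
  have h2 : f 0 - √v ≤ ∫ x, f x ∂(centeredGaussian v) := by
    calc f 0 - √v ≤ f 0 - ∫ x, |x| ∂(centeredGaussian v) := by
          gcongr; exact integral_abs_centeredGaussian_le hv0
      _ = ∫ x, (f 0 - |x|) ∂(centeredGaussian v) := by
          rw [integral_sub (integrable_const _) hid.abs]; simp
      _ ≤ ∫ x, f x ∂(centeredGaussian v) :=
          integral_mono ((integrable_const _).sub hid.abs)
            (integrable_comp_of_lipschitz hf hid) fun x => by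
              have := (abs_le.1 (hab x)).1
              simp only
              linarith
  linarith

end Wasserstein

/-! ### The triangular array and the last factor of the bound. -/

section Array

variable (α : ℕ → ℕ → ℝ) (n : ℕ)

lemma Icc_one_eq_Ioc_zero : Finset.Icc 1 n = Finset.Ioc 0 n := by
  ext; simp only [Finset.mem_Icc, Finset.mem_Ioc]; omega

lemma maxCoeff_nonneg : 0 ≤ maxCoeff α n := NNReal.coe_nonneg _

lemma abs_le_maxCoeff {l : ℕ} (hl : l ∈ Finset.Icc 1 n) : |α l n| ≤ maxCoeff α n := by
  have : ‖α l n‖₊ ≤ (Finset.Icc 1 n).sup fun l => ‖α l n‖₊ :=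
    Finset.le_sup (f := fun l => ‖α l n‖₊) hl
  exact_mod_cast this

lemma maxCoeff_sq_le_sumSq (hn : 1 ≤ n) : maxCoeff α n ^ 2 ≤ sumSq α n := by
  obtain ⟨l, hl, he⟩ := Finset.exists_mem_eq_sup (Finset.Icc 1 n) ⟨1, by simpa using hn⟩
    fun l => ‖α l n‖₊
  rw [maxCoeff, he, coe_nnnorm, Real.norm_eq_abs, sq_abs]
  exact Finset.single_le_sum (f := fun l => α l n ^ 2) (fun l _ => sq_nonneg _) hl

/-- The last factor of `boundB`. -/
noncomputable def spreadFactor (p : ℝ) : ℝ :=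
  if p < 3 then sumSq α n ^ ((3 - p) / 2) else Real.log (sumSq α n / maxCoeff α n ^ 2)

lemma sumSq_nonneg : 0 ≤ sumSq α n := Finset.sum_nonneg fun _ _ => sq_nonneg _

lemma spreadFactor_nonneg (hn : 1 ≤ n) (p : ℝ) : 0 ≤ spreadFactor α n p := by
  unfold spreadFactor
  split_ifs with h
  · exact Real.rpow_nonneg (sumSq_nonneg α n) _
  · rcases (maxCoeff_nonneg α n).eq_or_lt with h0 | h0
    -- For vanishing coefficients the quotient is `0 / 0 = 0`, and `Real.log 0 = 0`.
    · simp [← h0]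
    · refine Real.log_nonneg ?_
      rw [le_div_iff₀ (by positivity), one_mul]
      exact maxCoeff_sq_le_sumSq α n hn

/-- At `p = 3` the powers `p - 2` are first powers, so both cases share one formula and the final
estimate need not distinguish them. -/
lemma boundB_eq {Ω : Type*} [MeasurableSpace Ω] (P : Measure Ω) (Y : ℤ → Ω → ℝ) {p : ℝ}
    (hp : p ≤ 3) :
    boundB P Y α p n = maxCoeff α n ^ (p - 2) * eta P Y p n ^ (p - 2)
      * (bigLam P Y p n + eta P Y p n ^ 2) * spreadFactor α n p := by
  unfold boundB spreadFactor
  split_ifs with h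
  · rfl
  · obtain rfl : p = 3 := le_antisymm hp (not_lt.1 h)
    norm_num

variable {α n}

/-- The condition `ha` keeps each squared coefficient below `a²`, as the telescoping requires; `hA`
keeps the logarithm at `p = 3` bounded away from 0. -/
lemma sum_rpow_mul_sq_le_spreadFactor {p : ℝ} (hp2 : 2 < p) (hp3 : p ≤ 3)
    (hm : 0 < maxCoeff α n) {a : ℝ} (ha : maxCoeff α n ≤ a)
    (hA : 2 * maxCoeff α n ^ 2 ≤ sumSq α n) :
    ∑ l ∈ Finset.Ioc 0 n, (a ^ 2 + ∑ j ∈ Finset.Ioc l n, α j n ^ 2) ^ (-((p - 1) / 2)) * α l n ^ 2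
      ≤ (if p < 3 then 4 / (3 - p) else 4) * spreadFactor α n p := by
  have hB : ∀ l ∈ Finset.Ioc 0 n, α l n ^ 2 ≤ a ^ 2 := fun l hl => by
    rw [← Icc_one_eq_Ioc_zero] at hl
    rw [← sq_abs]
    have := (abs_le_maxCoeff α n hl).trans ha
    gcongr
  unfold spreadFactor
  rw [sumSq, Icc_one_eq_Ioc_zero] at *
  split_ifs with h
  · exact sum_rpow_mul_sq_le_rpow (α := fun l => α l n) hp2 h (by nlinarith) hB
  · obtain rfl : p = 3 := le_antisymm hp3 (not_lt.1 h)
    have := sum_inv_mul_sq_le_log (α := fun l => α l n) hm (B := a ^ 2) (by gcongr) hB hA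
    norm_num at this ⊢
    exact this

end Array

/-! ### Moments of the linear statistic. -/

section Statistic

variable {Ω : Type*} [MeasurableSpace Ω] {P : Measure Ω} [IsProbabilityMeasure P]
  {Y : ℤ → Ω → ℝ} {α : ℕ → ℕ → ℝ}

omit [IsProbabilityMeasure P] in
lemma memLp_linStat {q : ℝ≥0∞} (hY : ∀ i, MemLp (Y i) q P) (n : ℕ) : MemLp (linStat Y α n) q P :=
  memLp_finsetSum _ fun i _ => (hY i).const_mul _

lemma measurable_linStat (hY : ∀ i, Measurable (Y i)) (n : ℕ) : Measurable (linStat Y α n) := by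
  unfold linStat
  exact Finset.measurable_sum _ fun i _ => (hY i).const_mul _

omit [IsProbabilityMeasure P] in
lemma integral_linStat (hYi : ∀ i, Integrable (Y i) P) (hYc : ∀ i, ∫ ω, Y i ω ∂P = 0) (n : ℕ) :
    ∫ ω, linStat Y α n ω ∂P = 0 := by
  unfold linStat
  rw [integral_finsetSum _ fun (i : ℕ) _ => (hYi i).const_mul _]
  simp [integral_const_mul, hYc]

omit [IsProbabilityMeasure P] in
lemma variance_linStat (hYm : ∀ i, Measurable (Y i)) (hYi : ∀ i, Integrable (Y i) P)
    (hYc : ∀ i, ∫ ω, Y i ω ∂P = 0) (n : ℕ) :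
    Var[linStat Y α n; P] = ∫ ω, linStat Y α n ω ^ 2 ∂P :=
  variance_of_integral_eq_zero (measurable_linStat hYm n).aemeasurable
    (integral_linStat hYi hYc n)

omit [IsProbabilityMeasure P] in
lemma condNorm_nonneg (q : ℝ) (k : ℕ) : 0 ≤ condNorm P Y q k := lpNorm_nonneg

lemma condNorm_two_zero (hYm : ∀ i, Measurable (Y i)) (hY2 : ∀ i, MemLp (Y i) 2 P) :
    condNorm P Y 2 0 = √(∫ ω, Y 0 ω ^ 2 ∂P) := by
  rw [sqrt_integral_sq_eq_lpNorm (hY2 0), condNorm, Nat.cast_zero,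
    condExp_of_stronglyMeasurable (past_le hYm 0) (measurable_past le_rfl).stronglyMeasurable
      ((hY2 0).integrable one_le_two), ENNReal.ofReal_ofNat]

end Statistic

end LinearStatistic

/-! ### Choice of the constants and conclusion. -/

open LinearStatistic in
set_option maxHeartbeats 1000000 in
theorem corollary4p1 {Ω : Type*} [MeasurableSpace Ω] (P : Measure Ω) [IsProbabilityMeasure P]
    (p : ℝ) (hp2 : 2 < p) (hp3 : p ≤ 3)
    (Y : ℤ → Ω → ℝ) (hYmeas : ∀ i, Measurable (Y i))
    (hYstat : LinearStatistic.StrictlyStationary P Y)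
    (hYp : ∀ i, MemLp (Y i) (ENNReal.ofReal p) P)
    (hYcent : ∀ i, ∫ ω, Y i ω ∂P = 0)
    (hcov : Summable fun k : ℕ => |LinearStatistic.autocov P Y (k : ℤ)|)
    (hspec : 0 < ⨅ t : Set.Icc (-Real.pi) Real.pi, ‖LinearStatistic.spectralDensity P Y (t : ℝ)‖)
    (α : ℕ → ℕ → ℝ) :
    ∃ C : ℝ, 0 < C ∧ ∀ n : ℕ, 1 ≤ n →
      LinearStatistic.wasserstein1 (P.map (LinearStatistic.linStat Y α n))
          (LinearStatistic.centeredGaussian (Var[LinearStatistic.linStat Y α n; P]))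
        ≤ ENNReal.ofReal (C *
            (LinearStatistic.maxCoeff α n
                * ∑ k ∈ Finset.range (n + 1), LinearStatistic.condNorm P Y 2 k
              + LinearStatistic.boundB P Y α p n)) := by
  have hY2 : ∀ i, MemLp (Y i) 2 P := fun i => AdaptedLp.memLp_two hp2 (hYp i)
  have hYi : ∀ i, Integrable (Y i) P := fun i => (hY2 i).integrable one_le_two
  obtain ⟨κ, Γ, hκ, hQ⟩ := exists_bounds_integral_sum_sq hYmeas hYstat hY2 hYcent hcov hspec
  have hPB := projectiveBounds_of_stationary hYmeas hYstat hp2 hYp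
  set s := condNorm P Y 2 0 with hs
  have hs0 : 0 < s := by
    rw [hs, condNorm_two_zero hYmeas hY2]
    refine Real.sqrt_pos.2 ?_
    -- The quadratic form on the single index 0: the variance of `Y 0` is at least `κ`, so the
    -- process is not degenerate.
    have := (hQ {0} fun _ => 1).1
    simp only [Finset.sum_singleton, one_pow, mul_one, one_mul, Nat.cast_zero] at this
    linarith
  set κ' := min (1 / 2) κ with hκ'
  have hκ'0 : 0 < κ' := lt_min (by norm_num) hκ
  -- The part `2` lets `a = K m δ` absorb the projections; the part `1 / s`, with `δ ≥ s`, makes `a`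
  -- at least `m`.
  set K := 2 + 1 / s with hK
  have hK2 : 2 ≤ K := by rw [hK]; have : 0 < 1 / s := by positivity
                         linarith
  have hKs : 1 ≤ K * s := by
    rw [hK, add_mul, one_div, inv_mul_cancel₀ hs0.ne']; linarith
  set g := 4 * (2 + gaussMoment (p - 2) + gaussMoment p) with hg
  have hg0 : 0 ≤ g := by
    have := gaussMoment_nonneg (p - 2)
    have := gaussMoment_nonneg p
    positivity
  set D : ℝ := if p < 3 then 4 / (3 - p) else 4 with hD
  have hD0 : 0 ≤ D := by
    rw [hD]; split_ifs with h
    · have : 0 < 3 - p := by linarith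
      positivity
    · norm_num
  set C₁ := 2 * √(2 * |Γ|) / s with hC₁
  set C₂ := 2 ^ (p - 2) * (6 + g) * (4 * κ' ^ (-((p - 1) / 2)) * D) with hC₂
  have hC₁0 : 0 ≤ C₁ := by positivity
  have hC₂0 : 0 ≤ C₂ := by positivity
  refine ⟨C₁ + (2 * K + 2) + C₂, by positivity, fun n hn => ?_⟩
  set m := maxCoeff α n with hm
  set δ := ∑ k ∈ Finset.range (n + 1), condNorm P Y 2 k with hδ
  set η := eta P Y p n with hη
  set R := spreadFactor α n p with hR
  have hm0 : 0 ≤ m := maxCoeff_nonneg α n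
  have hsδ : s ≤ δ :=
    Finset.single_le_sum (f := fun k => condNorm P Y 2 k) (fun k _ => condNorm_nonneg 2 k)
      (Finset.mem_range.2 (Nat.succ_pos n))
  have hδ0 : 0 < δ := hs0.trans_le hsδ
  have hη0 : 0 ≤ η := Finset.sum_nonneg fun k _ => condNorm_nonneg p k
  have hR0 : 0 ≤ R := spreadFactor_nonneg α n hn p
  have hΛ0 : 0 ≤ bigLam P Y p n := Finset.sum_nonneg fun j hj =>
    mul_nonneg (Nat.cast_nonneg j) (hPB.lamb_nonneg j (Finset.mem_Icc.1 hj).1)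
  have hB : boundB P Y α p n = m ^ (p - 2) * η ^ (p - 2) * (bigLam P Y p n + η ^ 2) * R :=
    boundB_eq α n P Y hp3
  have hB0 : 0 ≤ boundB P Y α p n := by rw [hB]; positivity
  have hmδ0 : 0 ≤ m * δ := by positivity
  rw [variance_linStat hYmeas hYi hYcent]
  refine wasserstein1_map_centeredGaussian_le (measurable_linStat hYmeas n)
    ((memLp_linStat hY2 n).integrable one_le_two) _ fun f hf => ?_
  -- If the coefficients are concentrated, `V_n ≤ 2 |Γ| m²` and the trivial bound `2 √V_n` is at
  -- most `C₁ m s ≤ C₁ m δ`; `boundB` is not needed, and may be zero.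
  rcases le_total (sumSq α n) (2 * m ^ 2) with hA | hA
  · refine (integral_sub_integral_centeredGaussian_le_two_mul_sqrt (memLp_linStat hY2 n)
      hf).trans ?_
    have h1 : ∫ ω, linStat Y α n ω ^ 2 ∂P ≤ 2 * |Γ| * m ^ 2 := by
      calc ∫ ω, linStat Y α n ω ^ 2 ∂P ≤ Γ * sumSq α n :=
            (hQ (Finset.Icc 1 n) fun l => α l n).2
        _ ≤ |Γ| * (2 * m ^ 2) := by
            have := sumSq_nonneg α n
            gcongr
            exact le_abs_self Γ
        _ = _ := by ring
    have h2 : 2 * √(∫ ω, linStat Y α n ω ^ 2 ∂P) ≤ C₁ * (m * s) := by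
      calc 2 * √(∫ ω, linStat Y α n ω ^ 2 ∂P) ≤ 2 * √(2 * |Γ| * m ^ 2) := by gcongr
        _ = C₁ * (m * s) := by
            rw [Real.sqrt_mul (by positivity), Real.sqrt_sq hm0, hC₁]
            field_simp
    calc 2 * √(∫ ω, linStat Y α n ω ^ 2 ∂P) ≤ C₁ * (m * δ) := h2.trans (by gcongr)
      _ ≤ (C₁ + (2 * K + 2) + C₂) * (m * δ + boundB P Y α p n) := by
          gcongr <;> linarith
  -- If `m = 0` the statistic vanishes identically. Otherwise the smoothing scale `K m δ` is
  -- positive and the Lindeberg bound applies.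
  · rcases hm0.eq_or_lt with hm0' | hm0'
    · have h1 : ∀ l ∈ Finset.Icc 1 n, α l n = 0 := fun l hl => by
        have := abs_le_maxCoeff α n hl
        rw [← hm, ← hm0'] at this
        exact abs_nonpos_iff.1 this
      have h2 : ∀ ω, linStat Y α n ω = 0 := fun ω =>
        Finset.sum_eq_zero fun l hl => by rw [h1 l hl, zero_mul]
      refine (integral_sub_integral_centeredGaussian_le_two_mul_sqrt (memLp_linStat hY2 n)
        hf).trans ?_
      simp only [h2]
      simp only [ne_eq, OfNat.ofNat_ne_zero, not_false_eq_true, zero_pow, integral_zero,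
        Real.sqrt_zero, mul_zero]
      positivity
    · have hc₂ : ∀ k r : ℕ, lpNorm (P[(fun j : ℕ => Y j) (k + r) | past Y k]) 2 P
          ≤ condNorm P Y 2 r := fun k r => by
        have := lpNorm_condExp_shift hYmeas hYstat hYi 2 k r
        rw [condNorm, ENNReal.ofReal_ofNat, ← this]
        push_cast
        rw [add_comm]
      have hma : m ≤ K * m * δ := by
        calc m = m * 1 := (mul_one m).symm
          _ ≤ m * (K * s) := by gcongr
          _ ≤ m * (K * δ) := by gcongr
          _ = K * m * δ := by ring
      have main := hPB.integral_sub_integral_centeredGaussian_le hp2 hp3 hc₂ (fun l => α l n)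
        (n := n) hm0' (fun l hl => abs_le_maxCoeff α n (by rwa [Icc_one_eq_Ioc_zero])) hη.symm
        hδ.symm hδ0 hκ'0 (min_le_left _ _) hK2 (fun k => le_trans
          (mul_le_mul_of_nonneg_right (min_le_right _ _)
            (Finset.sum_nonneg fun _ _ => sq_nonneg _))
          (hQ (Finset.Ioc k n) fun l => α l n).1) hf
      have hsum := sum_rpow_mul_sq_le_spreadFactor hp2 hp3 hm0' hma hA
      unfold linStat
      rw [Icc_one_eq_Ioc_zero]
      refine main.trans ?_
      have e : (2 * m * η) ^ (p - 2) = 2 ^ (p - 2) * (m ^ (p - 2) * η ^ (p - 2)) := by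
        rw [mul_assoc, Real.mul_rpow (by norm_num) (by positivity), Real.mul_rpow hm0 hη0]
      have h6 : 6 * bigLam P Y p n + g * η ^ 2 ≤ (6 + g) * (bigLam P Y p n + η ^ 2) := by
        have : 0 ≤ g * bigLam P Y p n := by positivity
        nlinarith [sq_nonneg η]
      have hX : (2 * m * η) ^ (p - 2) * (6 * bigLam P Y p n + g * η ^ 2)
          * (4 * κ' ^ (-((p - 1) / 2)) * ∑ l ∈ Finset.Ioc 0 n,
            ((K * m * δ) ^ 2 + ∑ j ∈ Finset.Ioc l n, α j n ^ 2) ^ (-((p - 1) / 2)) * α l n ^ 2)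
          ≤ (2 * m * η) ^ (p - 2) * ((6 + g) * (bigLam P Y p n + η ^ 2))
            * (4 * κ' ^ (-((p - 1) / 2)) * (D * R)) := by
        refine mul_le_mul (mul_le_mul_of_nonneg_left h6 (by positivity))
          (mul_le_mul_of_nonneg_left hsum (by positivity)) ?_ (by positivity)
        exact mul_nonneg (by positivity) (Finset.sum_nonneg fun l _ =>
          mul_nonneg (Real.rpow_nonneg (by positivity) _) (sq_nonneg _))
      have hCB : (2 * m * η) ^ (p - 2) * ((6 + g) * (bigLam P Y p n + η ^ 2))
          * (4 * κ' ^ (-((p - 1) / 2)) * (D * R)) = C₂ * boundB P Y α p n := by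
        rw [e, hB, hC₂]
        ring
      refine (add_le_add_right (hX.trans_eq hCB) _).trans ?_
      have h1 : 0 ≤ (C₁ + C₂) * (m * δ) := by positivity
      have h2 : 0 ≤ (C₁ + (2 * K + 2)) * boundB P Y α p n := mul_nonneg (by positivity) hB0
      linarith
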